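/- Let $V$ be a vertex operator algebra over $\mathbb C$. Let $\mathcal D$ be one of the following categories: $\mathcal C(V)$, the weak $V$-modules $W$ on which $L(0)$ is semisimple with finite-dimensional eigenspaces $W_h$ such that for every $h\in\mathbb C$, $W_{h+n}=0$ for all sufficiently small integers $n$; or $\mathcal C^1(V)$, the weak $V$-modules on which $L(0)$ is locally finite with all generalized weights in a finite union of sets $h_i+\mathbb Z_{\ge 0}$. For $X$ in $\mathcal D$ with generalized $L(0)$-weight spaces $X_h$, let $X'=\bigoplus_h (X_h)^*$. Let $W_1,W_2,W_3$ be in $\mathcal D$, and let $(W_{12},F_{12})$, $(W_{12,3},F_{12,3})$, $(W_{23},F_{23})$, $(W_{1,23},F_{1,23})$ be tensor products in $\mathcal D$ of the ordered pairs $(W_1,W_2)$, $(W_{12},W_3)$, $(W_2,W_3)$, $(W_1,W_{23})$ respectively: each consists of an object of $\mathcal D$ and an intertwining operator which is universal among the intertwining operators from the given pair to objects of $\mathcal D$. Let $c(z_1,z_2)$ be a formal series in complex powers of $z_1,z_2$ that converges absolutely for $|z_1|>|z_2|>0$ and whose sum extends analytically to a multivalued function $$\sum_{i=1}^k z_2^{r_i}(z_1-z_2)^{s_i}f_i\!\left(\frac{z_1-z_2}{z_2}\right)\quad\text{on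 } |z_2|>|z_1-z_2|>0,$$ with $r_i,s_i\in\mathbb C$ and $f_i$ analytic on the open unit disc. (Powers are principal; the two functions agree where $|z_1|>|z_2|>|z_1-z_2|>0$ and $z_1,z_2,z_1-z_2$ have positive real part.) Then $E_{12}c$ is said to be defined, and $(E_{12}c)|_{z_1=z_0+z_2}$ denotes the formal series $\sum_{i=1}^k z_2^{r_i}z_0^{s_i}f_i(z_0/z_2)$, where $f_i$ is expanded in its Taylor series at $0$. Assume the convergence and extension property for the product of $F_{1,23}$ and $F_{23}$: there is an integer $N$ such that for all $w_i\in W_i$ ($i=1,2,3$) homogeneous for the generalized weights and all homogeneous $w_4'\in W_{1,23}'$, the series $\langle w_4',F_{1,23}(w_1,z_1)F_{23}(w_2,z_2)w_3\rangle$ converges and extends as above, with some $k,r_i,s_i,f_i$ such that $\operatorname{Re}(\operatorname{gwt}w_1+\operatorname{gwt}w_2+s_i)>N$ for all $i$. For $w_1\in W_1$, $w_2\in W_2$ let $\psi(w_1,w_2;z_0,z_2)=\sum_{n\in\mathbb C}\psi_n(w_1,w_2,z_2)z_0^{-n-1}$ be the series in complex powers of $z_0,z_2$ with coefficients in $\operatorname{Hom}_{\mathbb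 C}(W_3,W_{1,23})$ determined by $$\langle w_4',\psi(w_1,w_2;z_0,z_2)w_3\rangle=\bigl(E_{12}\langle w_4',F_{1,23}(w_1,z_1)F_{23}(w_2,z_2)w_3\rangle\bigr)\big|_{z_1=z_0+z_2}\qquad(w_3\in W_3,\ w_4'\in W_{1,23}'),$$ and let $W$ be the linear span of all the series $\psi_n(w_1,w_2,z_2)$, $n\in\mathbb C$, $w_1\in W_1$, $w_2\in W_2$, with the action of $V$ given by $$a_m\circ_l\Phi(z_2)=\operatorname{Res}_{z_1}\bigl((z_1-z_2)^mY(a,z_1)\Phi(z_2)-(-z_2+z_1)^m\Phi(z_2)Y(a,z_1)\bigr).$$ Assume that $W$ lies in $\mathcal D$. Then there is a $V$-homomorphism $f:W_{12,3}\to W_{1,23}$ such that for all $w_i\in W_i$ $(i=1,2,3)$ and $w_4'\in W_{1,23}'$, $E_{12}\langle w_4',F_{1,23}(w_1,z_1)F_{23}(w_2,z_2)w_3\rangle$ is defined and $$\langle w_4',fF_{12,3}(F_{12}(w_1,z_0)w_2,z_2)w_3\rangle=\bigl(E_{12}\langle w_4',F_{1,23}(w_1,z_1)F_{23}(w_2,z_2)w_3\rangle\bigr)\big|_{z_1=z_0+z_2}.$$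 -/

import Mathlib

universe u v

noncomputable section

namespace VOA

/-! ### The Jacobi identity, vertex operator algebras and weak modules -/

section Jacobi

variable {A V W₁ W₂ W₃ : Type*} [Ring A]
  [AddCommGroup V] [Module ℂ V] [AddCommGroup W₁] [Module ℂ W₁]
  [AddCommGroup W₂] [Module ℂ W₂] [AddCommGroup W₃] [Module ℂ W₃]

/-- A formal series `I(w, z) = ∑ I_α(w) z^{-α-1}` is given by its modes `I α w = I_α(w)`; the
exponents lie in `A = ℤ` (vertex operators) or `A = ℂ` (intertwining operators).
Truncation: for all `α, w₁, w₂`, `I_{α+n}(w₁)w₂ = 0` for all sufficiently large integers `n`. -/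
def Truncated (I : A → W₁ →ₗ[ℂ] W₂ →ₗ[ℂ] W₃) : Prop :=
  ∀ (α : A) (w₁ : W₁) (w₂ : W₂), ∃ N : ℤ, ∀ n : ℤ, N ≤ n → I (α + (n : A)) w₁ w₂ = 0

/-- The Jacobi identity
`z₀⁻¹δ((z₁-z₂)/z₀) Y₃(a,z₁) I(w₁,z₂) w₂ - z₀⁻¹δ((z₂-z₁)/(-z₀)) I(w₁,z₂) Y₂(a,z₁) w₂
  = z₂⁻¹δ((z₁-z₀)/z₂) I(Y₁(a,z₀)w₁,z₂) w₂`,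
as the equality of the coefficients of `z₀^{-l-1} z₁^{-m-1} z₂^{-α-1}` on both sides.  For truncated
`Y₁, Y₂, I` all the sums are finite. -/
def Jacobi (Y₁ : ℤ → V →ₗ[ℂ] W₁ →ₗ[ℂ] W₁) (Y₂ : ℤ → V →ₗ[ℂ] W₂ →ₗ[ℂ] W₂)
    (Y₃ : ℤ → V →ₗ[ℂ] W₃ →ₗ[ℂ] W₃) (I : A → W₁ →ₗ[ℂ] W₂ →ₗ[ℂ] W₃) : Prop :=
  ∀ (a : V) (w₁ : W₁) (w₂ : W₂) (l m : ℤ) (α : A),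
    (∑ᶠ i : ℕ, ((-1) ^ i * Ring.choose l i : ℤ) •
        Y₃ (l + m - i) a (I (α + (i : A)) w₁ w₂))
      - (∑ᶠ i : ℕ, ((l.negOnePow : ℤ) * (-1) ^ i * Ring.choose l i : ℤ) •
        I (α + (l : A) - (i : A)) w₁ (Y₂ (m + i) a w₂))
      = ∑ᶠ i : ℕ, (Ring.choose m i : ℤ) •
        I (α + (m : A) - (i : A)) (Y₁ (l + i) a w₁) w₂

end Jacobi

/-- A vertex operator algebra with underlying vector space `V`; `Y n a b = a_n b`, where
`Y(a,z) = ∑ a_n z^{-n-1}`, and `L(n) = ω_{n+1}`. The grading `V = ⨁_{n ∈ ℤ} V_(n)` is the one by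
eigenspaces of `L(0)` (whose sum is automatically direct). -/
structure VertexOperatorAlgebra (V : Type v) [AddCommGroup V] [Module ℂ V] where
  Y : ℤ → V →ₗ[ℂ] V →ₗ[ℂ] V
  vacuum : V
  conformal : V
  centralCharge : ℂ
  truncated : Truncated Y
  vacuum_left : ∀ (n : ℤ) (b : V), Y n vacuum b = if n = -1 then b else 0
  creation : ∀ a : V, Y (-1) a vacuum = a
  creation_nonneg : ∀ (n : ℤ) (a : V), 0 ≤ n → Y n a vacuum = 0
  jacobi : Jacobi Y Y Y Y
  virasoro : ∀ (m n : ℤ) (b : V),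
    Y (m + 1) conformal (Y (n + 1) conformal b) - Y (n + 1) conformal (Y (m + 1) conformal b)
      = ((m : ℂ) - n) • Y (m + n + 1) conformal b
        + if m + n = 0 then ((((m : ℂ) ^ 3 - m) / 12) * centralCharge) • b else 0
  derivative : ∀ (n : ℤ) (a b : V), Y n (Y 0 conformal a) b = (-(n : ℂ)) • Y (n - 1) a b
  vacuum_weight : Y 1 conformal vacuum = 0
  conformal_weight : Y 1 conformal conformal = (2 : ℂ) • conformal
  graded : ⨆ n : ℤ, Module.End.eigenspace (Y 1 conformal) (n : ℂ) = ⊤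
  finite_dim : ∀ n : ℤ, FiniteDimensional ℂ (Module.End.eigenspace (Y 1 conformal) (n : ℂ))
  bounded_below : ∃ N : ℤ, ∀ n : ℤ, n < N →
    Module.End.eigenspace (Y 1 conformal) (n : ℂ) = ⊥

variable {V : Type v} [AddCommGroup V] [Module ℂ V]

/-- A weak `V`-module structure on the vector space `W`. -/
structure WeakModule (𝒱 : VertexOperatorAlgebra V) (W : Type u) [AddCommGroup W] [Module ℂ W] where
  Y : ℤ → V →ₗ[ℂ] W →ₗ[ℂ] W
  vacuum : ∀ (n : ℤ) (w : W), Y n 𝒱.vacuum w = if n = -1 then w else 0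
  truncated : Truncated Y
  derivative : ∀ (n : ℤ) (a : V) (w : W),
    Y n (𝒱.Y 0 𝒱.conformal a) w = (-(n : ℂ)) • Y (n - 1) a w
  jacobi : Jacobi 𝒱.Y Y Y Y

/-- `L(0) = ω_1` on a weak module. -/
def WeakModule.L0 {𝒱 : VertexOperatorAlgebra V} {W : Type u} [AddCommGroup W] [Module ℂ W]
    (M : WeakModule 𝒱 W) : Module.End ℂ W := M.Y 1 𝒱.conformal

/-- `f` is a `V`-homomorphism. -/
def IsHom {𝒱 : VertexOperatorAlgebra V} {W W' : Type u} [AddCommGroup W] [Module ℂ W]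
    [AddCommGroup W'] [Module ℂ W'] (M : WeakModule 𝒱 W) (M' : WeakModule 𝒱 W')
    (f : W →ₗ[ℂ] W') : Prop :=
  ∀ (n : ℤ) (a : V) (w : W), f (M.Y n a w) = M'.Y n a (f w)

/-! ### The categories `𝒞(V)` and `𝒞¹(V)` -/

/-- Names of the two categories of weak `V`-modules, `𝒞(V)` and `𝒞¹(V)`. -/
inductive ModuleCategory : Type
  | C
  | C1

/-- The condition that defines the category, on the operator `T = L(0)` of a space `W`.

* `𝒞(V)`: `T` is semisimple, its eigenspaces `W_h` are finite-dimensional, and for each `h ∈ ℂ`,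
  `W_{h+n} = 0` for all sufficiently small integers `n`.
* `𝒞¹(V)`: `T` is locally finite, and the generalized weights (i.e. the `h` for which there is
  `w ≠ 0` with `(T - h)^n w = 0` for some `n`) lie in `⋃_{s ∈ S} (s + ℤ₊)` for a finite set `S`. -/
def InCategory (D : ModuleCategory) {W : Type u} [AddCommGroup W] [Module ℂ W]
    (T : Module.End ℂ W) : Prop :=
  match D with
  | .C => (⨆ h : ℂ, Module.End.eigenspace T h = ⊤) ∧
      (∀ h : ℂ, FiniteDimensional ℂ (Module.End.eigenspace T h)) ∧
      ∀ h : ℂ, ∃ N : ℤ, ∀ n : ℤ, n < N → Module.End.eigenspace T (h + n) = ⊥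
  | .C1 => (∀ w : W, ∃ N : Submodule ℂ W, FiniteDimensional ℂ N ∧ w ∈ N ∧ ∀ x ∈ N, T x ∈ N) ∧
      ∃ S : Finset ℂ, ∀ h : ℂ, Module.End.maxGenEigenspace T h ≠ ⊥ → ∃ s ∈ S, ∃ n : ℕ, h = s + n

/-- `w` is a nonzero generalized weight vector of generalized weight `h`. -/
def IsWeightVector {W : Type u} [AddCommGroup W] [Module ℂ W] (T : Module.End ℂ W) (h : ℂ)
    (w : W) : Prop :=
  w ≠ 0 ∧ ∃ n : ℕ, ((T - algebraMap ℂ (Module.End ℂ W) h) ^ n) w = 0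

/-- `φ` is an element of `(W_h)^*`: a functional that vanishes on all the generalized weight spaces
of `W` other than the one of generalized weight `h`. -/
def IsHomogeneousDual {W : Type u} [AddCommGroup W] [Module ℂ W] (T : Module.End ℂ W) (h : ℂ)
    (φ : Module.Dual ℂ W) : Prop :=
  ∀ h' : ℂ, h' ≠ h → ∀ w ∈ Module.End.maxGenEigenspace T h', φ w = 0

/-- `φ` is an element of the restricted dual `W' = ⨁_h (W_h)^*`: it vanishes on all but finitely
many of the generalized weight spaces of `W`. -/
def InRestrictedDual {W : Type u} [AddCommGroup W] [Module ℂ W] (T : Module.End ℂ W)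
    (φ : Module.Dual ℂ W) : Prop :=
  {h : ℂ | ∃ w ∈ Module.End.maxGenEigenspace T h, φ w ≠ 0}.Finite

/-! ### Intertwining operators and tensor products -/

section Intertwining

variable {𝒱 : VertexOperatorAlgebra V} {W₁ W₂ W₃ : Type u} [AddCommGroup W₁] [Module ℂ W₁]
  [AddCommGroup W₂] [Module ℂ W₂] [AddCommGroup W₃] [Module ℂ W₃]

/-- An intertwining operator `I(w,z) = ∑_{α ∈ ℂ} I_α(w) z^{-α-1}` of type `(M₃ ; M₁ M₂)`. -/
structure Intertwining (M₁ : WeakModule 𝒱 W₁) (M₂ : WeakModule 𝒱 W₂) (M₃ : WeakModule 𝒱 W₃) where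
  mode : ℂ → W₁ →ₗ[ℂ] W₂ →ₗ[ℂ] W₃
  truncated : Truncated mode
  derivative : ∀ (α : ℂ) (w₁ : W₁) (w₂ : W₂),
    mode α (M₁.Y 0 𝒱.conformal w₁) w₂ = (-α) • mode (α - 1) w₁ w₂
  jacobi : Jacobi M₁.Y M₂.Y M₃.Y mode

/-- `(M, F)` is a tensor product of the ordered pair `(M₁, M₂)` in the category `D`. -/
structure IsTensorProduct (D : ModuleCategory) {M₁ : WeakModule 𝒱 W₁} {M₂ : WeakModule 𝒱 W₂}
    {M : WeakModule 𝒱 W₃} (F : Intertwining M₁ M₂ M) : Prop where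
  mem : InCategory D M.L0
  universal : ∀ (X : Type u) [AddCommGroup X] [Module ℂ X] (N : WeakModule 𝒱 X),
    InCategory D N.L0 → ∀ I : Intertwining M₁ M₂ N,
      ∃! ψ : W₃ →ₗ[ℂ] X, IsHom M N ψ ∧
        ∀ (α : ℂ) (w₁ : W₁) (w₂ : W₂), I.mode α w₁ w₂ = ψ (F.mode α w₁ w₂)

end Intertwining

/-! ### Convergence, analytic extension and the operator `E₁₂` -/

/-- `c m n` is the coefficient of `z₁^{-m-1} z₂^{-n-1}` in a formal series.  The series converges
(absolutely) in the domain `|z₁| > |z₂| > 0`, and its sum extends analytically to the multi-valued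
function `∑ᵢ z₂^{rᵢ} (z₁ - z₂)^{sᵢ} fᵢ((z₁ - z₂)/z₂)` in the domain `|z₂| > |z₁ - z₂| > 0`, where
the `fᵢ` are analytic on the open unit disc.

Powers are principal powers.  The two functions are compared on the part of the intersection of the
two domains where `z₁`, `z₂`, `z₁ - z₂` have positive real part; it is open and connected, and
contains the points with `z₁ > z₂ > z₁ - z₂ > 0`, where all the powers have their usual values. -/
structure ExtendsTo (c : ℂ → ℂ → ℂ) {k : ℕ} (r s : Fin k → ℂ) (f : Fin k → ℂ → ℂ) : Prop where
  analytic : ∀ i, AnalyticOnNhd ℂ (f i) (Metric.ball 0 1)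
  converges : ∀ z₁ z₂ : ℂ, 0 < ‖z₂‖ → ‖z₂‖ < ‖z₁‖ →
    Summable fun p : ℂ × ℂ => c p.1 p.2 * z₁ ^ (-p.1 - 1) * z₂ ^ (-p.2 - 1)
  extends_eq : ∀ z₁ z₂ : ℂ, 0 < ‖z₁ - z₂‖ → ‖z₁ - z₂‖ < ‖z₂‖ → ‖z₂‖ < ‖z₁‖ →
    0 < z₁.re → 0 < z₂.re → 0 < (z₁ - z₂).re →
    ∑' p : ℂ × ℂ, c p.1 p.2 * z₁ ^ (-p.1 - 1) * z₂ ^ (-p.2 - 1)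
      = ∑ i, z₂ ^ r i * (z₁ - z₂) ^ s i * f i ((z₁ - z₂) / z₂)

/-- The coefficient of `z₀^{-n-1} z₂^{-m-1}` in the formal series
`∑ᵢ z₂^{rᵢ} z₀^{sᵢ} fᵢ(z₀/z₂)`, each `fᵢ` being replaced by its Taylor series at `0`. -/
def expansionCoeff {k : ℕ} (r s : Fin k → ℂ) (f : Fin k → ℂ → ℂ) (n m : ℂ) : ℂ :=
  open Classical in
  ∑ i, ∑ᶠ j : ℕ, if -n - 1 = s i + j ∧ -m - 1 = r i - j
    then iteratedDeriv j (f i) 0 / (j.factorial : ℂ) else 0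

/-- `E₁₂` is defined on the series with coefficients `c m n` (at `z₁^{-m-1} z₂^{-n-1}`), and
`(E₁₂ c)|_{z₁ = z₀ + z₂}` is the formal series with coefficients `d n m`
(at `z₀^{-n-1} z₂^{-m-1}`). -/
def HasE12 (c d : ℂ → ℂ → ℂ) : Prop :=
  ∃ (k : ℕ) (r s : Fin k → ℂ) (f : Fin k → ℂ → ℂ), ExtendsTo c r s f ∧
    ∀ n m : ℂ, d n m = expansionCoeff r s f n m

section Products

variable {𝒱 : VertexOperatorAlgebra V} {W₁ W₂ W₃ W₄ W₅ : Type u}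
  [AddCommGroup W₁] [Module ℂ W₁] [AddCommGroup W₂] [Module ℂ W₂] [AddCommGroup W₃] [Module ℂ W₃]
  [AddCommGroup W₄] [Module ℂ W₄] [AddCommGroup W₅] [Module ℂ W₅]
  {M₁ : WeakModule 𝒱 W₁} {M₂ : WeakModule 𝒱 W₂} {M₃ : WeakModule 𝒱 W₃} {M₄ : WeakModule 𝒱 W₄}
  {M₅ : WeakModule 𝒱 W₅}

/-- The coefficients of `⟨φ, I₁(w₁,z₁) I₂(w₂,z₂) w₃⟩`. -/
def productCoeff (I₁ : Intertwining M₁ M₅ M₄) (I₂ : Intertwining M₂ M₃ M₅)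
    (w₁ : W₁) (w₂ : W₂) (w₃ : W₃) (φ : Module.Dual ℂ W₄) (m n : ℂ) : ℂ :=
  φ (I₁.mode m w₁ (I₂.mode n w₂ w₃))

/-- The coefficients (at `z₀^{-n-1} z₂^{-m-1}`) of `⟨φ, I₄(I₃(w₁,z₀) w₂, z₂) w₃⟩`. -/
def iterateCoeff (I₄ : Intertwining M₅ M₃ M₄) (I₃ : Intertwining M₁ M₂ M₅)
    (w₁ : W₁) (w₂ : W₂) (w₃ : W₃) (φ : Module.Dual ℂ W₄) (n m : ℂ) : ℂ :=
  φ (I₄.mode m (I₃.mode n w₁ w₂) w₃)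

/-- The convergence and extension property for the product of `I₁` and `I₂`. -/
def ConvergenceExtension (I₁ : Intertwining M₁ M₅ M₄) (I₂ : Intertwining M₂ M₃ M₅) : Prop :=
  ∃ N : ℤ, ∀ (h₁ h₂ h₃ h₄ : ℂ) (w₁ : W₁) (w₂ : W₂) (w₃ : W₃) (φ : Module.Dual ℂ W₄),
    IsWeightVector M₁.L0 h₁ w₁ → IsWeightVector M₂.L0 h₂ w₂ → IsWeightVector M₃.L0 h₃ w₃ →
    IsHomogeneousDual M₄.L0 h₄ φ →
    ∃ (k : ℕ) (r s : Fin k → ℂ) (f : Fin k → ℂ → ℂ),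
      (∀ i, (N : ℝ) < (h₁ + h₂ + s i).re) ∧ ExtendsTo (productCoeff I₁ I₂ w₁ w₂ w₃ φ) r s f

/-- `ψ n m = ψ_n(w₁,w₂)_m` are the coefficients of the series
`ψ(w₁,w₂;z₀,z₂) = ∑ ψ_n(w₁,w₂)_m z₀^{-n-1} z₂^{-m-1} ∈ Hom(W₃,W₄){z₀,z₂}` determined by
`⟨φ, ψ(w₁,w₂;z₀,z₂) w₃⟩ = (E₁₂ ⟨φ, I₁(w₁,z₁) I₂(w₂,z₂) w₃⟩)|_{z₁ = z₀ + z₂}`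
for `w₃ ∈ W₃`, `φ ∈ W₄'`. -/
def IsPsi (I₁ : Intertwining M₁ M₅ M₄) (I₂ : Intertwining M₂ M₃ M₅) (w₁ : W₁) (w₂ : W₂)
    (ψ : ℂ → ℂ → W₃ →ₗ[ℂ] W₄) : Prop :=
  ∀ (w₃ : W₃) (φ : Module.Dual ℂ W₄), InRestrictedDual M₄.L0 φ →
    HasE12 (productCoeff I₁ I₂ w₁ w₂ w₃ φ) fun n m => φ (ψ n m w₃)

/-- The subspace `W` of `Hom(W₃,W₄){z₂}` spanned by all the series `ψ_n(w₁,w₂,z₂)`; a series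
`Φ(z) = ∑ Φ_α z^{-α-1}` is represented by `α ↦ Φ_α`. -/
def psiSpan (I₁ : Intertwining M₁ M₅ M₄) (I₂ : Intertwining M₂ M₃ M₅) :
    Submodule ℂ (ℂ → W₃ →ₗ[ℂ] W₄) :=
  Submodule.span ℂ {Φ | ∃ (w₁ : W₁) (w₂ : W₂) (ψ : ℂ → ℂ → W₃ →ₗ[ℂ] W₄) (n : ℂ),
    IsPsi I₁ I₂ w₁ w₂ ψ ∧ Φ = ψ n}

/-- The coefficient of `z₂^{-α-1}` in `(a_m ∘_l Φ)(z₂) u`, where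
`a_m ∘_l Φ(z₂) = Res_{z₁} ((z₁-z₂)^m Y(a,z₁) Φ(z₂) - (-z₂+z₁)^m Φ(z₂) Y(a,z₁))`. -/
def circCoeff (M₃ : WeakModule 𝒱 W₃) (M₄ : WeakModule 𝒱 W₄) (a : V) (m : ℤ)
    (Φ : ℂ → W₃ →ₗ[ℂ] W₄) (α : ℂ) (u : W₃) : W₄ :=
  (∑ᶠ i : ℕ, ((-1) ^ i * Ring.choose m i : ℤ) • M₄.Y (m - i) a (Φ (α + i) u))
    - ∑ᶠ i : ℕ, (((m - i).negOnePow : ℤ) * Ring.choose m i : ℤ) •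
        Φ (α + m - i) (M₃.Y i a u)

/-- The space `W` with the action `∘_l` lies in the category `D`.  Only what defines `D` is required
here: `W` is stable under the operator `L(0) = ω_1 ∘_l` and this operator satisfies the condition of
the category `D`.  (The other operators `a_m ∘_l` do not enter.) -/
def PsiSpanInCategory (D : ModuleCategory) (I₁ : Intertwining M₁ M₅ M₄)
    (I₂ : Intertwining M₂ M₃ M₅) : Prop :=
  ∃ T : Module.End ℂ (psiSpan I₁ I₂),
    (∀ (Φ : psiSpan I₁ I₂) (α : ℂ) (u : W₃),
      (T Φ : ℂ → W₃ →ₗ[ℂ] W₄) α u = circCoeff M₃ M₄ 𝒱.conformal 1 (Φ : ℂ → W₃ →ₗ[ℂ] W₄) α u) ∧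
    InCategory D T

end Products

end VOA

end

/-! Universality reduces the theorem to two intertwining operators that meet in W = `psiSpan`:
`psiIntertwining`, sending w₁ ⊗ w₂ to the series with coefficients ψ_n(w₁,w₂) ∈ W, and
`evalIntertwining`, sending Φ ⊗ w₃ to Φ(z)w₃. The first factors through F₁₂ by some g : W₁₂ → W. The
second, precomposed with g, factors through F₁₂,₃, and this gives f. Unwinding both factorizations,
fF₁₂,₃(F₁₂(w₁,z₀)w₂,z₂)w₃ = ψ(w₁,w₂;z₀,z₂)w₃, whose pairings are E₁₂ of the product by construction
of ψ.

What has to be shown is that ψ exists, that W is a weak module, and that both operators satisfy the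
axioms.

The analysis enters through a few facts about E₁₂. It is a linear relation, it is single-valued
(`ExtendsTo.expansionCoeff_eq_zero`), it turns multiplication by z₁ into multiplication by z₀ + z₂
and ∂/∂z₁ into ∂/∂z₀, it commutes with powers of z₂, and it preserves homogeneity. Pairings with all
functionals come from actual vectors because convergence against every functional leaves only
finitely many independent coefficients in each degree (`exists_vector_of_hasE12`).

The algebra is done once, for an abstract substitution z₁ = z₀ + z₂ (`IsSubstitution`, `AssocData`).
A vertex operator can be inserted into a product of two operators on the left, on the right, in the
middle, or on either argument; all of these but the middle one have counterparts in the iterate. The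
two Jacobi identities of the product eliminate the middle insertion. What remains is carried to the
iterate, where powers of z₀ + z₂ can be cancelled because series truncated in z₀ have no (z₀ +
z₂)-torsion. This gives `AssocData.outer_jacobi` and `AssocData.inner_jacobi`.

The argument is applied twice. With `e12Space` it shows that W is closed under the action and yields
the Jacobi identity for ψ. With `jacobiSpace`, where two series correspond when a Jacobi identity
links them, it yields the Jacobi identity of W as a module. -/

noncomputable section

namespace VOA

open Filter

/-! ### Binomial sums and the three terms of the Jacobi identity -/

section BinomialSums

variable {X E : Type*} [Ring X] [AddCommGroup E]

/-- The binomial sum `∑ᵢ C(c, i) g i`. -/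
def bsum (c : ℤ) (g : ℕ → E) : E := ∑ᶠ i : ℕ, Ring.choose c i • g i

/-- Eventually vanishing sequences. -/
abbrev EvZero (g : ℕ → E) : Prop := ∀ᶠ i in atTop, g i = 0

theorem EvZero.add {g h : ℕ → E} (hg : EvZero g) (hh : EvZero h) :
    EvZero (fun i => g i + h i) := by
  filter_upwards [hg, hh] with i h1 h2
  rw [h1, h2, add_zero]

theorem EvZero.sub {g h : ℕ → E} (hg : EvZero g) (hh : EvZero h) :
    EvZero (fun i => g i - h i) := by
  filter_upwards [hg, hh] with i h1 h2
  rw [h1, h2, sub_zero]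

theorem EvZero.succ {g : ℕ → E} (hg : EvZero g) : EvZero (fun i => g (i + 1)) :=
  (tendsto_add_atTop_nat 1).eventually hg

theorem EvZero.zsmul {g : ℕ → E} (hg : EvZero g) (c : ℕ → ℤ) : EvZero (fun i => c i • g i) := by
  filter_upwards [hg] with i h1
  rw [h1, smul_zero]

theorem EvZero.hasFiniteSupport {g : ℕ → E} (hg : EvZero g) : Function.HasFiniteSupport g := by
  obtain ⟨N, hN⟩ := eventually_atTop.1 hg
  refine (Set.finite_lt_nat N).subset fun i hi => ?_
  by_contra h
  exact hi (hN i (not_lt.1 h))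

theorem finsum_eq_sum_range {g : ℕ → E} {N : ℕ} (hN : ∀ i, N ≤ i → g i = 0) :
    ∑ᶠ i, g i = ∑ i ∈ Finset.range N, g i := by
  refine finsum_eq_sum_of_support_subset _ fun i hi => ?_
  simp only [Finset.coe_range, Set.mem_Iio]
  by_contra h
  exact hi (hN i (not_lt.1 h))

theorem bsum_eq_sum_range (c : ℤ) {g : ℕ → E} {N : ℕ} (hN : ∀ i, N ≤ i → g i = 0) :
    bsum c g = ∑ i ∈ Finset.range N, Ring.choose c i • g i :=
  finsum_eq_sum_range fun i hi => by rw [hN i hi, smul_zero]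

theorem bsum_add (c : ℤ) {g h : ℕ → E} (hg : EvZero g) (hh : EvZero h) :
    bsum c (fun i => g i + h i) = bsum c g + bsum c h := by
  simp only [bsum, smul_add]
  exact finsum_add_distrib (hg.zsmul _).hasFiniteSupport (hh.zsmul _).hasFiniteSupport

theorem bsum_sub (c : ℤ) {g h : ℕ → E} (hg : EvZero g) (hh : EvZero h) :
    bsum c (fun i => g i - h i) = bsum c g - bsum c h := by
  simp only [bsum, smul_sub]
  exact finsum_sub_distrib (hg.zsmul _).hasFiniteSupport (hh.zsmul _).hasFiniteSupport

theorem bsum_neg (c : ℤ) (g : ℕ → E) : bsum c (fun i => - g i) = - bsum c g := by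
  simp only [bsum, smul_neg]
  exact finsum_neg_distrib _

theorem bsum_map {F : Type*} [AddCommGroup F] (c : ℤ) {g : ℕ → E} (hg : EvZero g) (f : E →+ F) :
    f (bsum c g) = bsum c (fun i => f (g i)) := by
  simp only [bsum]
  rw [AddMonoidHom.map_finsum f (hg.zsmul _).hasFiniteSupport]
  simp

theorem bsum_congr (c : ℤ) {g h : ℕ → E} (H : ∀ i, g i = h i) : bsum c g = bsum c h := by
  rw [funext H]

theorem bsum_eq_zero (c : ℤ) {g : ℕ → E} (H : ∀ i, g i = 0) : bsum c g = 0 := by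
  simp [bsum, H]

theorem bsum_zero (g : ℕ → E) : bsum 0 g = g 0 := by
  rw [bsum, finsum_eq_single _ 0]
  · simp
  · intro i hi
    obtain ⟨j, rfl⟩ := Nat.exists_eq_succ_of_ne_zero hi
    simp [Ring.choose_zero_succ]

theorem EvZero.finsum_succ {g : ℕ → E} (hg : EvZero g) :
    ∑ᶠ i, g i = g 0 + ∑ᶠ i, g (i + 1) := by
  obtain ⟨N, hN⟩ := eventually_atTop.1 hg
  rw [finsum_eq_sum_range (N := N + 1) fun i hi => hN i (by omega),
    finsum_eq_sum_range (N := N) fun i hi => hN (i + 1) (by omega), Finset.sum_range_succ',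
    add_comm]

theorem bsum_succ (c : ℤ) {g : ℕ → E} (hg : EvZero g) :
    bsum (c + 1) g = bsum c g + bsum c (fun i => g (i + 1)) := by
  simp only [bsum]
  rw [(hg.zsmul _).finsum_succ, (hg.zsmul fun i => Ring.choose c i).finsum_succ]
  simp only [Ring.choose_succ_succ, Ring.choose_zero_right, add_smul]
  rw [finsum_add_distrib (hg.succ.zsmul _).hasFiniteSupport (hg.succ.zsmul _).hasFiniteSupport]
  abel

/-- The sum `∑ᵢ (-1)ⁱ C(l, i) P (l + m - i) (x + i)` of the Jacobi identity. -/
def jP (l m : ℤ) (x : X) (P : ℤ → X → E) : E :=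
  bsum l fun i => (-1 : ℤ) ^ i • P (l + m - i) (x + (i : X))

/-- The sum `∑ᵢ (-1)ˡ⁺ⁱ C(l, i) N (m + i) (x + l - i)` of the Jacobi identity. -/
def jN (l m : ℤ) (x : X) (N : ℤ → X → E) : E :=
  bsum l fun i => ((l.negOnePow : ℤ) * (-1) ^ i) • N (m + i) (x + (l : X) - (i : X))

/-- The sum `∑ᵢ C(m, i) R (l + i) (x + m - i)` of the Jacobi identity. -/
def jR (l m : ℤ) (x : X) (R : ℤ → X → E) : E :=
  bsum m fun i => R (l + i) (x + (m : X) - (i : X))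

/-- Truncation making the sums `jP` finite. -/
def TruncP (P : ℤ → X → E) : Prop := ∀ k x, EvZero fun i : ℕ => P (k - i) (x + (i : X))

/-- Truncation making the sums `jN` and `jR` finite. -/
def TruncN (N : ℤ → X → E) : Prop := ∀ k x, EvZero fun i : ℕ => N (k + i) (x - (i : X))

theorem jP_zero (m : ℤ) (x : X) (P : ℤ → X → E) : jP 0 m x P = P m x := by
  simp [jP, bsum_zero]

theorem jN_zero (m : ℤ) (x : X) (P : ℤ → X → E) : jN 0 m x P = P m x := by
  simp [jN, bsum_zero]

theorem jR_zero (l : ℤ) (x : X) (P : ℤ → X → E) : jR l 0 x P = P l x := by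
  simp [jR, bsum_zero]

theorem jP_sub (l m : ℤ) (x : X) {P Q : ℤ → X → E} (hP : TruncP P) (hQ : TruncP Q) :
    jP l m x (fun k x => P k x - Q k x) = jP l m x P - jP l m x Q := by
  simp only [jP, smul_sub]
  exact bsum_sub _ ((hP _ _).zsmul _) ((hQ _ _).zsmul _)

theorem jP_add (l m : ℤ) (x : X) {P Q : ℤ → X → E} (hP : TruncP P) (hQ : TruncP Q) :
    jP l m x (fun k x => P k x + Q k x) = jP l m x P + jP l m x Q := by
  simp only [jP, smul_add]
  exact bsum_add _ ((hP _ _).zsmul _) ((hQ _ _).zsmul _)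

theorem jN_sub (l m : ℤ) (x : X) {P Q : ℤ → X → E} (hP : TruncN P) (hQ : TruncN Q) :
    jN l m x (fun k x => P k x - Q k x) = jN l m x P - jN l m x Q := by
  simp only [jN, smul_sub]
  exact bsum_sub _ ((hP _ _).zsmul _) ((hQ _ _).zsmul _)

theorem jN_add (l m : ℤ) (x : X) {P Q : ℤ → X → E} (hP : TruncN P) (hQ : TruncN Q) :
    jN l m x (fun k x => P k x + Q k x) = jN l m x P + jN l m x Q := by
  simp only [jN, smul_add]
  exact bsum_add _ ((hP _ _).zsmul _) ((hQ _ _).zsmul _)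

theorem jR_sub (l m : ℤ) (x : X) {P Q : ℤ → X → E} (hP : TruncN P) (hQ : TruncN Q) :
    jR l m x (fun k x => P k x - Q k x) = jR l m x P - jR l m x Q :=
  bsum_sub _ (hP _ _) (hQ _ _)

theorem jR_add (l m : ℤ) (x : X) {P Q : ℤ → X → E} (hP : TruncN P) (hQ : TruncN Q) :
    jR l m x (fun k x => P k x + Q k x) = jR l m x P + jR l m x Q :=
  bsum_add _ (hP _ _) (hQ _ _)

/-- Pascal's rule: one more factor z₁ - z₂. The sums `jN` and `jR` obey the same recursion, so the
identity at l for all m and exponents gives it at l + 1. -/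
theorem jP_succ (l m : ℤ) (x : X) {P : ℤ → X → E} (hP : TruncP P) :
    jP (l + 1) m x P = jP l (m + 1) x P - jP l m (x + 1) P := by
  rw [jP, bsum_succ _ ((hP _ _).zsmul _), jP, jP, sub_eq_add_neg, ← bsum_neg]
  congr 1
  · exact bsum_congr _ fun i => by rw [show l + 1 + m = l + (m + 1) by ring]
  · refine bsum_congr _ fun i => ?_
    rw [pow_succ, mul_neg_one, neg_smul]
    congr 3
    · push_cast; ring
    · push_cast; abel

theorem jN_succ (l m : ℤ) (x : X) {P : ℤ → X → E} (hP : TruncN P) :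
    jN (l + 1) m x P = jN l (m + 1) x P - jN l m (x + 1) P := by
  rw [jN, bsum_succ _ ((hP _ _).zsmul _), jN, jN, sub_eq_neg_add, ← bsum_neg]
  congr 1
  · refine bsum_congr _ fun i => ?_
    rw [Int.negOnePow_succ, ← neg_smul]
    congr 2
    · push_cast; ring
    · push_cast; abel
  · refine bsum_congr _ fun i => ?_
    rw [Int.negOnePow_succ]
    have h : ((-l.negOnePow : ℤˣ) : ℤ) * (-1) ^ (i + 1) = (l.negOnePow : ℤ) * (-1) ^ i := by
      push_cast; ring
    rw [h]
    congr 2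
    · push_cast; ring
    · push_cast; abel

theorem jR_succ (l m : ℤ) (x : X) {P : ℤ → X → E} (hP : TruncN P) :
    jR (l + 1) m x P = jR l (m + 1) x P - jR l m (x + 1) P := by
  have h : EvZero fun i : ℕ => P (l + i) (x + ((m + 1 : ℤ) : X) - (i : X)) := hP _ _
  rw [eq_sub_iff_add_eq, jR, jR, jR, bsum_succ _ h, add_comm]
  congr 1
  · refine bsum_congr _ fun i => ?_
    congr 1
    push_cast; abel
  · refine bsum_congr _ fun i => ?_
    congr 1
    · push_cast; ring
    · push_cast; abel

theorem jP_eq_zero (l m : ℤ) (x : X) {P : ℤ → X → E}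
    (h : ∀ i : ℕ, P (l + m - i) (x + (i : X)) = 0) : jP l m x P = 0 :=
  bsum_eq_zero _ fun i => by rw [h i, smul_zero]

theorem jN_eq_zero (l m : ℤ) (x : X) {P : ℤ → X → E}
    (h : ∀ (i : ℕ) (y : X), P (m + i) y = 0) : jN l m x P = 0 :=
  bsum_eq_zero _ fun i => by rw [h i, smul_zero]

theorem jR_eq_zero (l m : ℤ) (x : X) {P : ℤ → X → E}
    (h : ∀ (i : ℕ) (y : X), P (l + i) y = 0) : jR l m x P = 0 :=
  bsum_eq_zero _ fun i => h i _

end BinomialSums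

/-! ### Abstract substitutions z₁ = z₀ + z₂ and cancellation of z₀ + z₂ -/

section Associativity

variable {A : Type*} [CommRing A]

theorem truncP_of_low {X E : Type*} [Ring X] [AddCommGroup E] {P : ℤ → X → E} {K : ℤ}
    (h : ∀ k < K, ∀ x, P k x = 0) : TruncP P := fun k x => by
  filter_upwards [eventually_gt_atTop (k - K).toNat] with i hi
  exact h _ (by omega) _

theorem truncN_of_high {X E : Type*} [Ring X] [AddCommGroup E] {P : ℤ → X → E} {K : ℤ}
    (h : ∀ k ≥ K, ∀ x, P k x = 0) : TruncN P := fun k x => by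
  filter_upwards [eventually_gt_atTop (K - k).toNat] with i hi
  exact h _ (by omega) _

/-- `d(z₀, z₂)` is truncated in `z₀`, uniformly in the powers of `z₂`. -/
def TruncZ (d : A → ℂ → ℂ) : Prop := ∀ n, ∀ᶠ i : ℕ in atTop, ∀ α, d (n + (i : A)) α = 0

/-- Multiplication by `z₀ + z₂` is injective on series truncated in `z₀`. -/
theorem TruncZ.eq_zero {d : A → ℂ → ℂ} (hd : TruncZ d)
    (h : ∀ n α, d (n + 1) α + d n (α + 1) = 0) : d = 0 := by
  -- Each use of the hypothesis raises n by one and lowers α by one. Since α moves as well, the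
  -- vanishing for large n must be uniform in α.
  have key : ∀ (i : ℕ) n α, d n α = (-1) ^ i * d (n + (i : A)) (α - i) := by
    intro i
    induction i with
    | zero => simp
    | succ i ih =>
      intro n α
      have := eq_neg_of_add_eq_zero_right (h (n + i) (α - i - 1))
      rw [sub_add_cancel] at this
      rw [ih, this]
      push_cast
      rw [show n + ((i : A) + 1) = n + i + 1 by ring, show α - ((i : ℂ) + 1) = α - i - 1 by ring]
      ring
  ext n α
  obtain ⟨i, hi⟩ := (hd n).exists
  rw [key i, hi, mul_zero]
  rfl

/-- The operator `y - z₀` on families indexed by the exponents of `y` and `x`. -/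
def dY (G : ℤ → ℤ → A → ℂ → ℂ) : ℤ → ℤ → A → ℂ → ℂ :=
  fun l m n α => G (l + 1) m n α - G l m (n + 1) α

/-- The operator `x - z₀ - z₂` on families indexed by the exponents of `y` and `x`. -/
def dX (G : ℤ → ℤ → A → ℂ → ℂ) : ℤ → ℤ → A → ℂ → ℂ :=
  fun l m n α => G l (m + 1) n α - (G l m (n + 1) α + G l m n (α + 1))

/-- The operator `x - z₁` on families indexed by the exponents of `y` and `x`. -/
def dXc (G : ℤ → ℤ → A → ℂ → ℂ) : ℤ → ℤ → A → ℂ → ℂ :=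
  fun l m p x => G l (m + 1) p x - G l m (p + 1) x

/-- The relation `y = x - z₂`. -/
def JacRec (G : ℤ → ℤ → A → ℂ → ℂ) : Prop :=
  ∀ l m n α, G (l + 1) m n α = G l (m + 1) n α - G l m n (α + 1)

omit [CommRing A] in
theorem JacRec.sub {G H : ℤ → ℤ → A → ℂ → ℂ} (hG : JacRec G) (hH : JacRec H) :
    JacRec (G - H) := fun l m n α => by
  simp only [Pi.sub_apply, hG l, hH l]; ring

theorem JacRec.dY {G : ℤ → ℤ → A → ℂ → ℂ} (hG : JacRec G) : JacRec (dY G) := fun l m n α => by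
  simp only [VOA.dY, hG l, hG (l + 1)]; ring

/-- Where y = x - z₂ holds, y - z₀ and x - z₀ - z₂ are the same operator. The second form is the one
that has a counterpart x - z₁ in the product. -/
theorem JacRec.dX_eq {G : ℤ → ℤ → A → ℂ → ℂ} (hG : JacRec G) : dX G = VOA.dY G := by
  ext l m n α
  simp only [VOA.dY, dX, hG l]; ring

theorem JacRec.iterate {G : ℤ → ℤ → A → ℂ → ℂ} (hG : JacRec G) (q : ℕ) :
    JacRec (VOA.dY^[q] G) ∧ dX^[q] G = VOA.dY^[q] G := by
  induction q with
  | zero => exact ⟨hG, rfl⟩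
  | succ q ih =>
    simp only [Function.iterate_succ_apply']
    exact ⟨ih.1.dY, by rw [ih.2, ih.1.dX_eq]⟩

theorem dY_sub (G H : ℤ → ℤ → A → ℂ → ℂ) : dY (G - H) = dY G - dY H := by
  ext l m n α
  simp only [dY, Pi.sub_apply]; ring

theorem dY_iterate_sub (G H : ℤ → ℤ → A → ℂ → ℂ) (q : ℕ) :
    dY^[q] (G - H) = dY^[q] G - dY^[q] H := by
  induction q with
  | zero => rfl
  | succ q ih => simp only [Function.iterate_succ_apply', ih, dY_sub]

theorem TruncZ.dY {G : ℤ → ℤ → A → ℂ → ℂ} (hG : ∀ l m, TruncZ (G l m)) (l m : ℤ) :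
    TruncZ (dY G l m) := fun n => by
  filter_upwards [hG (l + 1) m n, hG l m (n + 1)] with i h1 h2 α
  rw [VOA.dY, h1, show n + (i : A) + 1 = n + 1 + i by ring, h2, sub_zero]

/-- On such a family y acts as z₀, hence x acts as z₀ + z₂. Everything is then determined by `G 0
0`: lowering m amounts to dividing by z₀ + z₂, which truncation makes unambiguous, and changing l
only shifts n. -/
theorem JacRec.eq_zero_of_dY {G : ℤ → ℤ → A → ℂ → ℂ} (hG : JacRec G)
    (ht : ∀ l m, TruncZ (G l m)) (hd : VOA.dY G = 0) (h0 : G 0 0 = 0) : G = 0 := by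
  have hY : ∀ l m n α, G (l + 1) m n α = G l m (n + 1) α := fun l m n α =>
    sub_eq_zero.1 (congrFun (congrFun (congrFun (congrFun hd l) m) n) α)
  have hX : ∀ l m n α, G l (m + 1) n α = G l m (n + 1) α + G l m n (α + 1) := fun l m n α => by
    have := hG l m n α
    rw [hY] at this
    rw [this]; ring
  have h1 : ∀ m, G 0 m = 0 := by
    intro m
    induction m using Int.induction_on with
    | zero => exact h0
    | succ m ih =>
      ext n α
      rw [hX, ih]
      simp
    | pred m ih =>
      refine (ht _ _).eq_zero fun n α => ?_
      rw [← hX, sub_add_cancel, ih]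
      rfl
  ext l m n α
  induction l using Int.induction_on generalizing n with
  | zero => rw [h1]; rfl
  | succ l ih => rw [hY, ih]; rfl
  | pred l ih =>
    have := hY (-l - 1) m (n - 1) α
    rw [sub_add_cancel, sub_add_cancel] at this
    rw [← this, ih]
    rfl

/-- Descending induction on the power of y - z₀, removing one factor at a time. -/
theorem JacRec.eq_zero {G : ℤ → ℤ → A → ℂ → ℂ} (hG : JacRec G)
    (ht : ∀ l m, TruncZ (G l m)) {Q : ℕ} (hQ : VOA.dY^[Q] G = 0)
    (h0 : ∀ q, VOA.dY^[q] G 0 0 = 0) : G = 0 := by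
  have htq : ∀ q l m, TruncZ (VOA.dY^[q] G l m) := by
    intro q
    induction q with
    | zero => exact ht
    | succ q ih =>
      simp only [Function.iterate_succ_apply']
      exact TruncZ.dY ih
  have : ∀ j, VOA.dY^[Q - j] G = 0 := by
    intro j
    induction j with
    | zero => exact hQ
    | succ j ih =>
      by_cases hj : j < Q
      · refine ((hG.iterate _).1).eq_zero_of_dY (htq _) ?_ (h0 _)
        rw [← Function.iterate_succ_apply' VOA.dY, ← ih]
        congr 2
        omega
      · rw [show Q - (j + 1) = Q - j by omega, ih]
  simpa using this Q

/-- A linear relation between series `c(z₁, z₂)` and series `d(z₀, z₂)` that behaves like the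
substitution `z₁ = z₀ + z₂`. -/
structure IsSubstitution (E : Submodule ℂ ((A → ℂ → ℂ) × (A → ℂ → ℂ))) : Prop where
  mul_fst : ∀ c d, (c, d) ∈ E →
    ((fun p x => c (p + 1) x), fun n x => d (n + 1) x + d n (x + 1)) ∈ E
  shift : ∀ c d (i : ℤ), (c, d) ∈ E → ((fun p x => c p (x + i)), fun n x => d n (x + i)) ∈ E
  unique : ∀ d, (0, d) ∈ E → d = 0

namespace IsSubstitution

variable {E : Submodule ℂ ((A → ℂ → ℂ) × (A → ℂ → ℂ))} (hE : IsSubstitution E)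
include hE

omit [CommRing A] hE in
-- A linear relation is stable under finite sums only, so the vanishing bound has to hold for whole
-- series and not coefficient by coefficient.
theorem mem_bsum (c : ℤ) {gc g : ℕ → A → ℂ → ℂ} (hm : ∀ i, (gc i, g i) ∈ E) {N : ℕ}
    (hN : ∀ i, N ≤ i → gc i = 0 ∧ g i = 0) :
    ((fun p x => bsum c fun i => gc i p x), fun n x => bsum c fun i => g i n x) ∈ E := by
  have : ((fun p x => bsum c fun i => gc i p x), fun n x => bsum c fun i => g i n x)
      = ∑ i ∈ Finset.range N, Ring.choose c i • (gc i, g i) := by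
    refine Prod.ext ?_ ?_
    · ext p x
      dsimp only
      rw [bsum_eq_sum_range c (N := N) fun i hi => by rw [(hN i hi).1]; rfl]
      simp [Prod.fst_sum, Finset.sum_apply]
    · ext p x
      dsimp only
      rw [bsum_eq_sum_range c (N := N) fun i hi => by rw [(hN i hi).2]; rfl]
      simp [Prod.snd_sum, Finset.sum_apply]
  rw [this]
  exact E.sum_mem fun i _ => zsmul_mem (hm i) _

theorem mem_jP (l m : ℤ) {fc f : ℤ → A → ℂ → ℂ} (hm : ∀ k, (fc k, f k) ∈ E) {K : ℤ}
    (hK : ∀ k < K, fc k = 0 ∧ f k = 0) :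
    ((fun p x => jP l m x fun k y => fc k p y), fun n x => jP l m x fun k y => f k n y) ∈ E := by
  refine mem_bsum l (N := (l + m - K).toNat + 1) (gc := fun i p x => (-1 : ℤ) ^ i •
    fc (l + m - i) p (x + (i : ℂ))) (g := fun i p x => (-1 : ℤ) ^ i •
    f (l + m - i) p (x + (i : ℂ))) ?_ ?_
  · intro i
    exact zsmul_mem (hE.shift _ _ i (hm (l + m - i))) ((-1 : ℤ) ^ i)
  · intro i hi
    rw [(hK (l + m - i) (by omega)).1, (hK (l + m - i) (by omega)).2]
    simp only [Pi.zero_apply, smul_zero]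
    exact ⟨rfl, rfl⟩

theorem mem_jN (l m : ℤ) {fc f : ℤ → A → ℂ → ℂ} (hm : ∀ k, (fc k, f k) ∈ E) {K : ℤ}
    (hK : ∀ k ≥ K, fc k = 0 ∧ f k = 0) :
    ((fun p x => jN l m x fun k y => fc k p y), fun n x => jN l m x fun k y => f k n y) ∈ E := by
  refine mem_bsum l (N := (K - m).toNat + 1) (gc := fun i p x => ((l.negOnePow : ℤ) * (-1) ^ i) •
    fc (m + i) p (x + (l : ℂ) - (i : ℂ))) (g := fun i p x => ((l.negOnePow : ℤ) * (-1) ^ i) •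
    f (m + i) p (x + (l : ℂ) - (i : ℂ))) ?_ ?_
  · intro i
    have := zsmul_mem (hE.shift _ _ (l - i) (hm (m + i))) ((l.negOnePow : ℤ) * (-1) ^ i)
    simp only [Int.cast_sub, Int.cast_natCast, ← add_sub_assoc] at this
    exact this
  · intro i hi
    rw [(hK (m + i) (by omega)).1, (hK (m + i) (by omega)).2]
    simp only [Pi.zero_apply, smul_zero]
    exact ⟨rfl, rfl⟩

theorem mem_jR (l m : ℤ) {fc f : ℤ → A → ℂ → ℂ} (hm : ∀ k, (fc k, f k) ∈ E) {K : ℤ}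
    (hK : ∀ k ≥ K, fc k = 0 ∧ f k = 0) :
    ((fun p x => jR l m x fun k y => fc k p y), fun n x => jR l m x fun k y => f k n y) ∈ E := by
  refine mem_bsum m (N := (K - l).toNat + 1) (gc := fun i p x => fc (l + i) p (x + (m : ℂ) - (i : ℂ)))
    (g := fun i p x => f (l + i) p (x + (m : ℂ) - (i : ℂ))) ?_ ?_
  · intro i
    have := hE.shift _ _ (m - i) (hm (l + i))
    simp only [Int.cast_sub, Int.cast_natCast, ← add_sub_assoc] at this
    exact this
  · intro i hi
    rw [(hK (l + i) (by omega)).1, (hK (l + i) (by omega)).2]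
    exact ⟨rfl, rfl⟩

/-- The substitution carries x - z₁ to x - z₀ - z₂. -/
theorem mem_dX {Gc G : ℤ → ℤ → A → ℂ → ℂ} (hm : ∀ l m, (Gc l m, G l m) ∈ E) (q : ℕ) (l m : ℤ) :
    (dXc^[q] Gc l m, dX^[q] G l m) ∈ E := by
  induction q generalizing l m with
  | zero => exact hm l m
  | succ q ih =>
    simp only [Function.iterate_succ_apply']
    exact E.sub_mem (ih l (m + 1)) (hE.mul_fst _ _ (ih l m))

theorem eq_of_mem {c d d' : A → ℂ → ℂ} (h : (c, d) ∈ E) (h' : (c, d') ∈ E) : d = d' := by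
  have := E.sub_mem h h'
  rw [Prod.mk_sub_mk, sub_self] at this
  exact sub_eq_zero.1 (hE.unique _ this)

end IsSubstitution

end Associativity

/-! ### The Jacobi identity for insertions outside the iterate -/

section Associativity

variable {A : Type*} [CommRing A]

/-- Matrix coefficients of the product (`PPc`, `MM`, `NNc`, `R1c`, `R2c`) and of the iterate (`PP`,
`NN`, `R1`, `R2`) of two intertwining operators with a mode of a vertex operator inserted: on the
left, in the middle, on the right, on the first and on the second argument. -/
structure AssocData (E : Submodule ℂ ((A → ℂ → ℂ) × (A → ℂ → ℂ)))
    (PPc MM NNc R1c R2c PP NN R1 R2 : ℤ → A → ℂ → ℂ) : Prop where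
  subst : IsSubstitution E
  p_low : ∃ K, ∀ k < K, PPc k = 0 ∧ PP k = 0
  n_high : ∃ K, ∀ k ≥ K, NNc k = 0 ∧ NN k = 0
  r1_high : ∃ K, ∀ k ≥ K, R1c k = 0 ∧ R1 k = 0
  r2_high : ∃ K, ∀ k ≥ K, R2c k = 0 ∧ R2 k = 0
  m_high : ∀ x, ∃ K, ∀ k ≥ K, ∀ p, MM k p x = 0
  m_trunc : ∀ p, TruncP fun k x => MM k p x
  pn_trunc : ∀ n, ∀ᶠ i : ℕ in atTop, ∀ k α, PP k (n + (i : A)) α = 0 ∧ NN k (n + (i : A)) α = 0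
  r1_trunc : ∀ k, TruncZ (R1 k)
  r2_trunc : ∀ k, TruncZ (R2 k)
  jac1 : ∀ x l m p, jP l m p (fun k y => PPc k y x) - jN l m p (fun k y => MM k y x)
    = jR l m p fun k y => R1c k y x
  jac2 : ∀ p l m x, jP l m x (fun k y => MM k p y) - jN l m x (fun k y => NNc k p y)
    = jR l m x fun k y => R2c k p y
  p_mem : ∀ k, (PPc k, PP k) ∈ E
  n_mem : ∀ k, (NNc k, NN k) ∈ E
  r1_mem : ∀ k, (R1c k, R1 k) ∈ E
  r2_mem : ∀ k, (R2c k, R2 k) ∈ E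

/-- Only finitely many `R (l + j)` can be nonzero, and each is truncated, so a single bound serves
for all j. -/
theorem high_trunc {R : ℤ → A → ℂ → ℂ} {K : ℤ} (hK : ∀ k ≥ K, R k = 0) (ht : ∀ k, TruncZ (R k))
    (l : ℤ) (n : A) : ∀ᶠ i : ℕ in atTop, ∀ (j : ℕ) y, R (l + j) (n + (i : A)) y = 0 := by
  have := (eventually_all_finset (Finset.range (K - l).toNat)).2
    fun j (_ : j ∈ Finset.range (K - l).toNat) => ht (l + j) n
  filter_upwards [this] with i hi j y
  by_cases hj : j < (K - l).toNat
  · exact hi j (Finset.mem_range.2 hj) y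
  · rw [hK _ (by omega)]; rfl

theorem high_trunc_diag {R : ℤ → A → ℂ → ℂ} {K : ℤ} (hK : ∀ k ≥ K, R k = 0)
    (ht : ∀ k, TruncZ (R k)) (q : ℤ) (n : A) :
    ∃ K' : ℤ, ∀ k ≥ K', ∀ (j : ℕ) y, R (q + j) (n + (k : A) - (j : A)) y = 0 := by
  obtain ⟨I, hI⟩ := eventually_atTop.1 (high_trunc hK ht q n)
  refine ⟨I + (K - q).toNat, fun k hk j y => ?_⟩
  by_cases hj : q + j < K
  · have := hI (k - j).toNat (by omega) j y
    have h2 : (((k - j).toNat : ℕ) : A) = (k : A) - (j : A) := by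
      have : (((k - j).toNat : ℤ) : A) = ((k - j : ℤ) : A) := by
        rw [Int.toNat_of_nonneg (by omega)]
      simpa using this
    rwa [h2, ← add_sub_assoc] at this
  · rw [hK _ (by omega)]; rfl

/-- The operator `x - z₁` on families. -/
def dFam (f : ℤ → A → ℂ → ℂ) : ℤ → A → ℂ → ℂ := fun k p x => f (k + 1) p x - f k (p + 1) x

theorem truncP_dFam {f : ℤ → A → ℂ → ℂ} (hf : ∀ p, TruncP fun k x => f k p x) (q : ℕ) (p : A) :
    TruncP fun k x => dFam^[q] f k p x := by
  induction q generalizing p with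
  | zero => exact hf p
  | succ q ih =>
    simp only [Function.iterate_succ_apply', dFam]
    intro k x
    refine EvZero.sub ?_ (ih (p + 1) k x)
    filter_upwards [ih p (k + 1) x] with i hi
    simpa only [sub_add_eq_add_sub] using hi

theorem dXc_jP {f : ℤ → A → ℂ → ℂ} (hf : ∀ p, TruncP fun k x => f k p x) (q : ℕ) :
    dXc^[q] (fun l m p x => jP l m x fun k y => f k p y)
      = fun l m p x => jP l m x fun k y => dFam^[q] f k p y := by
  induction q with
  | zero => rfl
  | succ q ih =>
    simp only [Function.iterate_succ_apply', ih]
    ext l m p x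
    have h1 : TruncP fun k x => dFam^[q] f (k + 1) p x := fun k x => by
      filter_upwards [truncP_dFam hf q p (k + 1) x] with i hi
      simpa only [sub_add_eq_add_sub] using hi
    simp only [dXc, dFam]
    rw [jP_sub l m x h1 (truncP_dFam hf q (p + 1))]
    congr 1
    exact bsum_congr _ fun i => by rw [show l + (m + 1) - (i : ℤ) = l + m - i + 1 by ring]

namespace AssocData

variable {E : Submodule ℂ ((A → ℂ → ℂ) × (A → ℂ → ℂ))}
  {PPc MM NNc R1c R2c PP NN R1 R2 : ℤ → A → ℂ → ℂ}
  (h : AssocData E PPc MM NNc R1c R2c PP NN R1 R2)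
include h

/-- For a nonnegative exponent both expansions of (x - z₁)^q are the same polynomial, so the left
side of `jac1` at l = q is this polynomial applied to the commutator `PPc - MM`. -/
theorem dFam_eq (q : ℕ) (k : ℤ) (p : A) (x : ℂ) :
    dFam^[q] (fun k p x => PPc k p x - MM k p x) k p x = jR q k p fun k y => R1c k y x := by
  obtain ⟨K, hK⟩ := h.p_low
  obtain ⟨K', hK'⟩ := h.m_high x
  rw [← h.jac1]
  induction q generalizing k p with
  | zero => simp [jP_zero, jN_zero]
  | succ q ih =>
    simp only [Function.iterate_succ_apply', dFam]
    rw [ih, ih]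
    push_cast
    rw [jP_succ, jN_succ]
    · ring
    · exact truncN_of_high fun k hk p => hK' k hk p
    · exact truncP_of_low fun k hk p => by rw [(hK k hk).1]; rfl

/-- By `jac2` the right insertion and the insertion on the second argument combine into the middle
insertion. What is left is `jP` of the commutator `PPc - MM`, and `dFam_eq` applies to it. -/
theorem dXc_eq (q : ℕ) (l m : ℤ) :
    dXc^[q] (fun l m p x => jP l m x (fun k y => PPc k p y) - jN l m x (fun k y => NNc k p y)
      - jR l m x (fun k y => R2c k p y)) l m
    = fun p x => jP l m x fun k y => jR q k p fun k' y' => R1c k' y' y := by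
  obtain ⟨K, hK⟩ := h.p_low
  have h1 : ∀ p, TruncP fun k x => PPc k p x := fun p =>
    truncP_of_low fun k hk x => by rw [(hK k hk).1]; rfl
  have h2 : (fun l m p x => jP l m x (fun k y => PPc k p y) - jN l m x (fun k y => NNc k p y)
      - jR l m x (fun k y => R2c k p y))
      = fun l m p x => jP l m x fun k y => PPc k p y - MM k p y := by
    ext l m p x
    rw [jP_sub l m x (h1 p) (h.m_trunc p), ← h.jac2]
    ring
  rw [h2, dXc_jP (f := fun k p x => PPc k p x - MM k p x)
    fun p k x => (h1 p k x).sub (h.m_trunc p k x)]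
  ext p x
  simp only [h.dFam_eq]

omit [CommRing A] h in
theorem jacRec_jP {f : ℤ → A → ℂ → ℂ} (hf : ∀ n, TruncP fun k x => f k n x) :
    JacRec fun l m n α => jP l m α fun k y => f k n y :=
  fun l m n α => jP_succ l m α (hf n)

omit [CommRing A] h in
theorem jacRec_jN {f : ℤ → A → ℂ → ℂ} (hf : ∀ n, TruncN fun k x => f k n x) :
    JacRec fun l m n α => jN l m α fun k y => f k n y :=
  fun l m n α => jN_succ l m α (hf n)

omit [CommRing A] h in
theorem jacRec_jR {f : ℤ → A → ℂ → ℂ} (hf : ∀ n, TruncN fun k x => f k n x) :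
    JacRec fun l m n α => jR l m α fun k y => f k n y :=
  fun l m n α => jR_succ l m α (hf n)

theorem truncN_jR (q : ℤ) (n : A) :
    TruncN fun (k : ℤ) (y : ℂ) => jR q k n fun k' y' => R1 k' y' y := by
  obtain ⟨K, hK⟩ := h.r1_high
  obtain ⟨K', hK'⟩ := high_trunc_diag (fun k hk => (hK k hk).2) h.r1_trunc q n
  exact truncN_of_high fun k hk y => bsum_eq_zero _ fun j => hK' k hk j y

theorem truncN_r1 (y : ℂ) : TruncN fun k y' => R1 k y' y := by
  obtain ⟨K, hK⟩ := h.r1_high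
  exact truncN_of_high fun k hk x => by rw [(hK k hk).2]; rfl

theorem dY_jR (q : ℕ) :
    dY^[q] (fun l m n α => jR l m α fun k y => jR 0 k n fun k' y' => R1 k' y' y)
      = fun l m n α => jR l m α fun k y => jR q k n fun k' y' => R1 k' y' y := by
  induction q with
  | zero => rfl
  | succ q ih =>
    simp only [Function.iterate_succ_apply', ih]
    ext l m n α
    simp only [dY]
    push_cast
    have h1 : TruncN fun (k : ℤ) (y : ℂ) => jR q (k + 1) n fun k' y' => R1 k' y' y := fun k x => by
      filter_upwards [h.truncN_jR q n (k + 1) x] with i hi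
      simpa only [add_right_comm] using hi
    simp only [fun k y => jR_succ q k n (h.truncN_r1 y)]
    rw [jR_sub l m α h1 (h.truncN_jR q (n + 1))]
    congr 1
    exact bsum_congr _ fun i => by rw [show l + 1 + (i : ℤ) = l + i + 1 by ring]

/-- The commutator formula and its consequences: the Jacobi identity for the insertion of a vertex
operator on the left and on the right of the iterate. -/
theorem outer_jacobi (l m : ℤ) (n : A) (α : ℂ) :
    jP l m α (fun k y => PP k n y) - jN l m α (fun k y => NN k n y)
      = jR l m α fun k y => R2 k n y + jR 0 k n fun k' y' => R1 k' y' y := by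
  obtain ⟨KP, hKP⟩ := h.p_low
  obtain ⟨KN, hKN⟩ := h.n_high
  obtain ⟨K1, hK1⟩ := h.r1_high
  obtain ⟨K2, hK2⟩ := h.r2_high
  have tP : ∀ n, TruncP fun k x => PP k n x := fun p =>
    truncP_of_low fun k hk x => by rw [(hKP k hk).2]; rfl
  have tN : ∀ n, TruncN fun k x => NN k n x := fun p =>
    truncN_of_high fun k hk x => by rw [(hKN k hk).2]; rfl
  have t2 : ∀ n, TruncN fun k x => R2 k n x := fun p =>
    truncN_of_high fun k hk x => by rw [(hK2 k hk).2]; rfl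
  have tA : ∀ n, TruncN fun (k : ℤ) (y : ℂ) => jR 0 k n fun k' y' => R1 k' y' y :=
    fun n => h.truncN_jR 0 n
  set G : ℤ → ℤ → A → ℂ → ℂ := (fun l m n α => jP l m α (fun k y => PP k n y)
    - jN l m α (fun k y => NN k n y) - jR l m α (fun k y => R2 k n y)) with hGdef
  set G₁ : ℤ → ℤ → A → ℂ → ℂ := fun l m n α =>
    jR l m α fun k y => jR 0 k n fun k' y' => R1 k' y' y with hG₁def
  have rG : JacRec G := ((jacRec_jP tP).sub (jacRec_jN tN)).sub (jacRec_jR t2)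
  have rG₁ : JacRec G₁ := jacRec_jR (f := fun k n y => jR 0 k n fun k' y' => R1 k' y' y) tA
  -- G is the image of the same expression in the product, where (x - z₁)^q leaves only insertions
  -- on the first argument. On G this operator is (y - z₀)^q.
  have hmem : ∀ (q : ℕ) (l m : ℤ), ((fun p x => jP l m x fun k y => jR q k p fun k' y' => R1c k' y' y),
      dY^[q] G l m) ∈ E := by
    intro q l m
    rw [← h.dXc_eq, ← (rG.iterate q).2]
    refine h.subst.mem_dX (fun l m => ?_) q l m
    exact E.sub_mem (E.sub_mem (h.subst.mem_jP l m h.p_mem hKP) (h.subst.mem_jN l m h.n_mem hKN))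
      (h.subst.mem_jR l m h.r2_mem hK2)
  -- Both families are killed by (y - z₀)^q once q reaches K1, where `R1c` and `R1` vanish. So it is
  -- enough to compare them at l = m = 0 for every q.
  have hz : G - G₁ = 0 := by
    refine (rG.sub rG₁).eq_zero (Q := K1.toNat) ?_ ?_ ?_
    · intro l m n
      obtain ⟨I, hI⟩ := high_trunc_diag (fun k hk => (hK1 k hk).2) h.r1_trunc 0 n
      filter_upwards [h.pn_trunc n, high_trunc (fun k hk => (hK2 k hk).2) h.r2_trunc l n,
        eventually_ge_atTop (I - l).toNat] with i h1 h2 h3 α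
      simp only [hGdef, hG₁def, Pi.sub_apply]
      rw [jP_eq_zero, jN_eq_zero, jR_eq_zero, jR]
      · rw [bsum_eq_zero]
        · simp
        · intro j
          refine bsum_eq_zero _ fun j' => ?_
          have := hI (l + j + i) (by omega) j' (α + m - j)
          rw [← this]
          push_cast
          congr 2
          ring
      · intro j y; exact h2 j y
      · intro j y; exact (h1 _ _).2
      · intro j; exact (h1 _ _).1
    · rw [dY_iterate_sub, h.dY_jR]
      ext l m n α
      have h1 := hmem K1.toNat l m
      have h2 : (fun p x => jP l m x fun k y => jR K1.toNat k p fun k' y' => R1c k' y' y)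
          = (0 : A → ℂ → ℂ) := by
        ext p x
        refine jP_eq_zero _ _ _ fun i => jR_eq_zero _ _ _ fun j y => ?_
        rw [(hK1 _ (by omega)).1]; rfl
      rw [h2] at h1
      simp only [Pi.sub_apply]
      rw [h.subst.unique _ h1, jR_eq_zero]
      · simp
      · refine fun i y => jR_eq_zero _ _ _ fun j y => ?_
        rw [(hK1 _ (by omega)).2]; rfl
    -- At l = m = 0 the series to be carried over is `R1c q` itself, so uniqueness of the
    -- substitution identifies the result with `R1 q`.
    · intro q
      rw [dY_iterate_sub, h.dY_jR]
      ext n α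
      have h1 := hmem q 0 0
      simp only [jP_zero, jR_zero] at h1
      have h3 := h.subst.eq_of_mem h1 (h.r1_mem q)
      simp only [Pi.sub_apply]
      rw [h3, jR_zero, jR_zero, sub_self]
      rfl
  have := congrFun (congrFun (congrFun (congrFun hz l) m) n) α
  simp only [hGdef, hG₁def, Pi.sub_apply, Pi.zero_apply] at this
  rw [jR_add l m α (t2 n) (tA n)]
  linear_combination this

end AssocData

end Associativity

/-! ### The Jacobi identity for insertions into the inner operator -/

section Associativity

variable {A : Type*} [CommRing A]

/-- Multiplication by `z₀ + z₂`. -/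
def mulZ (d : A → ℂ → ℂ) : A → ℂ → ℂ := fun n x => d (n + 1) x + d n (x + 1)

theorem mulZ_zero : mulZ (0 : A → ℂ → ℂ) = 0 := by
  ext n x; simp [mulZ]

theorem mulZ_iterate_zero (q : ℕ) : mulZ^[q] (0 : A → ℂ → ℂ) = 0 :=
  Function.iterate_fixed mulZ_zero q

theorem TruncZ.mulZ {d : A → ℂ → ℂ} (hd : TruncZ d) : TruncZ (mulZ d) := fun n => by
  filter_upwards [hd n, hd (n + 1)] with i h1 h2 x
  rw [VOA.mulZ, h1, add_right_comm, h2, add_zero]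

theorem TruncZ.mulZ_iterate {d : A → ℂ → ℂ} (hd : TruncZ d) (q : ℕ) : TruncZ (VOA.mulZ^[q] d) := by
  induction q with
  | zero => exact hd
  | succ q ih => rw [Function.iterate_succ_apply']; exact ih.mulZ

theorem TruncZ.eq_zero_of_mulZ_iterate {d : A → ℂ → ℂ} (hd : TruncZ d) {q : ℕ}
    (hq : VOA.mulZ^[q] d = 0) : d = 0 := by
  induction q with
  | zero => exact hq
  | succ q ih =>
    refine ih ((hd.mulZ_iterate q).eq_zero fun n α => ?_)
    rw [Function.iterate_succ_apply'] at hq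
    exact congrFun (congrFun hq n) α

theorem mulZ_iterate_shift (q : ℕ) (d : A → ℂ → ℂ) (n : A) (x : ℂ) :
    mulZ^[q] (fun n x => d (n + 1) x) n x = mulZ^[q] d (n + 1) x := by
  induction q generalizing n x with
  | zero => rfl
  | succ q ih => simp only [Function.iterate_succ_apply', mulZ, ih]

theorem IsSubstitution.mulZ_mem {E : Submodule ℂ ((A → ℂ → ℂ) × (A → ℂ → ℂ))}
    (hE : IsSubstitution E) {c d : A → ℂ → ℂ} (h : (c, d) ∈ E) (i : ℕ) :
    ((fun p x => c (p + (i : A)) x), mulZ^[i] d) ∈ E := by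
  induction i with
  | zero => simpa using h
  | succ i ih =>
    rw [Function.iterate_succ_apply']
    have e : (fun (p : A) x => c (p + ((i + 1 : ℕ) : A)) x)
        = fun (p : A) x => c (p + 1 + (i : A)) x := by
      ext p x
      congr 1
      push_cast
      ring
    rw [e]
    exact hE.mul_fst _ _ ih

/-- The operator `x - z₂` on families indexed by the exponent of `x`. -/
def tOp (F : ℕ → A → ℂ → ℂ) : ℕ → A → ℂ → ℂ := fun k p x => F (k + 1) p x - F k p (x + 1)

/-- The operator `y + z₂` on families indexed by the exponent of `y`. -/
def omOp (F : ℕ → A → ℂ → ℂ) : ℕ → A → ℂ → ℂ := fun k p x => F (k + 1) p x + F k p (x + 1)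

omit [CommRing A] in
theorem jP_eq_tOp {f : ℤ → A → ℂ → ℂ} (hf : ∀ p, TruncP fun k x => f k p x) (m : ℕ) (k : ℕ)
    (p : A) (x : ℂ) :
    jP m k x (fun k x => f k p x) = tOp^[m] (fun (k : ℕ) => f k) k p x := by
  induction m generalizing k x with
  | zero => simp [jP_zero]
  | succ m ih =>
    push_cast
    rw [jP_succ _ _ _ (hf p), Function.iterate_succ_apply', tOp, ← ih, ← ih]
    rfl

omit [CommRing A] in
theorem tOp_iterate_sub (F G : ℕ → A → ℂ → ℂ) (q : ℕ) :
    tOp^[q] (F - G) = tOp^[q] F - tOp^[q] G := by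
  induction q with
  | zero => rfl
  | succ q ih =>
    simp only [Function.iterate_succ_apply', ih]
    ext k p x
    simp only [tOp, Pi.sub_apply]; ring

omit [CommRing A] in
theorem omOp_iterate_sub (F G : ℕ → A → ℂ → ℂ) (q : ℕ) :
    omOp^[q] (F - G) = omOp^[q] F - omOp^[q] G := by
  induction q with
  | zero => rfl
  | succ q ih =>
    simp only [Function.iterate_succ_apply', ih]
    ext k p x
    simp only [omOp, Pi.sub_apply]; ring

theorem IsSubstitution.tOp_mem {E : Submodule ℂ ((A → ℂ → ℂ) × (A → ℂ → ℂ))}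
    (hE : IsSubstitution E) {Fc F : ℕ → A → ℂ → ℂ} (h : ∀ k, (Fc k, F k) ∈ E) (q k : ℕ) :
    (tOp^[q] Fc k, tOp^[q] F k) ∈ E := by
  induction q generalizing k with
  | zero => exact h k
  | succ q ih =>
    simp only [Function.iterate_succ_apply']
    have := hE.shift _ _ 1 (ih k)
    rw [Int.cast_one] at this
    exact E.sub_mem (ih (k + 1)) this

/-- If y acts as z₀ from index M on, then y + z₂ acts there as z₀ + z₂, and that can be cancelled.
-/
theorem omOp_iterate_of_shift {G : ℕ → A → ℂ → ℂ} {M : ℕ}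
    (hG : ∀ m ≥ M, ∀ n α, G (m + 1) n α = G m (n + 1) α) (q : ℕ) {m : ℕ} (hm : M ≤ m) :
    omOp^[q] G m = mulZ^[q] (G m) := by
  induction q generalizing m with
  | zero => rfl
  | succ q ih =>
    ext n α
    simp only [Function.iterate_succ_apply', omOp, mulZ]
    have e : (fun n x => G m (n + 1) x) = G (m + 1) := by
      ext n α
      exact (hG m hm n α).symm
    rw [ih hm, ih (by omega : M ≤ m + 1), ← mulZ_iterate_shift, e]

/-- The family `(σ + z₁)ᵏ R`, with `z₁ = z₀ + z₂` and `σ` the shift. -/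
def rFam (R : ℤ → A → ℂ → ℂ) (l : ℤ) : ℕ → A → ℂ → ℂ
  | 0 => R l
  | k + 1 => fun n α => rFam R (l + 1) k n α + mulZ (rFam R l k) n α

theorem tOp_rFam (R : ℤ → A → ℂ → ℂ) (l : ℤ) (m k : ℕ) :
    tOp^[m] (rFam R l) (k + 1)
      = fun n α => tOp^[m] (rFam R (l + 1)) k n α + mulZ (tOp^[m] (rFam R l) k) n α := by
  induction m generalizing k with
  | zero => rfl
  | succ m ih =>
    simp only [Function.iterate_succ_apply']
    ext n α
    simp only [tOp, ih, mulZ]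
    ring

/-- Let σ raise the index l. Both sides are (σ + z₀)^m (σ + z₀ + z₂)^k R l: on the left y = σ + z₀,
on the right x = σ + z₁ with z₁ = z₀ + z₂. -/
theorem omOp_jR {R : ℤ → A → ℂ → ℂ} (hR : ∀ y, TruncN fun k n => R k n y) (l : ℤ) (k m : ℕ) :
    omOp^[k] (fun (m : ℕ) n α => jR l m n fun k' n' => R k' n' α) m = tOp^[m] (rFam R l) k := by
  induction k generalizing m with
  | zero =>
    simp only [Function.iterate_zero, id_eq]
    induction m generalizing l with
    | zero =>
      ext n α
      simp [jR_zero, rFam]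
    | succ m ih =>
      have h1 := fun n α => congrFun (congrFun (ih (l + 1)) n) α
      have h2 := fun n α => congrFun (congrFun (ih l) n) α
      ext n α
      rw [Function.iterate_succ_apply', tOp, tOp_rFam]
      simp only [mulZ]
      rw [← h1, ← h2, jR_succ _ _ _ (hR α)]
      push_cast
      simp only [h2]
      ring
  | succ k ih =>
    ext n α
    rw [Function.iterate_succ_apply', omOp, ih, ih, Function.iterate_succ_apply', tOp]
    ring

namespace AssocData

variable {E : Submodule ℂ ((A → ℂ → ℂ) × (A → ℂ → ℂ))}
  {PPc MM NNc R1c R2c PP NN R1 R2 : ℤ → A → ℂ → ℂ}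
  (h : AssocData E PPc MM NNc R1c R2c PP NN R1 R2)
include h

theorem rFam_mem (l : ℤ) (k : ℕ) :
    ((fun p x => jR l k p fun k' p' => R1c k' p' x), rFam R1 l k) ∈ E := by
  obtain ⟨K, hK⟩ := h.r1_high
  have ht : ∀ x, TruncN fun k p => R1c k p x := fun x =>
    truncN_of_high fun k hk p => by rw [(hK k hk).1]; rfl
  induction k generalizing l with
  | zero => simpa [jR_zero, rFam] using h.r1_mem l
  | succ k ih =>
    have := E.add_mem (ih (l + 1)) (h.subst.mul_fst _ _ (ih l))
    rw [Prod.mk_add_mk] at this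
    have e : (fun p x => jR l ((k + 1 : ℕ) : ℤ) p fun k' p' => R1c k' p' x)
        = (fun p x => jR (l + 1) k p fun k' p' => R1c k' p' x)
          + fun p x => jR l k (p + 1) fun k' p' => R1c k' p' x := by
      ext p x
      simp only [Pi.add_apply, jR_succ _ _ _ (ht x)]
      push_cast
      ring
    rw [e]
    exact this

/-- The coefficients of `(x - z₀ - z₂)ˡ PP`, expanded in negative powers of `x`. -/
def pFam (PP : ℤ → A → ℂ → ℂ) (l k : ℤ) (n : A) (α : ℂ) : ℂ :=
  bsum l fun i => (-1 : ℤ) ^ i • mulZ^[i] (PP (l + k - i)) n α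

theorem pFam_mem (l k : ℤ) : ((fun p x => jP l k p fun k' p' => PPc k' p' x), pFam PP l k) ∈ E := by
  obtain ⟨K, hK⟩ := h.p_low
  refine IsSubstitution.mem_bsum l (N := (l + k - K).toNat + 1)
    (gc := fun i p x => (-1 : ℤ) ^ i • PPc (l + k - i) (p + (i : A)) x)
    (g := fun i n x => (-1 : ℤ) ^ i • mulZ^[i] (PP (l + k - i)) n x) ?_ ?_
  · intro i
    exact zsmul_mem (h.subst.mulZ_mem (h.p_mem (l + k - i)) i) ((-1 : ℤ) ^ i)
  · intro i hi
    rw [(hK (l + k - i) (by omega)).1, (hK (l + k - i) (by omega)).2, mulZ_iterate_zero]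
    simp only [Pi.zero_apply, smul_zero]
    exact ⟨rfl, rfl⟩

theorem pFam_low (l : ℤ) : ∃ K, ∀ k < K, pFam PP l k = 0 := by
  obtain ⟨K, hK⟩ := h.p_low
  refine ⟨K - l, fun k hk => ?_⟩
  ext n α
  refine bsum_eq_zero _ fun i => ?_
  rw [(hK (l + k - i) (by omega)).2, mulZ_iterate_zero]
  simp

theorem pFam_succ (l k : ℤ) (n : A) (α : ℂ) :
    pFam PP (l + 1) k n α = pFam PP l (k + 1) n α - mulZ (pFam PP l k) n α := by
  obtain ⟨K, hK⟩ := h.p_low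
  have ht : ∀ l k n α, EvZero fun i : ℕ => (-1 : ℤ) ^ i • mulZ^[i] (PP (l + k - i)) n α := by
    intro l k n α
    filter_upwards [eventually_gt_atTop (l + k - K).toNat] with i hi
    rw [(hK (l + k - i) (by omega)).2, mulZ_iterate_zero]
    simp
  simp only [mulZ, pFam]
  rw [bsum_succ _ (ht _ _ _ _), ← bsum_add _ (ht _ _ _ _) (ht _ _ _ _), sub_eq_add_neg, ← bsum_neg]
  congr 1
  · exact bsum_congr _ fun i => by rw [show l + 1 + k - (i : ℤ) = l + (k + 1) - i by ring]
  · refine bsum_congr _ fun i => ?_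
    rw [pow_succ, mul_neg_one, neg_smul, Function.iterate_succ_apply',
      show l + 1 + k - ((i + 1 : ℕ) : ℤ) = l + k - i by push_cast; ring, mulZ, smul_add]

/-- Two expansions of (x - z₂ - z₀)^{-j} agree: one in z₀/y with y = x - z₂ expanded afterwards, the
other directly in negative powers of x. Both satisfy the same recursion, and the truncation in z₀,
uniform in the other exponents, leaves no room for a difference. -/
theorem jP_jP (j : ℕ) (k m : ℤ) (n : A) (α : ℂ) :
    jP (-j : ℤ) m n (fun M y => jP M k α fun k' y' => PP k' y y')
      = jP m k α fun k' y' => pFam PP (-j) k' n y' := by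
  induction j generalizing m n α with
  | zero => simp [jP_zero, pFam, bsum_zero]
  | succ j ih =>
    obtain ⟨Kp, hKp⟩ := h.pFam_low (-(j + 1 : ℤ))
    have hj : -((j : ℤ) + 1) + 1 = -j := by ring
    set L1 : ℤ → A → ℂ → ℂ := fun m n α =>
      jP (-(j + 1 : ℤ)) m n (fun M y => jP M k α fun k' y' => PP k' y y') with hL1
    set L2 : ℤ → A → ℂ → ℂ := fun m n α =>
      jP m k α fun k' y' => pFam PP (-(j + 1 : ℤ)) k' n y' with hL2
    have t1 : ∀ α, TruncP fun M y => jP M k α fun k' y' => PP k' y y' := by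
      intro α M n
      filter_upwards [h.pn_trunc n] with i hi
      exact jP_eq_zero _ _ _ fun i' => (hi _ _).1
    have t2 : ∀ n, TruncP fun k' y' => pFam PP (-(j + 1 : ℤ)) k' n y' := fun n =>
      truncP_of_low fun k hk x => by rw [hKp k hk]; rfl
    have r1 : ∀ m n α, L1 (m + 1) n α - L1 m (n + 1) α
        = jP m k α fun k' y' => pFam PP (-j) k' n y' := by
      intro m n α
      rw [hL1, ← jP_succ _ _ _ (t1 α), hj, ih]
    have r2 : ∀ m n α, L2 (m + 1) n α - L2 m (n + 1) α
        = jP m k α fun k' y' => pFam PP (-j) k' n y' := by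
      intro m n α
      have t3 : TruncP fun k' y' => pFam PP (-(j + 1 : ℤ)) (k' + 1) n y' :=
        truncP_of_low (K := Kp - 1) fun k hk x => by rw [hKp _ (by omega)]; rfl
      have t4 : TruncP fun k' y' => pFam PP (-(j + 1 : ℤ)) k' n (y' + 1) :=
        truncP_of_low fun k hk x => by rw [hKp k hk]; rfl
      simp only [hL2]
      rw [← hj]
      simp only [h.pFam_succ, mulZ]
      rw [jP_sub _ _ _ t3 fun k x => (t2 (n + 1) k x).add (t4 k x), jP_add _ _ _ (t2 _) t4,
        jP_succ _ _ _ (t2 n)]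
      have e1 : jP m (k + 1) α (fun k' y' => pFam PP (-(j + 1 : ℤ)) k' n y')
          = jP m k α fun k' y' => pFam PP (-(j + 1 : ℤ)) (k' + 1) n y' :=
        bsum_congr _ fun i => by rw [show m + (k + 1) - (i : ℤ) = m + k - i + 1 by ring]
      have e2 : jP m k (α + 1) (fun k' y' => pFam PP (-(j + 1 : ℤ)) k' n y')
          = jP m k α fun k' y' => pFam PP (-(j + 1 : ℤ)) k' n (y' + 1) :=
        bsum_congr _ fun i => by rw [show α + 1 + (i : ℂ) = α + i + 1 by ring]
      rw [e1, e2]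
      ring
    -- The difference is invariant under (m, n) ↦ (m - 1, n + 1), and both terms vanish once n is
    -- large.
    have key : ∀ (i : ℕ) m n α, L1 m n α - L2 m n α
        = L1 (m - i) (n + (i : A)) α - L2 (m - i) (n + (i : A)) α := by
      intro i
      induction i with
      | zero => simp
      | succ i ihi =>
        intro m n α
        have h1 := r1 (m - i - 1) (n + i) α
        have h2 := r2 (m - i - 1) (n + i) α
        rw [sub_add_cancel] at h1 h2
        rw [ihi]
        push_cast
        rw [show m - ((i : ℤ) + 1) = m - i - 1 by ring, ← add_assoc]
        linear_combination h1 - h2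
    have hz : ∀ᶠ i : ℕ in atTop, ∀ k α, PP k (n + (i : A)) α = 0 :=
      (h.pn_trunc n).mono fun i hi k α => (hi k α).1
    obtain ⟨I, hI⟩ := eventually_atTop.1 hz
    have hit : ∀ (q : ℕ) k (i : ℕ), I ≤ i → ∀ α, mulZ^[q] (PP k) (n + (i : A)) α = 0 := by
      intro q k
      induction q with
      | zero => exact fun i hi α => hI i hi k α
      | succ q ihq =>
        intro i hi α
        have := ihq (i + 1) (by omega) α
        push_cast at this
        rw [Function.iterate_succ_apply', mulZ, ihq i hi, add_assoc, this, add_zero]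
    have hk := key I m n α
    have z1 : L1 (m - I) (n + (I : A)) α = 0 := by
      refine jP_eq_zero _ _ _ fun i => jP_eq_zero _ _ _ fun i' => ?_
      have := hI (I + i) (by omega)
      push_cast at this
      rw [add_assoc, this]
    have z2 : L2 (m - I) (n + (I : A)) α = 0 := by
      refine jP_eq_zero _ _ _ fun i => bsum_eq_zero _ fun i' => ?_
      rw [hit _ _ _ le_rfl, smul_zero]
    rw [z1, z2, sub_zero, sub_eq_zero] at hk
    simpa [hL1, hL2] using hk

theorem m_jP_high (m : ℕ) (x : ℂ) :
    ∃ K, ∀ k ≥ K, ∀ p, jP m k x (fun k' y' => MM k' p y') = 0 := by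
  induction m generalizing x with
  | zero => simpa [jP_zero] using h.m_high x
  | succ m ih =>
    obtain ⟨K, hK⟩ := ih x
    obtain ⟨K', hK'⟩ := ih (x + 1)
    refine ⟨max K K', fun k hk p => ?_⟩
    push_cast
    rw [jP_succ _ _ _ (h.m_trunc p), hK _ (by omega), hK' _ (by omega), sub_zero]

theorem tOp_jN (l : ℤ) (m k : ℕ) (p : A) (x : ℂ) :
    tOp^[m] (fun (k : ℕ) p x => jN l k p fun k' p' => MM k' p' x) k p x
      = jN l k p fun k' p' => jP m k' x fun k'' y => MM k'' p' y := by
  induction m generalizing k p x with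
  | zero => simp [jP_zero]
  | succ m ih =>
    obtain ⟨K, hK⟩ := h.m_jP_high m x
    obtain ⟨K', hK'⟩ := h.m_jP_high m (x + 1)
    rw [Function.iterate_succ_apply', tOp, ih, ih]
    push_cast
    simp only [fun k' p' => jP_succ m k' x (h.m_trunc p')]
    rw [jN_sub]
    · congr 1
      exact bsum_congr _ fun i => by rw [add_right_comm]
    · exact truncN_of_high (K := K) fun k hk p => hK _ (by omega) p
    · exact truncN_of_high (K := K') fun k hk p => hK' _ (by omega) p

/-- In the product the two families differ, by `jac1`, by expansions of (x - z₁)^l applied to the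
middle insertion. Multiplication by a high power (x - z₂)^m together with a high power x^k kills
that insertion, by `jac2`. The equality is then carried to the iterate. The bound M does not depend
on l. -/
theorem tOp_pFam : ∃ M : ℕ, ∀ l : ℤ, ∀ m ≥ M, ∀ k ≥ M,
    tOp^[m] (fun (k : ℕ) => pFam PP l k) k = tOp^[m] (rFam R1 l) k := by
  obtain ⟨K2, hK2⟩ := h.r2_high
  obtain ⟨KN, hKN⟩ := h.n_high
  refine ⟨max K2.toNat KN.toNat, fun l m hm k hk => ?_⟩
  have h1 := h.subst.tOp_mem (fun k : ℕ => h.pFam_mem l k) m k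
  have h2 := h.subst.tOp_mem (fun k : ℕ => h.rFam_mem l k) m k
  refine h.subst.eq_of_mem h1 (c := _) ?_
  convert h2 using 2
  rw [← sub_eq_zero, ← Pi.sub_apply, ← tOp_iterate_sub]
  have h3 : ((fun (k : ℕ) p x => jP l k p fun k' p' => PPc k' p' x)
      - fun (k : ℕ) p x => jR l k p fun k' p' => R1c k' p' x)
      = fun (k : ℕ) p x => jN l k p fun k' p' => MM k' p' x := by
    ext k p x
    simp only [Pi.sub_apply]
    rw [← h.jac1]
    ring
  rw [h3]
  ext p x
  rw [h.tOp_jN]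
  refine jN_eq_zero _ _ _ fun i y => ?_
  have := h.jac2 y m (k + i) x
  rw [jN_eq_zero, jR_eq_zero, sub_zero] at this
  · exact this
  · intro i y'
    rw [(hK2 _ (by omega)).1]; rfl
  · intro i' y'
    rw [(hKN _ (by omega)).1]; rfl

/-- The associativity formula: the Jacobi identity for the insertion of a vertex operator in the
inner operator of the iterate. -/
theorem inner_jacobi (l m : ℤ) (n : A) (α : ℂ) :
    jP l m n (fun k y => R2 k y α + jR 0 k y fun k' y' => R1 k' y' α)
      - jN l m n (fun k y => R2 k y α) = jR l m n fun k y => R1 k y α := by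
  obtain ⟨K1, hK1⟩ := h.r1_high
  obtain ⟨K2, hK2⟩ := h.r2_high
  obtain ⟨KN, hKN⟩ := h.n_high
  obtain ⟨M, hM⟩ := h.tOp_pFam
  set a : ℤ → A → ℂ → ℂ := fun k y α => R2 k y α + jR 0 k y fun k' y' => R1 k' y' α with ha
  have a_trunc : ∀ n, ∀ᶠ i : ℕ in atTop, ∀ k α, a k (n + (i : A)) α = 0 := by
    intro n
    filter_upwards [h.pn_trunc n] with i hi k α
    have := h.outer_jacobi k 0 (n + i) α
    rw [jR_zero] at this
    simp only [ha]
    rw [← this, jP_eq_zero _ _ _ fun j => (hi _ _).1, jN_eq_zero _ _ _ fun j y => (hi _ _).2,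
      sub_zero]
  have tP : ∀ α, TruncP fun k y => a k y α := by
    intro α k n
    filter_upwards [a_trunc n] with i hi
    exact hi _ _
  have tN : ∀ y, TruncN fun k α => a k y α := by
    intro y k α
    have t2 : TruncN fun k α => R2 k y α :=
      truncN_of_high fun k hk x => by rw [(hK2 k hk).2]; rfl
    exact (t2 k α).add (h.truncN_jR 0 y k α)
  have t1 := h.truncN_r1
  have t2 : ∀ α, TruncN fun k y => R2 k y α := fun α =>
    truncN_of_high fun k hk x => by rw [(hK2 k hk).2]; rfl
  set Γ : ℤ → ℤ → A → ℂ → ℂ := fun l m n α => jP l m n (fun k y => a k y α)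
      - jN l m n (fun k y => R2 k y α) - jR l m n (fun k y => R1 k y α) with hΓ
  have hrec : ∀ l m n α, Γ (l + 1) m n α = Γ l (m + 1) n α - Γ l m (n + 1) α := by
    intro l m n α
    simp only [hΓ]
    rw [jP_succ _ _ _ (tP α), jN_succ _ _ _ (t2 α), jR_succ _ _ _ (t1 α)]
    ring
  have base : Γ 0 = 0 := by
    ext m n α
    simp [hΓ, jP_zero, jN_zero, ha]
  -- At l = 0 the identity is the definition of `a`; the recursion takes it to all l ≥ 0. It does
  -- not go downwards by itself.
  have up : ∀ j : ℕ, Γ j = 0 := by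
    intro j
    induction j with
    | zero => exact base
    | succ j ih =>
      ext m n α
      push_cast
      rw [hrec, ih]
      simp
  -- The operator y + z₂ is x. Applying it k times turns each coefficient of `a` into a `jR` sum,
  -- which is the right side of `outer_jacobi`.
  have om_a : ∀ (l : ℤ) (k m : ℕ) n α,
      omOp^[k] (fun (m : ℕ) n α => jP l m n fun k' y => a k' y α) m n α
        = jP l m n fun M y => jR M k α fun k' y' => a k' y y' := by
    intro l k
    induction k with
    | zero => intro m n α; simp [jR_zero]
    | succ k ih =>
      intro m n α
      rw [Function.iterate_succ_apply', omOp, ih, ih]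
      have e : ∀ M y, jR M ((k + 1 : ℕ) : ℤ) α (fun k' y' => a k' y y')
          = jR (M + 1) k α (fun k' y' => a k' y y')
            + jR M k (α + 1) (fun k' y' => a k' y y') := fun M y => by
        rw [jR_succ _ _ _ (tN y)]
        push_cast
        ring
      have t : ∀ (s : ℤ) α, TruncP fun M y => jR (M + s) k α fun k' y' => a k' y y' := by
        intro s α M n
        filter_upwards [a_trunc n] with i hi
        exact jR_eq_zero _ _ _ fun _ _ => hi _ _
      simp only [e]
      rw [jP_add _ _ _ (t 1 α) (by simpa using t 0 (α + 1))]
      congr 1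
      refine bsum_congr _ fun i => ?_
      dsimp only
      rw [show l + (m : ℤ) - (i : ℤ) + 1 = l + ((m + 1 : ℕ) : ℤ) - i by push_cast; ring]
  have down : ∀ j : ℕ, Γ (-j) = 0 := by
    intro j
    induction j with
    | zero => simpa using base
    | succ j ih =>
      -- Vanishing at l + 1 says that (y - z₀)Γ l = 0, so that y acts on Γ l as z₀.
      have hs : ∀ m n α, Γ (-(j + 1 : ℕ)) (m + 1) n α = Γ (-(j + 1 : ℕ)) m (n + 1) α := by
        intro m n α
        have := hrec (-(j + 1 : ℕ)) m n α
        rw [show -((j + 1 : ℕ) : ℤ) + 1 = -j by push_cast; ring, ih] at this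
        exact (sub_eq_zero.1 this.symm)
      set l : ℤ := -(j + 1 : ℕ) with hl
      -- Γ l without its `jN` term, which is zero from m = K2 on.
      set G : ℕ → A → ℂ → ℂ := (fun (m : ℕ) n α => jP l m n fun k' y => a k' y α)
        - fun (m : ℕ) n α => jR l m n fun k' n' => R1 k' n' α with hG
      have hGΓ : ∀ m : ℕ, K2.toNat ≤ m → G m = Γ l m := by
        intro m hm
        ext n α
        simp only [hG, hΓ, Pi.sub_apply]
        rw [jN_eq_zero, sub_zero]
        intro i y
        rw [(hK2 _ (by omega)).2]; rfl
      have hGs : ∀ m ≥ K2.toNat, ∀ n α, G (m + 1) n α = G m (n + 1) α := by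
        intro m hm n α
        rw [hGΓ m hm, hGΓ (m + 1) (by omega)]
        push_cast
        exact hs m n α
      -- The exponent of y + z₂ is at least KN, so that in `outer_jacobi` the right insertion
      -- disappears, and at least M, so that `tOp_pFam` identifies the two resulting families.
      have hom : ∀ m : ℕ, M ≤ m → omOp^[max M KN.toNat] G m = 0 := by
        intro m hm
        ext n α
        rw [hG, omOp_iterate_sub]
        simp only [Pi.sub_apply]
        rw [omOp_jR t1, om_a, ← hM l m hm _ (le_max_left _ _)]
        have e : ∀ M' y, jR M' ((max M KN.toNat : ℕ) : ℤ) α (fun k' y' => a k' y y')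
            = jP M' ((max M KN.toNat : ℕ) : ℤ) α fun k' y' => PP k' y y' := by
          intro M' y
          rw [ha, ← h.outer_jacobi, jN_eq_zero, sub_zero]
          intro i y'
          rw [(hKN _ (by omega)).2]; rfl
        simp only [e]
        rw [hl, h.jP_jP (j + 1), ← jP_eq_tOp]
        · simp
        · intro n
          obtain ⟨Kp, hKp⟩ := h.pFam_low (-((j + 1 : ℕ) : ℤ))
          exact truncP_of_low fun k hk x => by rw [hKp k hk]; rfl
      have hGt : ∀ m, TruncZ (G m) := by
        intro m n
        obtain ⟨K', hK'⟩ := high_trunc_diag (fun k hk => (hK1 k hk).2) h.r1_trunc l n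
        filter_upwards [a_trunc n, a_trunc n |>.and (eventually_ge_atTop K'.toNat),
          eventually_forall_ge_atTop.2 (a_trunc n)] with i h1 h2 h3 α
        simp only [hG, Pi.sub_apply]
        rw [jP_eq_zero, zero_sub, neg_eq_zero]
        · refine bsum_eq_zero _ fun j => ?_
          have := hK' (m + i) (by omega) j α
          rw [← this]
          push_cast
          congr 1
          ring
        · intro i'
          have := h3 (i + i') (by omega)
          push_cast at this
          rw [add_assoc, this]
      have hG0 : ∀ m : ℕ, max M K2.toNat ≤ m → G m = 0 := by
        intro m hm
        refine (hGt m).eq_zero_of_mulZ_iterate (q := max M KN.toNat) ?_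
        rw [← omOp_iterate_of_shift hGs _ (by omega)]
        exact hom m (by omega)
      -- Since y acts as z₀, any m can be raised into the range where Γ l is already known to
      -- vanish, at the cost of lowering n.
      have hall : ∀ (i : ℕ) m n α, Γ l m n α = Γ l (m + i) (n - (i : A)) α := by
        intro i
        induction i with
        | zero => simp
        | succ i ihi =>
          intro m n α
          rw [ihi]
          push_cast
          rw [← add_assoc, hs]
          congr 1
          ring
      ext m n α
      rw [hall (max M K2.toNat + (-m).toNat),
        show m + ((max M K2.toNat + (-m).toNat : ℕ) : ℤ)
          = ((max M K2.toNat + m.toNat : ℕ) : ℤ) by omega, ← hGΓ _ (by omega), hG0 _ (by omega)]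
      rfl
  have : Γ l m n α = 0 := by
    obtain ⟨j, rfl | rfl⟩ := Int.eq_nat_or_neg l
    · rw [up]; rfl
    · rw [down]; rfl
  simp only [hΓ] at this
  linear_combination this

end AssocData

end Associativity

/-! ### Single-valuedness of E₁₂ -/

section Uniqueness

open Complex Metric
open scoped Real

/-- Dedekind's independence of characters, after grouping the indices that carry the same character.
-/
theorem sum_fiber_eq_zero {G ι : Type*} [Monoid G] [Fintype ι] [DecidableEq (G →* ℂ)]
    (χ : ι → G →* ℂ) (v : ι → ℂ) (h : ∀ g, ∑ i, v i * χ i g = 0) (ξ : G →* ℂ) :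
    ∑ i with χ i = ξ, v i = 0 := by
  have hli := linearIndependent_iff'.1 (linearIndependent_monoidHom G ℂ)
    (insert ξ (Finset.univ.image χ)) (fun ξ => ∑ i with χ i = ξ, v i) ?_ ξ (by simp)
  · exact hli
  · ext g
    rw [Finset.sum_apply, Pi.zero_apply, ← h g,
      ← Finset.sum_fiberwise_of_maps_to (t := insert ξ (Finset.univ.image χ)) (g := χ) (by simp)]
    refine Finset.sum_congr rfl fun η _ => ?_
    simp only [Pi.smul_apply, smul_eq_mul, Finset.sum_mul]
    refine Finset.sum_congr rfl fun i hi => ?_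
    rw [(Finset.mem_filter.1 hi).2]

/-- The character `(y, k) ↦ exp(ρ y + 2πi σ k)`. -/
def expChar (ρ σ : ℂ) : Multiplicative (ℝ × ℕ) →* ℂ where
  toFun g := exp (ρ * (g.toAdd.1 : ℂ) + σ * (2 * π * I * (g.toAdd.2 : ℂ)))
  map_one' := by simp
  map_mul' g h := by
    rw [← exp_add]
    congr 1
    simp only [toAdd_mul, Prod.fst_add, Prod.snd_add]
    push_cast
    ring

theorem eq_of_exp_mul_eq {a b : ℂ} (h : ∀ y : ℝ, exp (a * y) = exp (b * y)) : a = b := by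
  have h1 : ∀ c : ℂ, HasDerivAt (fun y : ℝ => exp (c * y)) c 0 := by
    intro c
    have : HasDerivAt (fun y : ℝ => exp (c * (y : ℂ))) (exp (c * ((0 : ℝ) : ℂ)) * (c * 1)) 0 :=
      ((hasDerivAt_id (0 : ℝ)).ofReal_comp.const_mul c).cexp
    simpa using this
  have h2 := h1 a
  rw [funext h] at h2
  exact h2.unique (h1 b)

theorem expChar_eq_iff (ρ σ ρ' σ' : ℂ) :
    expChar ρ σ = expChar ρ' σ' ↔ ρ = ρ' ∧ ∃ e : ℤ, σ' = σ + e := by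
  constructor
  · intro h
    have h' : ∀ (y : ℝ) (k : ℕ), exp (ρ * (y : ℂ) + σ * (2 * π * I * (k : ℂ)))
        = exp (ρ' * (y : ℂ) + σ' * (2 * π * I * (k : ℂ))) := fun y k =>
      DFunLike.congr_fun h (Multiplicative.ofAdd (y, k))
    refine ⟨eq_of_exp_mul_eq fun y => by simpa using h' y 0, ?_⟩
    have := h' 0 1
    obtain ⟨n, hn⟩ := exp_eq_exp_iff_exists_int.1 this
    refine ⟨-n, ?_⟩
    have h2 : (2 * π * I : ℂ) ≠ 0 := two_pi_I_ne_zero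
    refine mul_right_cancel₀ h2 ?_
    push_cast at hn ⊢
    linear_combination -hn
  · rintro ⟨rfl, e, rfl⟩
    refine DFunLike.ext _ _ fun g => ?_
    refine exp_eq_exp_iff_exists_int.2 ⟨-(e * (g.toAdd.2 : ℤ)), ?_⟩
    push_cast
    ring

theorem circleIntegral_zpow_mul {f : ℂ → ℂ} (hf : AnalyticOnNhd ℂ f (ball 0 1)) (e : ℤ) :
    ∮ w in C(0, 1 / 2), w ^ (-1 - e) * f w
      = 2 * π * I * if 0 ≤ e then iteratedDeriv e.toNat f 0 / (e.toNat.factorial : ℂ) else 0 := by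
  have hsub : closedBall (0 : ℂ) (1 / 2) ⊆ ball 0 1 := closedBall_subset_ball (by norm_num)
  have hd : DifferentiableOn ℂ f (closedBall 0 (1 / 2)) := (hf.differentiableOn).mono hsub
  have hc : DiffContOnCl ℂ f (ball 0 (1 / 2)) := hd.diffContOnCl_ball subset_rfl
  split_ifs with he
  · have := hc.circleIntegral_one_div_sub_center_pow_smul (by norm_num) e.toNat
    simp only [sub_zero, smul_eq_mul] at this
    have e1 : ∀ w : ℂ, w ^ (-1 - e) = 1 / w ^ (e.toNat + 1) := by
      intro w
      rw [one_div, ← zpow_natCast, ← zpow_neg]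
      congr 1
      push_cast
      rw [Int.toNat_of_nonneg he]
      ring
    simp only [e1]
    rw [this]
    ring
  · obtain ⟨j, hj⟩ := Int.eq_ofNat_of_zero_le (a := -1 - e) (by omega)
    simp only [hj, zpow_natCast, mul_zero]
    refine circleIntegral_eq_zero_of_differentiable_on_off_countable (by norm_num)
      Set.countable_empty ?_ ?_
    · exact (continuousOn_id.pow j).mul hd.continuousOn
    · intro z hz
      exact (differentiableAt_id.pow j).mul
        ((hf z (hsub (ball_subset_closedBall hz.1))).differentiableAt)

/-- The residue at 0 of the vanishing function divided by w, computed term by term with Cauchy's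
formula. -/
theorem sum_taylor_eq_zero {ι : Type*} (S : Finset ι) (e : ι → ℤ) (f : ι → ℂ → ℂ)
    (hf : ∀ i, AnalyticOnNhd ℂ (f i) (ball 0 1))
    (h : ∀ w : ℂ, w ≠ 0 → ‖w‖ < 1 → ∑ i ∈ S, w ^ (-e i) * f i w = 0) :
    ∑ i ∈ S, (if 0 ≤ e i then
      iteratedDeriv (e i).toNat (f i) 0 / ((e i).toNat.factorial : ℂ) else 0) = 0 := by
  refine mul_left_cancel₀ two_pi_I_ne_zero ?_
  rw [Finset.mul_sum, mul_zero, ← Finset.sum_congr rfl fun i _ => circleIntegral_zpow_mul (hf i) (e i),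
    ← circleIntegral.integral_fun_sum]
  · have : (∮ w in C(0, 1 / 2), ∑ i ∈ S, w ^ (-1 - e i) * f i w) = ∮ w in C(0, 1 / 2), (0 : ℂ) := by
      refine circleIntegral.integral_congr (by norm_num) fun w hw => ?_
      have hw' : ‖w‖ = 1 / 2 := by simpa using hw
      have hw0 : w ≠ 0 := by rintro rfl; norm_num at hw'
      have := h w hw0 (by rw [hw']; norm_num)
      simp only [zpow_sub₀ hw0, zpow_neg] at this ⊢
      simp only [div_eq_mul_inv, mul_assoc]
      rw [← Finset.mul_sum, this, mul_zero]
    rw [this]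
    simp [circleIntegral]
  · intro i _
    refine ContinuousOn.circleIntegrable (by norm_num) ?_
    have hsub : sphere (0 : ℂ) (1 / 2) ⊆ ball 0 1 :=
      sphere_subset_closedBall.trans (closedBall_subset_ball (by norm_num))
    refine ContinuousOn.mul (fun w hw => ?_) ((hf i).continuousOn.mono hsub)
    have hw0 : w ≠ 0 := by
      rintro rfl
      simp at hw
    exact (continuousAt_zpow₀ w _ (Or.inl hw0)).continuousWithinAt

theorem cpow_exp_ofReal (y : ℝ) (r : ℂ) : (exp (y : ℂ)) ^ r = exp (r * y) := by
  rw [cpow_def_of_ne_zero (exp_ne_zero _), log_exp, mul_comm]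
  · simpa using Real.pi_pos
  · simpa using Real.pi_pos.le

/-- Put z₂ = e^y and z₀ = e^{y+t}. Analytic continuation in t reaches all the sheets t + 2πik, and
independence of the characters (y, k) ↦ exp((r+s)y + 2πisk) separates the terms by r + s and by s
modulo ℤ. Within one class the powers of w = e^t differ by integers, and a residue picks out the
required sum of Taylor coefficients. -/
theorem ExtendsTo.expansionCoeff_eq_zero {k : ℕ} {r s : Fin k → ℂ} {f : Fin k → ℂ → ℂ}
    (h : ExtendsTo 0 r s f) (n m : ℂ) : expansionCoeff r s f n m = 0 := by
  classical
  have real_eq : ∀ y t : ℝ, t < 0 →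
      ∑ i, exp (r i * y) * exp (s i * ((y : ℂ) + t)) * f i (exp t) = 0 := by
    intro y t ht
    have hlt : Real.exp (y + t) < Real.exp y := Real.exp_lt_exp.2 (by linarith)
    have hp := Real.exp_pos (y + t)
    have hp2 := Real.exp_pos y
    have key := h.extends_eq ((Real.exp (y + t) : ℂ) + (Real.exp y : ℂ)) (Real.exp y : ℂ)
    rw [add_sub_cancel_right, ← ofReal_add] at key
    simp only [norm_real, ofReal_re, Real.norm_of_nonneg hp.le, Real.norm_of_nonneg hp2.le,
      Real.norm_of_nonneg (add_pos hp hp2).le] at key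
    have key := key hp hlt (by linarith) (by linarith) hp2 hp
    simp only [Pi.zero_apply, zero_mul, tsum_zero] at key
    rw [key]
    refine Finset.sum_congr rfl fun i _ => ?_
    rw [ofReal_exp, ofReal_exp, cpow_exp_ofReal, cpow_exp_ofReal, ← exp_sub]
    push_cast
    rw [add_sub_cancel_left]
  -- Identity theorem on the half-plane Re t < 0, where e^t lies in the unit disc; the zeros on the
  -- negative real axis accumulate at -1.
  have cplx_eq : ∀ (y : ℝ) (t : ℂ), t.re < 0 →
      ∑ i, exp (r i * y) * exp (s i * ((y : ℂ) + t)) * f i (exp t) = 0 := by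
    intro y
    have hU : IsPreconnected {t : ℂ | t.re < 0} := (convex_halfSpace_re_lt 0).isPreconnected
    have han : AnalyticOnNhd ℂ
        (fun t : ℂ => ∑ i, exp (r i * y) * exp (s i * ((y : ℂ) + t)) * f i (exp t))
        {t : ℂ | t.re < 0} := by
      intro t ht
      have : exp t ∈ ball (0 : ℂ) 1 := by
        simpa [norm_exp] using ht
      refine Finset.analyticAt_fun_sum _ fun i _ => ?_
      exact (by fun_prop : AnalyticAt ℂ (fun t => exp (r i * y) * exp (s i * ((y : ℂ) + t))) t).mul
        ((h.analytic i _ this).comp (f := exp) (by fun_prop))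
    have hfr : ∃ᶠ t in nhdsWithin ((-1 : ℝ) : ℂ) {((-1 : ℝ) : ℂ)}ᶜ,
        ∑ i, exp (r i * y) * exp (s i * ((y : ℂ) + t)) * f i (exp t) = 0 := by
      have ht : Tendsto (fun x : ℝ => (x : ℂ)) (nhdsWithin (-1) {-1}ᶜ)
          (nhdsWithin ((-1 : ℝ) : ℂ) {((-1 : ℝ) : ℂ)}ᶜ) := by
        refine tendsto_nhdsWithin_of_tendsto_nhds_of_eventually_within _
          (continuous_ofReal.continuousAt.tendsto.mono_left nhdsWithin_le_nhds) ?_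
        filter_upwards [self_mem_nhdsWithin] with x hx
        exact fun hh => hx (ofReal_injective hh)
      refine ht.frequently (Eventually.frequently ?_)
      filter_upwards [nhdsWithin_le_nhds (Iio_mem_nhds (by norm_num : (-1 : ℝ) < 0))] with x hx
      exact real_eq y x hx
    intro t ht
    exact han.eqOn_zero_of_preconnected_of_frequently_eq_zero hU (by simp) hfr ht
  have fiber_eq : ∀ t : ℂ, t.re < 0 →
      ∑ i with expChar (r i + s i) (s i) = expChar (-n - m - 2) (-n - 1),
        exp (s i * t) * f i (exp t) = 0 := by
    intro t ht
    refine sum_fiber_eq_zero (fun i => expChar (r i + s i) (s i)) _ (fun g => ?_) _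
    have := cplx_eq g.toAdd.1 (t + g.toAdd.2 * (2 * π * I)) (by simpa using ht)
    rw [← this]
    refine Finset.sum_congr rfl fun i _ => ?_
    rw [(exp_periodic.nat_mul g.toAdd.2) t, ← exp_add]
    change _ * exp _ = _
    rw [mul_right_comm, ← exp_add]
    congr 2
    ring
  have hfib : ∀ i, expChar (r i + s i) (s i) = expChar (-n - m - 2) (-n - 1) ↔
      r i + s i = -n - m - 2 ∧ ∃ e : ℤ, -n - 1 = s i + e := fun i => expChar_eq_iff _ _ _ _
  -- The integer e i is the order of the Taylor coefficient wanted from term i. Outside the class it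
  -- is set to 0, and such indices are never summed over.
  have hex : ∀ i, ∃ e : ℤ, r i + s i = -n - m - 2 ∧ (∃ e : ℤ, -n - 1 = s i + e) →
      -n - 1 = s i + e := by
    intro i
    by_cases hi : r i + s i = -n - m - 2 ∧ ∃ e : ℤ, -n - 1 = s i + e
    · obtain ⟨e, he⟩ := hi.2
      exact ⟨e, fun _ => he⟩
    · exact ⟨0, fun hh => absurd hh hi⟩
  choose e he using hex
  have hw := sum_taylor_eq_zero
    {i | expChar (r i + s i) (s i) = expChar (-n - m - 2) (-n - 1)} e f h.analytic ?_
  · rw [← hw, expansionCoeff, Finset.sum_filter]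
    refine Finset.sum_congr rfl fun i _ => ?_
    split_ifs with h1 h2
    · have h3 := he i ((hfib i).1 h1)
      have h4 := ((hfib i).1 h1).1
      have h5 : ((e i).toNat : ℂ) = e i := by
        have : (((e i).toNat : ℤ) : ℂ) = e i := by rw [Int.toNat_of_nonneg h2]
        rwa [Int.cast_natCast] at this
      rw [finsum_eq_single _ (e i).toNat, if_pos]
      · rw [h5]
        exact ⟨h3, by linear_combination -h4 - h3⟩
      · intro j hj
        rw [if_neg]
        rintro ⟨h6, -⟩
        apply hj
        have : ((j : ℤ) : ℂ) = e i := by push_cast; linear_combination h3 - h6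
        have := Int.cast_injective this
        omega
    · have h3 := he i ((hfib i).1 h1)
      rw [finsum_eq_zero_of_forall_eq_zero]
      intro j
      rw [if_neg]
      rintro ⟨h6, -⟩
      apply h2
      have : ((j : ℤ) : ℂ) = e i := by push_cast; linear_combination h3 - h6
      have := Int.cast_injective this
      omega
    · rw [finsum_eq_zero_of_forall_eq_zero]
      intro j
      rw [if_neg]
      rintro ⟨h6, h7⟩
      refine h1 ((hfib i).2 ⟨by linear_combination -h6 - h7, j, by simpa using h6⟩)
  · intro w hw0 hw1
    have ht : (log w).re < 0 := by
      rw [log_re]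
      exact Real.log_neg (norm_pos_iff.2 hw0) hw1
    have := fiber_eq _ ht
    rw [exp_log hw0] at this
    have h0 : exp ((-n - 1) * log w) ≠ 0 := exp_ne_zero _
    refine mul_left_cancel₀ h0 ?_
    rw [mul_zero, ← this, Finset.mul_sum]
    refine Finset.sum_congr rfl fun i hi => ?_
    have hi' := he i ((hfib i).1 (Finset.mem_filter.1 hi).2)
    have hz : w ^ (-e i) = exp (-(e i : ℂ) * log w) := by
      conv_lhs => rw [← exp_log hw0]
      rw [← exp_int_mul]
      push_cast
      rfl
    rw [hz, ← mul_assoc, ← exp_add]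
    congr 2
    rw [hi']
    ring

end Uniqueness

/-! ### Operations on series for which E₁₂ is defined -/

section Extension

open Complex Metric
open scoped Real

/-- The coefficient of `z₀^{-n-1} z₂^{-m-1}` in `z₂ʳ z₀ˢ f(z₀/z₂)`. -/
def termCoeff (r s : ℂ) (f : ℂ → ℂ) (n m : ℂ) : ℂ :=
  open Classical in
  ∑ᶠ j : ℕ, if -n - 1 = s + j ∧ -m - 1 = r - j then iteratedDeriv j f 0 / (j.factorial : ℂ) else 0

theorem expansionCoeff_eq_sum {k : ℕ} (r s : Fin k → ℂ) (f : Fin k → ℂ → ℂ) (n m : ℂ) :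
    expansionCoeff r s f n m = ∑ i, termCoeff (r i) (s i) (f i) n m := rfl

theorem termCoeff_of {r s : ℂ} {f : ℂ → ℂ} {n m : ℂ} {j : ℕ} (h1 : -n - 1 = s + j)
    (h2 : -m - 1 = r - j) : termCoeff r s f n m = iteratedDeriv j f 0 / (j.factorial : ℂ) := by
  rw [termCoeff, finsum_eq_single _ j, if_pos ⟨h1, h2⟩]
  intro i hi
  rw [if_neg]
  rintro ⟨h3, -⟩
  apply hi
  have : (i : ℂ) = j := by linear_combination h1 - h3
  exact_mod_cast this

theorem termCoeff_eq_zero {r s : ℂ} {f : ℂ → ℂ} {n m : ℂ}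
    (h : ∀ j : ℕ, -n - 1 = s + j → -m - 1 ≠ r - j) : termCoeff r s f n m = 0 := by
  rw [termCoeff]
  refine finsum_eq_zero_of_forall_eq_zero fun j => ?_
  rw [if_neg]
  rintro ⟨h1, h2⟩
  exact h j h1 h2

theorem termCoeff_shift (r s : ℂ) (f : ℂ → ℂ) (n m a b : ℂ) :
    termCoeff (r + a) (s + b) f n m = termCoeff r s f (n + b) (m + a) := by
  simp only [termCoeff]
  refine finsum_congr fun j => ?_
  congr 1
  refine propext ⟨fun h => ⟨?_, ?_⟩, fun h => ⟨?_, ?_⟩⟩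
  · linear_combination h.1
  · linear_combination h.2
  · linear_combination h.1
  · linear_combination h.2

theorem termCoeff_const_mul (r s a : ℂ) (f : ℂ → ℂ) (n m : ℂ) :
    termCoeff r s (fun t => a * f t) n m = a * termCoeff r s f n m := by
  by_cases h : ∃ j : ℕ, -n - 1 = s + j ∧ -m - 1 = r - j
  · obtain ⟨j, h1, h2⟩ := h
    rw [termCoeff_of h1 h2, termCoeff_of h1 h2, iteratedDeriv_const_mul_field, mul_div_assoc]
  · push Not at h
    rw [termCoeff_eq_zero h, termCoeff_eq_zero h, mul_zero]

/-- The product rule for ∂/∂z₀ of z₂^r z₀^s f(z₀/z₂) gives two terms of the same shape. -/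
theorem termCoeff_deriv (r s : ℂ) (f : ℂ → ℂ) (n m : ℂ) :
    termCoeff r (s - 1) (fun t => s * f t) n m + termCoeff (r - 1) s (deriv f) n m
      = -n * termCoeff r s f (n - 1) m := by
  rw [termCoeff_const_mul]
  have e : termCoeff r (s - 1) f n m = termCoeff r s f (n - 1) m := by
    have := termCoeff_shift r s f n m 0 (-1)
    simpa [sub_eq_add_neg] using this
  rw [e]
  by_cases h : ∃ j : ℕ, -(n - 1) - 1 = s + j ∧ -m - 1 = r - j
  · obtain ⟨j, h1, h2⟩ := h
    rw [termCoeff_of h1 h2]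
    cases j with
    | zero =>
      rw [termCoeff_eq_zero]
      · have : s = -n := by
          rw [Nat.cast_zero] at h1
          linear_combination -h1
        rw [this]; ring
      · intro j h3 _
        have : (j : ℂ) + 1 = 0 := by
          rw [Nat.cast_zero] at h1
          linear_combination h1 - h3
        exact Nat.cast_add_one_ne_zero j this
    | succ j =>
      push_cast at h1 h2
      rw [termCoeff_of (j := j) (by linear_combination h1) (by linear_combination h2),
        ← iteratedDeriv_succ', Nat.factorial_succ]
      have h3 : ((j : ℂ) + 1) ≠ 0 := Nat.cast_add_one_ne_zero j
      have h4 : (j.factorial : ℂ) ≠ 0 := Nat.cast_ne_zero.2 j.factorial_ne_zero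
      have h5 : s = -n - (j + 1) := by linear_combination -h1
      rw [h5]
      push_cast
      field_simp
      ring
  · push Not at h
    rw [termCoeff_eq_zero h, termCoeff_eq_zero]
    · ring
    · intro j h1 h2
      refine h (j + 1) ?_ ?_
      · push_cast; linear_combination h1
      · push_cast; linear_combination h2

theorem expansionCoeff_append {k k' : ℕ} (r s : Fin k → ℂ) (f : Fin k → ℂ → ℂ)
    (r' s' : Fin k' → ℂ) (f' : Fin k' → ℂ → ℂ) (n m : ℂ) :
    expansionCoeff (Fin.append r r') (Fin.append s s') (Fin.append f f') n m
      = expansionCoeff r s f n m + expansionCoeff r' s' f' n m := by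
  simp only [expansionCoeff_eq_sum, Fin.sum_univ_add, Fin.append_left, Fin.append_right]

theorem analyticOnNhd_append {k k' : ℕ} {f : Fin k → ℂ → ℂ} {f' : Fin k' → ℂ → ℂ}
    (h : ∀ i, AnalyticOnNhd ℂ (f i) (ball 0 1)) (h' : ∀ i, AnalyticOnNhd ℂ (f' i) (ball 0 1))
    (i : Fin (k + k')) : AnalyticOnNhd ℂ (Fin.append f f' i) (ball 0 1) := by
  refine Fin.addCases (fun i => ?_) (fun i => ?_) i
  · rw [Fin.append_left]; exact h i
  · rw [Fin.append_right]; exact h' i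

theorem HasE12.zero : HasE12 0 0 := by
  refine ⟨0, Fin.elim0, Fin.elim0, fun i => i.elim0, ⟨fun i => i.elim0, ?_, ?_⟩, ?_⟩
  · intro z₁ z₂ _ _
    simp
  · intros
    simp
  · intro n m
    simp [expansionCoeff]

theorem HasE12.add {c d c' d' : ℂ → ℂ → ℂ} (h : HasE12 c d) (h' : HasE12 c' d') :
    HasE12 (c + c') (d + d') := by
  obtain ⟨k, r, s, f, hx, hd⟩ := h
  obtain ⟨k', r', s', f', hx', hd'⟩ := h'
  refine ⟨k + k', Fin.append r r', Fin.append s s', Fin.append f f',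
    ⟨analyticOnNhd_append hx.analytic hx'.analytic, fun z₁ z₂ h1 h2 => ?_,
      fun z₁ z₂ h1 h2 h3 h4 h5 h6 => ?_⟩, fun n m => ?_⟩
  · simpa only [Pi.add_apply, add_mul] using (hx.converges z₁ z₂ h1 h2).add (hx'.converges z₁ z₂ h1 h2)
  · have h0 := h1.trans h2
    simp only [Fin.sum_univ_add, Fin.append_left, Fin.append_right, Pi.add_apply, add_mul]
    rw [← hx.extends_eq z₁ z₂ h1 h2 h3 h4 h5 h6, ← hx'.extends_eq z₁ z₂ h1 h2 h3 h4 h5 h6]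
    exact (hx.converges z₁ z₂ h0 h3).tsum_add (hx'.converges z₁ z₂ h0 h3)
  · rw [expansionCoeff_append, ← hd, ← hd']; rfl

theorem ExtendsTo.const_mul {c : ℂ → ℂ → ℂ} {k : ℕ} {r s : Fin k → ℂ} {f : Fin k → ℂ → ℂ}
    (h : ExtendsTo c r s f) (a : ℂ) : ExtendsTo (a • c) r s (fun i t => a * f i t) := by
  refine ⟨fun i => analyticOnNhd_const.mul (h.analytic i), fun z₁ z₂ h1 h2 => ?_,
    fun z₁ z₂ h1 h2 h3 h4 h5 h6 => ?_⟩
  · simpa only [Pi.smul_apply, smul_eq_mul, mul_assoc] using (h.converges z₁ z₂ h1 h2).mul_left a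
  · simp only [Pi.smul_apply, smul_eq_mul, mul_assoc]
    rw [tsum_mul_left]
    simp only [← mul_assoc]
    rw [h.extends_eq z₁ z₂ h1 h2 h3 h4 h5 h6, Finset.mul_sum]
    exact Finset.sum_congr rfl fun i _ => by ring

theorem HasE12.smul {c d : ℂ → ℂ → ℂ} (a : ℂ) (h : HasE12 c d) : HasE12 (a • c) (a • d) := by
  obtain ⟨k, r, s, f, hx, hd⟩ := h
  refine ⟨k, r, s, _, hx.const_mul a, fun n m => ?_⟩
  simp only [expansionCoeff_eq_sum, termCoeff_const_mul, ← Finset.mul_sum]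
  rw [← expansionCoeff_eq_sum, ← hd]; rfl

/-- The relation `HasE12` as a space of pairs of series. -/
def e12Space : Submodule ℂ ((ℂ → ℂ → ℂ) × (ℂ → ℂ → ℂ)) where
  carrier := {x | HasE12 x.1 x.2}
  add_mem' := HasE12.add
  zero_mem' := HasE12.zero
  smul_mem' a _ := HasE12.smul a

theorem mem_e12Space {c d : ℂ → ℂ → ℂ} : (c, d) ∈ e12Space ↔ HasE12 c d := Iff.rfl

theorem summand_shift (c : ℂ → ℂ → ℂ) (a b : ℂ) {z₁ z₂ : ℂ} (h1 : z₁ ≠ 0) (h2 : z₂ ≠ 0) :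
    (fun p : ℂ × ℂ => c (p.1 + a) (p.2 + b) * z₁ ^ (-p.1 - 1) * z₂ ^ (-p.2 - 1))
      = fun p => z₁ ^ a * z₂ ^ b * (fun p : ℂ × ℂ => c p.1 p.2 * z₁ ^ (-p.1 - 1) * z₂ ^ (-p.2 - 1))
        ((Equiv.addRight a).prodCongr (Equiv.addRight b) p) := by
  ext p
  simp only [Equiv.prodCongr_apply, Prod.map, Equiv.coe_addRight]
  have e1 : z₁ ^ (-p.1 - 1) = z₁ ^ a * z₁ ^ (-(p.1 + a) - 1) := by
    rw [← cpow_add _ _ h1]; congr 1; ring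
  have e2 : z₂ ^ (-p.2 - 1) = z₂ ^ b * z₂ ^ (-(p.2 + b) - 1) := by
    rw [← cpow_add _ _ h2]; congr 1; ring
  rw [e1, e2]
  ring

theorem ExtendsTo.summable_shift {c : ℂ → ℂ → ℂ} {k : ℕ} {r s : Fin k → ℂ} {f : Fin k → ℂ → ℂ}
    (h : ExtendsTo c r s f) (a b : ℂ) {z₁ z₂ : ℂ} (h1 : 0 < ‖z₂‖) (h2 : ‖z₂‖ < ‖z₁‖) :
    Summable fun p : ℂ × ℂ => c (p.1 + a) (p.2 + b) * z₁ ^ (-p.1 - 1) * z₂ ^ (-p.2 - 1) := by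
  rw [summand_shift c a b (norm_pos_iff.1 (h1.trans h2)) (norm_pos_iff.1 h1)]
  exact ((Equiv.summable_iff _).2 (h.converges z₁ z₂ h1 h2)).mul_left _

theorem ExtendsTo.tsum_shift {c : ℂ → ℂ → ℂ} {k : ℕ} {r s : Fin k → ℂ} {f : Fin k → ℂ → ℂ}
    (h : ExtendsTo c r s f) (a b : ℂ) {z₁ z₂ : ℂ} (h1 : 0 < ‖z₁ - z₂‖) (h2 : ‖z₁ - z₂‖ < ‖z₂‖)
    (h3 : ‖z₂‖ < ‖z₁‖) (h4 : 0 < z₁.re) (h5 : 0 < z₂.re) (h6 : 0 < (z₁ - z₂).re) :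
    ∑' p : ℂ × ℂ, c (p.1 + a) (p.2 + b) * z₁ ^ (-p.1 - 1) * z₂ ^ (-p.2 - 1)
      = z₁ ^ a * z₂ ^ b * ∑ i, z₂ ^ r i * (z₁ - z₂) ^ s i * f i ((z₁ - z₂) / z₂) := by
  have h0 := h1.trans h2
  rw [summand_shift c a b (norm_pos_iff.1 (h0.trans h3)) (norm_pos_iff.1 h0), tsum_mul_left,
    Equiv.tsum_eq _ fun p : ℂ × ℂ => c p.1 p.2 * z₁ ^ (-p.1 - 1) * z₂ ^ (-p.2 - 1),
    h.extends_eq z₁ z₂ h1 h2 h3 h4 h5 h6]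

theorem HasE12.shift {c d : ℂ → ℂ → ℂ} (h : HasE12 c d) (b : ℂ) :
    HasE12 (fun p x => c p (x + b)) (fun n x => d n (x + b)) := by
  obtain ⟨k, r, s, f, hx, hd⟩ := h
  refine ⟨k, fun i => r i + b, s, f, ⟨hx.analytic, fun z₁ z₂ h1 h2 => ?_,
    fun z₁ z₂ h1 h2 h3 h4 h5 h6 => ?_⟩, fun n m => ?_⟩
  · simpa using hx.summable_shift 0 b h1 h2
  · have := hx.tsum_shift 0 b h1 h2 h3 h4 h5 h6
    simp only [add_zero, cpow_zero, one_mul] at this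
    rw [this, Finset.mul_sum]
    refine Finset.sum_congr rfl fun i _ => ?_
    rw [cpow_add _ _ (norm_pos_iff.1 (h1.trans h2))]
    ring
  · dsimp only
    rw [hd]
    simp only [expansionCoeff_eq_sum]
    refine Finset.sum_congr rfl fun i _ => ?_
    simpa using (termCoeff_shift (r i) (s i) (f i) n m b 0).symm

/-- Since z₁ = (z₁ - z₂) + z₂, every term of the extension splits in two, one with sᵢ + 1 and one
with rᵢ + 1. -/
theorem HasE12.mul_fst {c d : ℂ → ℂ → ℂ} (h : HasE12 c d) :
    HasE12 (fun p x => c (p + 1) x) (fun n x => d (n + 1) x + d n (x + 1)) := by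
  obtain ⟨k, r, s, f, hx, hd⟩ := h
  refine ⟨k + k, Fin.append r (fun i => r i + 1), Fin.append (fun i => s i + 1) s, Fin.append f f,
    ⟨analyticOnNhd_append hx.analytic hx.analytic, fun z₁ z₂ h1 h2 => ?_,
    fun z₁ z₂ h1 h2 h3 h4 h5 h6 => ?_⟩, fun n m => ?_⟩
  · simpa using hx.summable_shift 1 0 h1 h2
  · have := hx.tsum_shift 1 0 h1 h2 h3 h4 h5 h6
    simp only [add_zero, cpow_zero, mul_one, cpow_one] at this
    rw [this, Finset.mul_sum]
    simp only [Fin.sum_univ_add, Fin.append_left, Fin.append_right]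
    rw [← Finset.sum_add_distrib]
    refine Finset.sum_congr rfl fun i _ => ?_
    rw [cpow_add _ _ (norm_pos_iff.1 (h1.trans h2)), cpow_add _ _ (norm_pos_iff.1 h1), cpow_one,
      cpow_one]
    ring
  · dsimp only
    rw [hd, hd, expansionCoeff_append]
    simp only [expansionCoeff_eq_sum]
    congr 1
    · refine Finset.sum_congr rfl fun i _ => ?_
      simpa using (termCoeff_shift (r i) (s i) (f i) n m 0 1).symm
    · refine Finset.sum_congr rfl fun i _ => ?_
      simpa using (termCoeff_shift (r i) (s i) (f i) n m 1 0).symm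

theorem isSubstitution_e12Space : IsSubstitution e12Space where
  mul_fst _ _ h := HasE12.mul_fst h
  shift _ _ i h := HasE12.shift h i
  unique d := by
    rintro ⟨k, r, s, f, hx, hd⟩
    ext n m
    exact (hd n m).trans (hx.expansionCoeff_eq_zero n m)

theorem HasE12.unique {c d d' : ℂ → ℂ → ℂ} (h : HasE12 c d) (h' : HasE12 c d') : d = d' :=
  isSubstitution_e12Space.eq_of_mem (E := e12Space) h h'

/-- Scaling z₁ and z₂ by e^y multiplies c by a scalar; by uniqueness it multiplies d by the same
scalar, for every real y. Positive scalings respect the principal branches. -/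
theorem HasE12.homogeneous {c d : ℂ → ℂ → ℂ} (h : HasE12 c d) {K : ℂ}
    (hc : ∀ m n, c m n ≠ 0 → m + n = K) (n m : ℂ) (hd0 : d n m ≠ 0) : n + m = K := by
  obtain ⟨k, r, s, f, hx, hd⟩ := h
  have key : ∀ y : ℝ, HasE12 (exp (-(K + 2) * y) • c)
      (fun n m => exp (-(n + m + 2) * y) * d n m) := by
    intro y
    have hlog : ∀ z : ℂ, z ≠ 0 → ∀ r : ℂ,
        ((Real.exp y : ℂ) * z) ^ r = exp (r * y) * z ^ r := by
      intro z hz r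
      have hne : (Real.exp y : ℂ) * z ≠ 0 :=
        mul_ne_zero (ofReal_ne_zero.2 (Real.exp_pos y).ne') hz
      rw [cpow_def_of_ne_zero hne, cpow_def_of_ne_zero hz, log_ofReal_mul (Real.exp_pos y) hz,
        Real.log_exp, ← exp_add]
      congr 1
      ring
    refine ⟨k, r, s, fun i t => exp ((r i + s i) * y) * f i t,
      ⟨fun i => analyticOnNhd_const.mul (hx.analytic i), (hx.const_mul _).converges,
        fun z₁ z₂ h1 h2 h3 h4 h5 h6 => ?_⟩, fun n m => ?_⟩
    · have hz0 : z₁ - z₂ ≠ 0 := norm_pos_iff.1 h1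
      have hz2 : z₂ ≠ 0 := norm_pos_iff.1 (h1.trans h2)
      have hz1 : z₁ ≠ 0 := norm_pos_iff.1 ((h1.trans h2).trans h3)
      have hp := Real.exp_pos y
      have hn : ∀ z : ℂ, ‖(Real.exp y : ℂ) * z‖ = Real.exp y * ‖z‖ := fun z => by
        rw [norm_mul, norm_real, Real.norm_of_nonneg hp.le]
      have hr : ∀ z : ℂ, ((Real.exp y : ℂ) * z).re = Real.exp y * z.re := fun z => re_ofReal_mul _ _
      have := hx.extends_eq ((Real.exp y : ℂ) * z₁) ((Real.exp y : ℂ) * z₂)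
      rw [← mul_sub, hn, hn, hn, hr, hr, hr] at this
      have := this (mul_pos hp h1) (mul_lt_mul_of_pos_left h2 hp) (mul_lt_mul_of_pos_left h3 hp)
        (mul_pos hp h4) (mul_pos hp h5) (mul_pos hp h6)
      rw [mul_div_mul_left _ _ (ofReal_ne_zero.2 hp.ne')] at this
      simp only [hlog _ hz0, hlog _ hz1, hlog _ hz2] at this
      convert this using 1
      · refine tsum_congr fun p => ?_
        simp only [Pi.smul_apply, smul_eq_mul]
        by_cases hcp : c p.1 p.2 = 0
        · rw [hcp]; ring
        · rw [← hc _ _ hcp]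
          have : exp (-(p.1 + p.2 + 2) * y) = exp ((-p.1 - 1) * y) * exp ((-p.2 - 1) * y) := by
            rw [← exp_add]; congr 1; ring
          rw [this]
          ring
      · refine Finset.sum_congr rfl fun i _ => ?_
        rw [add_mul, exp_add]
        ring
    · dsimp only
      rw [hd]
      simp only [expansionCoeff_eq_sum, termCoeff_const_mul, Finset.mul_sum]
      refine Finset.sum_congr rfl fun i _ => ?_
      by_cases hz : termCoeff (r i) (s i) (f i) n m = 0
      · rw [hz, mul_zero, mul_zero]
      · have : ∃ j : ℕ, -n - 1 = s i + j ∧ -m - 1 = r i - j := by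
          by_contra hh
          push Not at hh
          exact hz (termCoeff_eq_zero hh)
        obtain ⟨j, h1, h2⟩ := this
        congr 2
        linear_combination (h1 + h2) * y
  have h2 : ∀ y : ℝ, exp (-(n + m + 2) * y) = exp (-(K + 2) * y) := by
    intro y
    have := (key y).unique (HasE12.smul _ ⟨k, r, s, f, hx, hd⟩)
    exact mul_right_cancel₀ hd0 (congrFun (congrFun this n) m)
  have := eq_of_exp_mul_eq h2
  linear_combination -this

end Extension

/-! ### Differentiation in z₁ -/

section Derivative

open Complex Metric
open scoped Real

/-- On a square in the logarithmic coordinate a power is bounded by its values at the corners. -/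
theorem norm_cpow_le_corners {w z : ℂ} (hw : w ≠ 0) {δ : ℝ} (hδ : 0 < δ)
    (hz : |z.im| + δ < π) (h1 : |(log w).re - z.re| < δ) (h2 : |(log w).im - z.im| < δ) (c : ℂ) :
    ‖w ^ c‖ ≤ ∑ ε : Bool × Bool,
      ‖exp (z + (if ε.1 then δ else -δ : ℝ) + (if ε.2 then δ else -δ : ℝ) * I) ^ c‖ := by
  have hcorner : ∀ ε : Bool × Bool,
      ‖exp (z + (if ε.1 then δ else -δ : ℝ) + (if ε.2 then δ else -δ : ℝ) * I) ^ c‖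
        = Real.exp (c.re * (z.re + (if ε.1 then δ else -δ))
            - c.im * (z.im + (if ε.2 then δ else -δ))) := by
    intro ε
    have hz' := abs_le.1 (le_refl |z.im|)
    have hi : (z + (if ε.1 then δ else -δ : ℝ) + (if ε.2 then δ else -δ : ℝ) * I).im
        = z.im + (if ε.2 then δ else -δ) := by simp
    have hr : (z + (if ε.1 then δ else -δ : ℝ) + (if ε.2 then δ else -δ : ℝ) * I).re
        = z.re + (if ε.1 then δ else -δ) := by simp
    rw [cpow_def_of_ne_zero (exp_ne_zero _), log_exp, norm_exp, mul_re, hi, hr]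
    · ring_nf
    · rw [hi]; split_ifs <;> linarith
    · rw [hi]; split_ifs <;> linarith
  rw [cpow_def_of_ne_zero hw, norm_exp, mul_re]
  rw [abs_lt] at h1 h2
  have hle : ∃ ε : Bool × Bool, (log w).re * c.re - (log w).im * c.im
      ≤ c.re * (z.re + (if ε.1 then δ else -δ)) - c.im * (z.im + (if ε.2 then δ else -δ)) := by
    -- The logarithm of the absolute value of the power is linear in log w, so the signs of Re c and
    -- Im c decide which corner dominates.
    refine ⟨(decide (0 ≤ c.re), decide (c.im ≤ 0)), ?_⟩
    simp only [decide_eq_true_eq]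
    have ha : (log w).re * c.re ≤ c.re * (z.re + (if 0 ≤ c.re then δ else -δ)) := by
      split_ifs with h
      · nlinarith
      · nlinarith [not_le.1 h]
    have hb : c.im * (z.im + (if c.im ≤ 0 then δ else -δ)) ≤ (log w).im * c.im := by
      split_ifs with h
      · nlinarith
      · nlinarith [not_le.1 h]
    linarith
  obtain ⟨ε, hε⟩ := hle
  refine (Real.exp_le_exp.2 hε).trans ?_
  rw [← hcorner]
  exact Finset.single_le_sum (f := fun ε : Bool × Bool =>
    ‖exp (z + (if ε.1 then δ else -δ : ℝ) + (if ε.2 then δ else -δ : ℝ) * I) ^ c‖)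
    (fun _ _ => norm_nonneg _) (Finset.mem_univ ε)

/-- Near z₁ the terms are dominated by the sum of their absolute values at four fixed points of the
domain of convergence, so the series may be differentiated term by term. -/
theorem ExtendsTo.hasSum_deriv {c : ℂ → ℂ → ℂ} {k : ℕ} {r s : Fin k → ℂ} {f : Fin k → ℂ → ℂ}
    (h : ExtendsTo c r s f) {z₁ z₂ : ℂ} (h1 : 0 < ‖z₂‖) (h2 : ‖z₂‖ < ‖z₁‖) (h3 : 0 < z₁.re) :
    HasSum (fun p : ℂ × ℂ => c p.1 p.2 * ((-p.1 - 1) * z₁ ^ (-p.1 - 1 - 1)) * z₂ ^ (-p.2 - 1))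
      (deriv (fun z => ∑' p : ℂ × ℂ, c p.1 p.2 * z ^ (-p.1 - 1) * z₂ ^ (-p.2 - 1)) z₁) := by
  have hz1 : z₁ ≠ 0 := norm_pos_iff.1 (h1.trans h2)
  have harg : |(log z₁).im| < π / 2 := by
    rw [log_im]
    exact abs_arg_lt_pi_div_two_iff.2 (Or.inl h3)
  have hlog : 0 < Real.log ‖z₁‖ - Real.log ‖z₂‖ := sub_pos.2 (Real.log_lt_log h1 h2)
  -- The first bound keeps the corners on the principal branch, because |arg z₁| < π/2; the second
  -- keeps them in the region |z| > |z₂|.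
  obtain ⟨δ, hδ, hδ1, hδ2⟩ : ∃ δ : ℝ, 0 < δ ∧ δ < π / 2 ∧ δ < Real.log ‖z₁‖ - Real.log ‖z₂‖ := by
    obtain ⟨δ, h1, h2⟩ := exists_between (lt_min (by positivity : 0 < π / 2) hlog)
    exact ⟨δ, h1, lt_min_iff.1 h2⟩
  set x : Bool × Bool → ℂ := fun ε =>
    log z₁ + (if ε.1 then δ else -δ : ℝ) + (if ε.2 then δ else -δ : ℝ) * I with hx
  set U : Set ℂ := {w | 0 < w.re} ∩
    {w | |(log w).re - (log z₁).re| < δ} ∩ {w | |(log w).im - (log z₁).im| < δ} with hU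
  have hre : IsOpen {w : ℂ | 0 < w.re} := isOpen_lt continuous_const continuous_re
  have hlogc : ContinuousOn log {w : ℂ | 0 < w.re} := fun w hw =>
    (continuousAt_clog (Or.inl hw)).continuousWithinAt
  have hUo : IsOpen U := by
    have e : U = {w : ℂ | 0 < w.re} ∩ log ⁻¹' ({x | |x.re - (log z₁).re| < δ}
        ∩ {x | |x.im - (log z₁).im| < δ}) := by
      ext w
      simp only [hU, Set.mem_inter_iff, Set.mem_ofPred_eq, Set.mem_preimage, and_assoc]
    rw [e]
    refine hlogc.isOpen_inter_preimage hre (IsOpen.inter ?_ ?_)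
    · exact isOpen_lt (by fun_prop) continuous_const
    · exact isOpen_lt (by fun_prop) continuous_const
  have hne : ∀ w ∈ U, w ∈ slitPlane := fun w hw => Or.inl hw.1.1
  have hcorner : ∀ ε, ‖z₂‖ < ‖exp (x ε)‖ := by
    intro ε
    have hr : (x ε).re = Real.log ‖z₁‖ + (if ε.1 then δ else -δ) := by
      simp [hx, log_re]
    rw [norm_exp, hr, ← Real.log_lt_iff_lt_exp h1]
    split_ifs <;> linarith
  have hsum : Summable fun p : ℂ × ℂ => ∑ ε : Bool × Bool,
      ‖c p.1 p.2 * exp (x ε) ^ (-p.1 - 1) * z₂ ^ (-p.2 - 1)‖ :=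
    summable_sum fun ε _ => (h.converges _ z₂ h1 (hcorner ε)).norm
  have main := Complex.hasSum_deriv_of_summable_norm
    (F := fun (p : ℂ × ℂ) z => c p.1 p.2 * z ^ (-p.1 - 1) * z₂ ^ (-p.2 - 1)) hsum
    (fun p w hw => ?_) hUo (fun p w hw => ?_) (z := z₁) ?_
  · have e : ∀ p : ℂ × ℂ, _root_.deriv (fun z : ℂ => c p.1 p.2 * z ^ (-p.1 - 1) * z₂ ^ (-p.2 - 1)) z₁
        = c p.1 p.2 * ((-p.1 - 1) * z₁ ^ (-p.1 - 1 - 1)) * z₂ ^ (-p.2 - 1) := fun p => by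
      have := ((hasDerivAt_id z₁).cpow_const (c := -p.1 - 1) (Or.inl h3)).const_mul (c p.1 p.2)
      have := this.mul_const (z₂ ^ (-p.2 - 1))
      simp only [id, mul_one] at this
      exact this.deriv
    simpa only [e] using main
  · refine DifferentiableAt.differentiableWithinAt ?_
    have := ((hasDerivAt_id w).cpow_const (c := -p.1 - 1) (hne w hw)).const_mul (c p.1 p.2)
    exact (this.mul_const (z₂ ^ (-p.2 - 1))).differentiableAt
  · have hb := norm_cpow_le_corners (slitPlane_ne_zero (hne w hw)) hδ (z := log z₁)
      (by linarith) hw.1.2 hw.2 (-p.1 - 1)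
    simp only [norm_mul, ← Finset.sum_mul, ← Finset.mul_sum]
    gcongr
  · exact ⟨⟨h3, by simpa using hδ⟩, by simpa using hδ⟩

/-- Termwise differentiation identifies the sum only where Re z₁ > 0, while convergence is required
on the whole domain. It is therefore assumed here; in the application it is the convergence of the
product with L(-1)w₁ in place of w₁. -/
theorem HasE12.deriv {c d : ℂ → ℂ → ℂ} (h : HasE12 c d)
    (hc : ∀ z₁ z₂ : ℂ, 0 < ‖z₂‖ → ‖z₂‖ < ‖z₁‖ → Summable fun p : ℂ × ℂ =>
      -p.1 * c (p.1 - 1) p.2 * z₁ ^ (-p.1 - 1) * z₂ ^ (-p.2 - 1)) :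
    HasE12 (fun m n => -m * c (m - 1) n) (fun n m => -n * d (n - 1) m) := by
  obtain ⟨k, r, s, f, hx, hd⟩ := h
  refine ⟨k + k, Fin.append r (fun i => r i - 1), Fin.append (fun i => s i - 1) s,
    Fin.append (fun i t => s i * f i t) (fun i => _root_.deriv (f i)),
    ⟨analyticOnNhd_append (fun i => analyticOnNhd_const.mul (hx.analytic i))
      (fun i => (hx.analytic i).deriv), hc, fun z₁ z₂ h1 h2 h3 h4 h5 h6 => ?_⟩, fun n m => ?_⟩
  · have h0 := h1.trans h2
    have hz2 : z₂ ≠ 0 := norm_pos_iff.1 h0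
    have hs := (hx.hasSum_deriv h0 h3 h4).tsum_eq
    have e1 : ∑' p : ℂ × ℂ, -p.1 * c (p.1 - 1) p.2 * z₁ ^ (-p.1 - 1) * z₂ ^ (-p.2 - 1)
        = ∑' p : ℂ × ℂ, c p.1 p.2 * ((-p.1 - 1) * z₁ ^ (-p.1 - 1 - 1)) * z₂ ^ (-p.2 - 1) := by
      rw [← Equiv.tsum_eq ((Equiv.addRight (1 : ℂ)).prodCongr (Equiv.refl ℂ))]
      refine tsum_congr fun p => ?_
      simp only [Equiv.prodCongr_apply, Prod.map, Equiv.coe_addRight, Equiv.refl_apply,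
        add_sub_cancel_right]
      rw [show -(p.1 + 1) - 1 = -p.1 - 1 - 1 by ring]
      ring
    rw [e1, hs]
    have hev : (fun z => ∑' p : ℂ × ℂ, c p.1 p.2 * z ^ (-p.1 - 1) * z₂ ^ (-p.2 - 1)) =ᶠ[nhds z₁]
        fun z => ∑ i, z₂ ^ r i * (z - z₂) ^ s i * f i ((z - z₂) / z₂) := by
      have o1 : ∀ᶠ z in nhds z₁, 0 < ‖z - z₂‖ :=
        (isOpen_lt continuous_const (by fun_prop)).mem_nhds h1
      have o2 : ∀ᶠ z in nhds z₁, ‖z - z₂‖ < ‖z₂‖ :=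
        (isOpen_lt (by fun_prop) continuous_const).mem_nhds h2
      have o3 : ∀ᶠ z in nhds z₁, ‖z₂‖ < ‖z‖ :=
        (isOpen_lt continuous_const (by fun_prop)).mem_nhds h3
      have o4 : ∀ᶠ z in nhds z₁, 0 < z.re :=
        (isOpen_lt continuous_const (by fun_prop)).mem_nhds h4
      have o6 : ∀ᶠ z in nhds z₁, 0 < (z - z₂).re :=
        (isOpen_lt continuous_const (by fun_prop)).mem_nhds h6
      filter_upwards [o1, o2, o3, o4, o6] with z g1 g2 g3 g4 g6
      exact hx.extends_eq z z₂ g1 g2 g3 g4 h5 g6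
    rw [hev.deriv_eq]
    have hsub : HasDerivAt (fun z => z - z₂) 1 z₁ := (hasDerivAt_id z₁).sub_const z₂
    have hmem : (z₁ - z₂) / z₂ ∈ ball (0 : ℂ) 1 := by
      rw [mem_ball_zero_iff, norm_div, div_lt_one h0]
      exact h2
    have hder : ∀ i, HasDerivAt (fun z => z₂ ^ r i * (z - z₂) ^ s i * f i ((z - z₂) / z₂))
        (z₂ ^ r i * (s i * (z₁ - z₂) ^ (s i - 1) * 1) * f i ((z₁ - z₂) / z₂)
          + z₂ ^ r i * (z₁ - z₂) ^ s i * (_root_.deriv (f i) ((z₁ - z₂) / z₂) * (1 / z₂))) z₁ :=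
      fun i => ((hsub.cpow_const (Or.inl h6)).const_mul _).mul
        (((hx.analytic i _ hmem).differentiableAt.hasDerivAt).comp z₁ (hsub.div_const z₂))
    rw [(HasDerivAt.fun_sum fun i _ => hder i).deriv]
    simp only [Fin.sum_univ_add, Fin.append_left, Fin.append_right]
    rw [← Finset.sum_add_distrib]
    refine Finset.sum_congr rfl fun i _ => ?_
    rw [cpow_sub _ _ hz2, cpow_one]
    ring
  · dsimp only
    rw [hd, expansionCoeff_append]
    simp only [expansionCoeff_eq_sum]
    rw [← Finset.sum_add_distrib, Finset.mul_sum]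
    exact Finset.sum_congr rfl fun i _ => (termCoeff_deriv (r i) (s i) (f i) n m).symm

end Derivative

/-! ### Generalized weight spaces and the restricted dual -/

section Weights

open Module.End

variable {W : Type*} [AddCommGroup W] [Module ℂ W] {T : Module.End ℂ W}

theorem mem_maxGenEigenspace_iff {h : ℂ} {w : W} : w ∈ maxGenEigenspace T h ↔
    ∃ n : ℕ, ((T - algebraMap ℂ (Module.End ℂ W) h) ^ n) w = 0 := by
  rw [mem_maxGenEigenspace]
  simp only [Algebra.algebraMap_eq_smul_one]

theorem maxGenEigenspace_eq_bot {h : ℂ} (hh : eigenspace T h = ⊥) : maxGenEigenspace T h = ⊥ := by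
  rw [eq_bot_iff]
  intro w hw
  obtain ⟨n, hn⟩ := mem_maxGenEigenspace_iff.1 hw
  induction n generalizing w with
  | zero => simpa using hn
  | succ n ih =>
    rw [pow_succ, Module.End.mul_apply] at hn
    have h1 : (T - algebraMap ℂ (Module.End ℂ W) h) w ∈ (⊥ : Submodule ℂ W) :=
      ih (mem_maxGenEigenspace_iff.2 ⟨n, hn⟩) hn
    have h2 : w ∈ eigenspace T h := by
      rw [mem_eigenspace_iff]
      simpa [sub_eq_zero] using h1
    rwa [hh] at h2

theorem InCategory.iSup_eq_top {D : ModuleCategory} {W : Type u} [AddCommGroup W] [Module ℂ W]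
    {T : Module.End ℂ W} (hT : InCategory D T) : ⨆ h, maxGenEigenspace T h = ⊤ := by
  cases D with
  | C =>
    rw [eq_top_iff, ← hT.1]
    exact iSup_mono fun h => eigenspace_le_maxGenEigenspace
  | C1 =>
    rw [eq_top_iff]
    intro w _
    obtain ⟨N, hN, hw, hst⟩ := hT.1 w
    have h1 := iSup_maxGenEigenspace_eq_top (T.restrict hst)
    have h2 : (⟨w, hw⟩ : N) ∈ ⨆ h, maxGenEigenspace (T.restrict hst) h := h1 ▸ Submodule.mem_top
    have h3 : (⨆ h, maxGenEigenspace (T.restrict hst) h)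
        ≤ (⨆ h, maxGenEigenspace T h).comap N.subtype := by
      refine iSup_le fun h => ?_
      rw [maxGenEigenspace, genEigenspace_restrict]
      exact Submodule.comap_mono (le_iSup (fun h => maxGenEigenspace T h) h)
    exact h3 h2

theorem InCategory.lower {D : ModuleCategory} {W : Type u} [AddCommGroup W] [Module ℂ W]
    {T : Module.End ℂ W} (hT : InCategory D T) (h : ℂ) :
    ∃ N : ℤ, ∀ n : ℤ, n < N → maxGenEigenspace T (h + n) = ⊥ := by
  cases D with
  | C =>
    obtain ⟨N, hN⟩ := hT.2.2 h
    exact ⟨N, fun n hn => maxGenEigenspace_eq_bot (hN n hn)⟩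
  | C1 =>
    obtain ⟨S, hS⟩ := hT.2
    obtain ⟨B, hB⟩ := (S.image Complex.re).bddBelow
    refine ⟨⌊B - h.re⌋, fun n hn => ?_⟩
    by_contra hne
    obtain ⟨s, hs, j, hj⟩ := hS _ hne
    have h1 : B ≤ s.re := hB (by simpa using ⟨s, hs, rfl⟩)
    have h2 := congrArg Complex.re hj
    simp only [Complex.add_re, Complex.intCast_re, Complex.natCast_re] at h2
    have h3 : (n : ℝ) < B - h.re :=
      (Int.cast_lt.2 hn).trans_le (Int.floor_le _)
    have h4 : (0 : ℝ) ≤ j := Nat.cast_nonneg j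
    linarith

theorem weight_induction (hT : ⨆ h, maxGenEigenspace T h = ⊤) {p : W → Prop}
    (hmem : ∀ h, ∀ w ∈ maxGenEigenspace T h, p w) (h0 : p 0)
    (hadd : ∀ x y, p x → p y → p (x + y)) (w : W) : p w :=
  Submodule.iSup_induction _ (motive := p) (hT ▸ Submodule.mem_top : w ∈ ⨆ h, maxGenEigenspace T h)
    hmem h0 hadd

/-- The operator `TZ - (h₁ + h₂ + c)` acts on B x y as a derivation built from the nilpotent parts
on x and y, so p + q applications annihilate it. -/
theorem weight_add {X Y Z : Type*} [AddCommGroup X] [Module ℂ X] [AddCommGroup Y] [Module ℂ Y]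
    [AddCommGroup Z] [Module ℂ Z] {TX : Module.End ℂ X} {TY : Module.End ℂ Y} {TZ : Module.End ℂ Z}
    (B : X →ₗ[ℂ] Y →ₗ[ℂ] Z) (c : ℂ)
    (hB : ∀ x y, TZ (B x y) = B (TX x) y + B x (TY y) + c • B x y) {h₁ h₂ : ℂ} {x : X} {y : Y}
    (hx : x ∈ maxGenEigenspace TX h₁) (hy : y ∈ maxGenEigenspace TY h₂) :
    B x y ∈ maxGenEigenspace TZ (h₁ + h₂ + c) := by
  obtain ⟨p, hp⟩ := mem_maxGenEigenspace_iff.1 hx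
  obtain ⟨q, hq⟩ := mem_maxGenEigenspace_iff.1 hy
  clear hx hy
  rw [mem_maxGenEigenspace_iff]
  refine ⟨p + q, ?_⟩
  obtain ⟨N, hN⟩ : ∃ N, p + q = N := ⟨_, rfl⟩
  rw [hN]
  induction N generalizing p q x y with
  | zero =>
    obtain rfl : p = 0 := by omega
    rw [show x = 0 by simpa using hp]
    simp
  | succ N ih =>
    rw [pow_succ, Module.End.mul_apply]
    have e : (TZ - algebraMap ℂ (Module.End ℂ Z) (h₁ + h₂ + c)) (B x y)
        = B ((TX - algebraMap ℂ (Module.End ℂ X) h₁) x) y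
          + B x ((TY - algebraMap ℂ (Module.End ℂ Y) h₂) y) := by
      simp only [LinearMap.sub_apply, Module.algebraMap_end_apply, hB, map_sub, map_smul,
        LinearMap.smul_apply]
      module
    rw [e, map_add]
    have z1 : ((TZ - algebraMap ℂ (Module.End ℂ Z) (h₁ + h₂ + c)) ^ N)
        (B ((TX - algebraMap ℂ (Module.End ℂ X) h₁) x) y) = 0 := by
      cases p with
      | zero =>
        rw [show x = 0 by simpa using hp]
        simp
      | succ p =>
        rw [pow_succ, Module.End.mul_apply] at hp
        exact ih p hp q hq (by omega)
    have z2 : ((TZ - algebraMap ℂ (Module.End ℂ Z) (h₁ + h₂ + c)) ^ N)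
        (B x ((TY - algebraMap ℂ (Module.End ℂ Y) h₂) y)) = 0 := by
      cases q with
      | zero =>
        rw [show y = 0 by simpa using hq]
        simp
      | succ q =>
        rw [pow_succ, Module.End.mul_apply] at hq
        exact ih p hp q hq (by omega)
    rw [z1, z2, add_zero]

section Dual

variable {W : Type u} [AddCommGroup W] [Module ℂ W] {T : Module.End ℂ W}

/-- The restricted dual as a space of functionals. -/
def restrictedDual (T : Module.End ℂ W) : Submodule ℂ (Module.Dual ℂ W) where
  carrier := {φ | InRestrictedDual T φ}
  zero_mem' := by simp [InRestrictedDual]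
  add_mem' := by
    intro φ ψ hφ hψ
    refine (Set.Finite.union hφ hψ).subset ?_
    rintro h ⟨w, hw, hne⟩
    by_cases h1 : φ w = 0
    · exact Or.inr ⟨w, hw, fun h2 => hne (by simp [h1, h2])⟩
    · exact Or.inl ⟨w, hw, h1⟩
  smul_mem' := by
    intro a φ hφ
    refine Set.Finite.subset hφ ?_
    rintro h ⟨w, hw, hne⟩
    exact ⟨w, hw, fun h2 => hne (by simp [h2])⟩

theorem mem_restrictedDual {φ : Module.Dual ℂ W} : φ ∈ restrictedDual T ↔ InRestrictedDual T φ :=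
  Iff.rfl

theorem IsHomogeneousDual.mem_restrictedDual {h : ℂ} {φ : Module.Dual ℂ W}
    (hφ : IsHomogeneousDual T h φ) : φ ∈ restrictedDual T := by
  rw [VOA.mem_restrictedDual]
  refine (Set.finite_singleton h).subset ?_
  rintro h' ⟨w, hw, hne⟩
  by_contra hh
  exact hne (hφ h' hh w hw)

/-- Modulo the sum of the other weight spaces the family stays independent; a functional with the
prescribed values on the quotient pulls back. -/
theorem exists_homogeneousDual {h : ℂ} {κ : Type*} {v : κ → W}
    (hv : ∀ i, v i ∈ maxGenEigenspace T h) (hli : LinearIndependent ℂ v) (b : κ → ℂ) :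
    ∃ φ, IsHomogeneousDual T h φ ∧ ∀ i, φ (v i) = b i := by
  set G' : Submodule ℂ W := ⨆ (h') (_ : h' ≠ h), maxGenEigenspace T h' with hG'
  have hdis : Disjoint (maxGenEigenspace T h) G' := independent_maxGenEigenspace T h
  have hli' : LinearIndependent ℂ (G'.mkQ ∘ v) := by
    refine hli.map ?_
    rw [Submodule.ker_mkQ]
    refine hdis.mono_left (Submodule.span_le.2 ?_)
    rintro _ ⟨i, rfl⟩
    exact hv i
  obtain ⟨g, hg⟩ := LinearMap.exists_extend ((Module.Basis.span hli').constr ℂ b)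
  refine ⟨g ∘ₗ G'.mkQ, fun h' hne w hw => ?_, fun i => ?_⟩
  · have : w ∈ G' := (le_iSup₂_of_le h' hne le_rfl : maxGenEigenspace T h' ≤ G') hw
    have h0 : G'.mkQ w = 0 := by simpa using this
    rw [LinearMap.comp_apply, h0, map_zero]
  · have := LinearMap.congr_fun hg (Module.Basis.span hli' i)
    rw [Module.Basis.constr_basis] at this
    rw [← this]
    simp [Module.Basis.span_apply]

theorem isCompl_weight (hT : ⨆ h, maxGenEigenspace T h = ⊤) (h : ℂ) :
    IsCompl (maxGenEigenspace T h) (⨆ (h') (_ : h' ≠ h), maxGenEigenspace T h') := by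
  refine ⟨independent_maxGenEigenspace T h, codisjoint_iff_le_sup.2 ?_⟩
  rw [← hT]
  refine iSup_le fun h' => ?_
  by_cases hh : h' = h
  · rw [hh]; exact le_sup_left
  · exact (le_iSup₂ (f := fun h' (_ : h' ≠ h) => maxGenEigenspace T h') h' hh).trans le_sup_right

/-- The component of a functional on a weight space. -/
def weightPart (hT : ⨆ h, maxGenEigenspace T h = ⊤) (h : ℂ) (φ : Module.Dual ℂ W) :
    Module.Dual ℂ W :=
  φ ∘ₗ Submodule.projection _ _ (isCompl_weight hT h)

theorem weightPart_apply_self (hT : ⨆ h, maxGenEigenspace T h = ⊤) {h : ℂ} (φ : Module.Dual ℂ W)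
    {w : W} (hw : w ∈ maxGenEigenspace T h) : weightPart hT h φ w = φ w := by
  rw [weightPart, LinearMap.comp_apply, ← Submodule.coe_projectionOnto_apply,
    Submodule.projectionOnto_apply_of_mem_left _ hw]

theorem isHomogeneousDual_weightPart (hT : ⨆ h, maxGenEigenspace T h = ⊤) (h : ℂ)
    (φ : Module.Dual ℂ W) : IsHomogeneousDual T h (weightPart hT h φ) := by
  intro h' hne w hw
  have : w ∈ ⨆ (h') (_ : h' ≠ h), maxGenEigenspace T h' :=
    (le_iSup₂_of_le h' hne le_rfl : maxGenEigenspace T h' ≤ _) hw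
  rw [weightPart, LinearMap.comp_apply, ← Submodule.coe_projectionOnto_apply,
    Submodule.projectionOnto_apply_of_mem_right _ this]
  simp

theorem restrictedDual_induction (hT : ⨆ h, maxGenEigenspace T h = ⊤)
    {p : Module.Dual ℂ W → Prop} (hmem : ∀ h φ, IsHomogeneousDual T h φ → p φ) (h0 : p 0)
    (hadd : ∀ φ ψ, p φ → p ψ → p (φ + ψ)) {φ : Module.Dual ℂ W} (hφ : InRestrictedDual T φ) :
    p φ := by
  have key : φ = ∑ h ∈ hφ.toFinset, weightPart hT h φ := by
    ext w
    refine weight_induction hT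
      (p := fun w => φ w = (∑ h ∈ hφ.toFinset, weightPart hT h φ) w) ?_ (by simp) ?_ w
    · intro h w hw
      rw [LinearMap.sum_apply, Finset.sum_eq_single h, weightPart_apply_self hT φ hw]
      · intro h' _ hne
        exact isHomogeneousDual_weightPart hT h' φ h hne.symm w hw
      · intro hnot
        rw [weightPart_apply_self hT φ hw]
        by_contra hne
        exact hnot (hφ.mem_toFinset.2 ⟨w, hw, hne⟩)
    · intro x y hx hy
      simp only [map_add, hx, hy]
  rw [key]
  exact Finset.sum_induction _ p hadd h0 fun h _ => hmem h _ (isHomogeneousDual_weightPart hT h φ)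

/-- A vector has finitely many weight components, so on it an arbitrary functional agrees with a
finite sum of its weight parts, which lies in the restricted dual. -/
theorem eq_zero_of_restrictedDual (hT : ⨆ h, maxGenEigenspace T h = ⊤) {x : W}
    (hx : ∀ φ, InRestrictedDual T φ → φ x = 0) : x = 0 := by
  by_contra hne
  obtain ⟨θ, hθ⟩ : ∃ θ : Module.Dual ℂ W, θ x ≠ 0 := by
    by_contra hh
    push Not at hh
    exact hne ((Module.forall_dual_apply_eq_zero_iff ℂ x).1 hh)
  classical
  have key : ∀ y : W, ∃ S : Finset ℂ, ∀ S', S ⊆ S' → θ y = (∑ h ∈ S', weightPart hT h θ) y := by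
    refine weight_induction hT ?_ ⟨∅, by simp⟩ ?_
    · intro h w hw
      refine ⟨{h}, fun S' hS' => ?_⟩
      rw [LinearMap.sum_apply, Finset.sum_eq_single_of_mem h (hS' (by simp)),
        weightPart_apply_self hT θ hw]
      intro h' _ hne
      exact isHomogeneousDual_weightPart hT h' θ h hne.symm w hw
    · rintro x y ⟨S, hS⟩ ⟨S', hS'⟩
      refine ⟨S ∪ S', fun S'' h => ?_⟩
      rw [map_add, map_add, hS S'' (Finset.union_subset_left h), hS' S'' (Finset.union_subset_right h)]
  obtain ⟨S, hS⟩ := key x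
  rw [hS S subset_rfl] at hθ
  refine hθ (hx _ (mem_restrictedDual.1 (Submodule.sum_mem _ fun h _ => ?_)))
  exact (isHomogeneousDual_weightPart hT h θ).mem_restrictedDual

end Dual

end Weights

/-! ### Weights of the modes of vertex and intertwining operators -/

section VertexOperators

variable {V : Type v} [AddCommGroup V] [Module ℂ V] {𝒱 : VertexOperatorAlgebra V}

theorem bsum_one {E : Type*} [AddCommGroup E] (g : ℕ → E) : bsum 1 g = g 0 + g 1 := by
  rw [bsum, finsum_eq_sum_of_support_subset (s := Finset.range 2)]
  · simp [Finset.sum_range_succ]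
  · intro i hi
    simp only [Finset.coe_range, Set.mem_Iio]
    by_contra hlt
    refine hi ?_
    have h1 : Ring.choose (1 : ℤ) i = 0 := by
      have := Ring.choose_natCast (R := ℤ) 1 i
      rw [Nat.cast_one] at this
      rw [this, Nat.choose_eq_zero_of_lt (by omega), Nat.cast_zero]
    change Ring.choose (1 : ℤ) i • g i = 0
    rw [h1, zero_smul]

theorem jacobi_iff {A V W₁ W₂ W₃ : Type*} [Ring A] [AddCommGroup V] [Module ℂ V]
    [AddCommGroup W₁] [Module ℂ W₁] [AddCommGroup W₂] [Module ℂ W₂] [AddCommGroup W₃] [Module ℂ W₃]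
    {Y₁ : ℤ → V →ₗ[ℂ] W₁ →ₗ[ℂ] W₁} {Y₂ : ℤ → V →ₗ[ℂ] W₂ →ₗ[ℂ] W₂} {Y₃ : ℤ → V →ₗ[ℂ] W₃ →ₗ[ℂ] W₃}
    {I : A → W₁ →ₗ[ℂ] W₂ →ₗ[ℂ] W₃} :
    Jacobi Y₁ Y₂ Y₃ I ↔ ∀ (a : V) (w₁ : W₁) (w₂ : W₂) (l m : ℤ) (α : A),
      jP l m α (fun k x => Y₃ k a (I x w₁ w₂)) - jN l m α (fun k x => I x w₁ (Y₂ k a w₂))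
        = jR l m α fun k x => I x (Y₁ k a w₁) w₂ := by
  simp only [Jacobi, jP, jN, jR, bsum, smul_smul, mul_comm]

/-- The Jacobi identity for ω at l = 0, m = 1; the scalar c comes from the L(-1)-derivative
property. -/
theorem Jacobi.L0_comm {A W₁ W₂ W₃ : Type*} [Ring A]
    [AddCommGroup W₁] [Module ℂ W₁] [AddCommGroup W₂] [Module ℂ W₂] [AddCommGroup W₃] [Module ℂ W₃]
    {Y₁ : ℤ → V →ₗ[ℂ] W₁ →ₗ[ℂ] W₁} {Y₂ : ℤ → V →ₗ[ℂ] W₂ →ₗ[ℂ] W₂} {Y₃ : ℤ → V →ₗ[ℂ] W₃ →ₗ[ℂ] W₃}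
    {I : A → W₁ →ₗ[ℂ] W₂ →ₗ[ℂ] W₃} (hI : Jacobi Y₁ Y₂ Y₃ I) {ω : V} {α : A} {c : ℂ}
    {w₁ : W₁} {w₂ : W₂} (hd : I (α + 1) (Y₁ 0 ω w₁) w₂ = c • I α w₁ w₂) :
    Y₃ 1 ω (I α w₁ w₂) = I α (Y₁ 1 ω w₁) w₂ + I α w₁ (Y₂ 1 ω w₂) + c • I α w₁ w₂ := by
  have := jacobi_iff.1 hI ω w₁ w₂ 0 1 α
  rw [jP_zero, jN_zero, jR, bsum_one] at this
  simp only [Int.cast_one, Nat.cast_zero, sub_zero, Nat.cast_one, add_sub_cancel_right, zero_add] at this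
  rw [hd] at this
  rw [sub_eq_iff_eq_add.1 this]
  abel

theorem Intertwining.weight {W₁ W₂ W₃ : Type u} [AddCommGroup W₁] [Module ℂ W₁]
    [AddCommGroup W₂] [Module ℂ W₂] [AddCommGroup W₃] [Module ℂ W₃] {M₁ : WeakModule 𝒱 W₁}
    {M₂ : WeakModule 𝒱 W₂} {M₃ : WeakModule 𝒱 W₃} (I : Intertwining M₁ M₂ M₃) (α : ℂ) {h₁ h₂ : ℂ}
    {w₁ : W₁} {w₂ : W₂} (hw₁ : w₁ ∈ Module.End.maxGenEigenspace M₁.L0 h₁)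
    (hw₂ : w₂ ∈ Module.End.maxGenEigenspace M₂.L0 h₂) :
    I.mode α w₁ w₂ ∈ Module.End.maxGenEigenspace M₃.L0 (h₁ + h₂ + (-(α + 1))) := by
  refine weight_add (I.mode α) _ (fun x y => ?_) hw₁ hw₂
  refine I.jacobi.L0_comm ?_
  rw [I.derivative, add_sub_cancel_right]

theorem WeakModule.weight {W : Type u} [AddCommGroup W] [Module ℂ W] (M : WeakModule 𝒱 W) (k : ℤ)
    {h : ℂ} {n : ℤ} {a : V} {w : W} (ha : a ∈ Module.End.eigenspace (𝒱.Y 1 𝒱.conformal) (n : ℂ))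
    (hw : w ∈ Module.End.maxGenEigenspace M.L0 h) :
    M.Y k a w ∈ Module.End.maxGenEigenspace M.L0 (n + h + (-(k + 1 : ℤ))) := by
  refine weight_add (TX := 𝒱.Y 1 𝒱.conformal) (M.Y k) _ (fun x y => ?_)
    (Module.End.eigenspace_le_maxGenEigenspace ha) hw
  refine M.jacobi.L0_comm ?_
  have := M.derivative (k + 1) x y
  rw [add_sub_cancel_right] at this
  rw [← this]

theorem VertexOperatorAlgebra.homogeneous_induction (𝒱 : VertexOperatorAlgebra V) {p : V → Prop}
    (hmem : ∀ n : ℤ, ∀ a ∈ Module.End.eigenspace (𝒱.Y 1 𝒱.conformal) (n : ℂ), p a) (h0 : p 0)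
    (hadd : ∀ a b, p a → p b → p (a + b)) (a : V) : p a :=
  Submodule.iSup_induction _ (motive := p) (𝒱.graded ▸ Submodule.mem_top :
    a ∈ ⨆ n : ℤ, Module.End.eigenspace (𝒱.Y 1 𝒱.conformal) (n : ℂ)) hmem h0 hadd

variable {W : Type u} [AddCommGroup W] [Module ℂ W]

theorem WeakModule.comp_mem_restrictedDual (M : WeakModule 𝒱 W) {φ : Module.Dual ℂ W}
    (hφ : InRestrictedDual M.L0 φ) (k : ℤ) (a : V) : InRestrictedDual M.L0 (φ ∘ₗ M.Y k a) := by
  rw [← mem_restrictedDual]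
  refine 𝒱.homogeneous_induction (p := fun a => φ ∘ₗ M.Y k a ∈ restrictedDual M.L0) ?_ ?_ ?_ a
  · intro n a ha
    rw [mem_restrictedDual]
    refine (Set.Finite.image (fun h : ℂ => h - n + (k + 1 : ℤ)) hφ).subset ?_
    rintro h ⟨w, hw, hne⟩
    exact ⟨_, ⟨_, M.weight k ha hw, hne⟩, by push_cast; ring⟩
  · simp
  · intro a b ha hb
    rw [map_add, LinearMap.comp_add]
    exact Submodule.add_mem _ ha hb

/-- The mode a_k changes weights by wt a - k - 1. For very negative k the finitely many weights seen
by φ could only be reached from weights below those of the module. -/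
theorem WeakModule.comp_eq_zero {D : ModuleCategory} (M : WeakModule 𝒱 W) (hM : InCategory D M.L0)
    {φ : Module.Dual ℂ W} (hφ : InRestrictedDual M.L0 φ) (a : V) :
    ∃ K : ℤ, ∀ k < K, φ ∘ₗ M.Y k a = 0 := by
  refine 𝒱.homogeneous_induction (p := fun a => ∃ K : ℤ, ∀ k < K, φ ∘ₗ M.Y k a = 0) ?_ ?_ ?_ a
  · intro n a ha
    have : ∀ᶠ k : ℤ in atBot, ∀ h ∈ hφ.toFinset,
        Module.End.maxGenEigenspace M.L0 (h - n + 1 + k) = ⊥ := by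
      refine (eventually_all_finset _).2 fun h _ => ?_
      obtain ⟨N, hN⟩ := hM.lower (h - n + 1)
      filter_upwards [eventually_lt_atBot N] with k hk
      exact hN k hk
    obtain ⟨K, hK⟩ := eventually_atBot.1 this
    refine ⟨K, fun k hk => ?_⟩
    ext w
    refine weight_induction hM.iSup_eq_top
      (p := fun w => (φ ∘ₗ M.Y k a) w = (0 : Module.Dual ℂ W) w) ?_ (by simp) ?_ w
    · intro h w hw
      by_contra hne
      have h1 : (n : ℂ) + h + (-(k + 1 : ℤ)) ∈ hφ.toFinset :=
        hφ.mem_toFinset.2 ⟨_, M.weight k ha hw, hne⟩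
      have h2 := hK k hk.le _ h1
      rw [show (n : ℂ) + h + (-(k + 1 : ℤ)) - n + 1 + k = h by push_cast; ring] at h2
      rw [h2, Submodule.mem_bot] at hw
      rw [hw] at hne
      simp at hne
    · intro x y hx hy
      rw [map_add, map_add, hx, hy]
  · exact ⟨0, by simp⟩
  · rintro a b ⟨K, hK⟩ ⟨K', hK'⟩
    refine ⟨min K K', fun k hk => ?_⟩
    rw [map_add, LinearMap.comp_add, hK k (by omega), hK' k (by omega), add_zero]

end VertexOperators

/-! ### From matrix coefficients to vectors -/

section Coefficients

open Module.End

variable {W : Type u} [AddCommGroup W] [Module ℂ W] {T : Module.End ℂ W}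

theorem IsHomogeneousDual.weight_eq {h h' : ℂ} {φ : Module.Dual ℂ W} (hφ : IsHomogeneousDual T h φ)
    {w : W} (hw : w ∈ maxGenEigenspace T h') (hne : φ w ≠ 0) : h' = h := by
  by_contra hh
  exact hne (hφ h' hh w hw)

/-- Convergence of a homogeneous series with vector coefficients, tested on all the functionals,
leaves room for finitely many linearly independent coefficients only. -/
theorem finite_of_summable {κ : Type*} {h : ℂ} {v : κ → W} (hv : ∀ i, v i ∈ maxGenEigenspace T h)
    (hli : LinearIndependent ℂ v) {b : κ → ℂ} (hb : ∀ i, b i ≠ 0)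
    (hs : ∀ φ, IsHomogeneousDual T h φ → Summable fun i => φ (v i) * b i) : Finite κ := by
  -- With these values every term of the series equals 1, and this cannot be summed over an infinite
  -- index set.
  obtain ⟨φ, hφ, hφv⟩ := exists_homogeneousDual hv hli fun i => (b i)⁻¹
  have h1 := (hs φ hφ).tendsto_cofinite_zero
  simp only [hφv, inv_mul_cancel₀ (hb _)] at h1
  by_contra hfin
  rw [not_finite_iff_infinite] at hfin
  have := tendsto_nhds_unique h1 tendsto_const_nhds
  exact zero_ne_one this

/-- If `E₁₂` is defined on the series `⟨φ, u⟩` for all functionals `φ` in the restricted dual, where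
`u` is a series with coefficients in weight spaces, the series `E₁₂⟨φ, u⟩` are the pairings of `φ`
with a series of vectors. -/
theorem exists_vector_of_hasE12 (hT : ⨆ h, maxGenEigenspace T h = ⊤) {h : ℂ} {v : ℂ → ℂ → W}
    (hv : ∀ m n, v m n ∈ maxGenEigenspace T (h - (m + n)))
    (hE : ∀ φ, InRestrictedDual T φ → ∃ d, HasE12 (fun m n => φ (v m n)) d) :
    ∃ Ψ : ℂ → ℂ → W, (∀ n m, Ψ n m ∈ maxGenEigenspace T (h - (m + n))) ∧
      ∀ φ, InRestrictedDual T φ → HasE12 (fun m n => φ (v m n)) fun n m => φ (Ψ n m) := by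
  classical
  have hE' : ∀ h' φ, IsHomogeneousDual T h' φ → ∃ d, HasE12 (fun m n => φ (v m n)) d :=
    fun h' φ hφ => hE φ (mem_restrictedDual.1 hφ.mem_restrictedDual)
  have key : ∀ n m : ℂ, ∃ x ∈ maxGenEigenspace T (h - (m + n)), ∀ h' φ, IsHomogeneousDual T h' φ →
      ∀ d, HasE12 (fun m n => φ (v m n)) d → d n m = φ x := by
    intro n m
    set K := m + n with hK
    -- The coefficients of one total degree, all in a single weight space, which may be
    -- infinite-dimensional. A maximal independent family among them is finite, as convergence at
    -- the point (2, 1) shows.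
    let u : {p : ℂ × ℂ // p.1 + p.2 = K} → W := fun p => v p.1.1 p.1.2
    have hu : ∀ p, u p ∈ maxGenEigenspace T (h - K) := by
      rintro ⟨⟨m', n'⟩, hp⟩
      have := hv m' n'
      rwa [show m' + n' = K from hp] at this
    obtain ⟨κ, a, ha, hspan, hli⟩ := exists_linearIndependent' ℂ u
    have hfin : Finite κ := by
      refine finite_of_summable (v := u ∘ a) (fun i => hu _) hli
        (b := fun i => (2 : ℂ) ^ (-(a i).1.1 - 1) * 1 ^ (-(a i).1.2 - 1)) (fun i => ?_) ?_
      · rw [Complex.one_cpow, mul_one]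
        simp [Complex.cpow_eq_zero_iff]
      · intro φ hφ
        obtain ⟨d, k, r, s, f, hx, -⟩ := hE' _ φ hφ
        have := (hx.converges 2 1 (by simp) (by simp)).comp_injective
          (Subtype.val_injective.comp ha)
        refine this.congr fun i => ?_
        simp only [Function.comp_apply, u, mul_assoc]
    have hdual : ∀ i, ∃ φ, IsHomogeneousDual T (h - K) φ ∧ ∀ j, φ (u (a j)) = if j = i then 1 else 0 :=
      fun i => exists_homogeneousDual (fun j => hu (a j)) hli fun j => if j = i then 1 else 0
    choose φi hφi hφij using hdual
    choose di hdi using fun i => hE' _ _ (hφi i)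
    have := Fintype.ofFinite κ
    -- The vector is assembled from E₁₂ of the pairings with the functionals dual to the independent
    -- coefficients.
    refine ⟨∑ i, di i n m • u (a i), Submodule.sum_mem _ fun i _ => Submodule.smul_mem _ _ (hu _), ?_⟩
    intro h' φ hφ d hd
    by_cases hh : h' = h - K
    · subst hh
      have h0 : HasE12 ((fun m n => φ (v m n)) + ∑ i, (-φ (u (a i))) • fun m n => φi i (v m n))
          (d + ∑ i, (-φ (u (a i))) • di i) := by
        have := Submodule.add_mem e12Space (mem_e12Space.2 hd) (Submodule.sum_mem e12Space
          fun i (_ : i ∈ Finset.univ) => Submodule.smul_mem _ (-φ (u (a i))) (mem_e12Space.2 (hdi i)))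
        rw [← mem_e12Space]
        convert this using 1
        ext : 1
        · simp [Prod.fst_sum]
        · simp [Prod.snd_sum]
      -- The functional φ minus its expansion in the dual functionals kills every coefficient, so
      -- uniqueness of E₁₂ gives the corresponding relation between the extended series.
      have hzero : (fun m n => φ (v m n)) + ∑ i, (-φ (u (a i))) • (fun m n => φi i (v m n)) = 0 := by
        ext m' n'
        set φ' : Module.Dual ℂ W := φ - ∑ i, φ (u (a i)) • φi i with hφ'
        have e : ((fun m n => φ (v m n)) + ∑ i, (-φ (u (a i))) • fun m n => φi i (v m n)) m' n'
            = φ' (v m' n') := by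
          simp [hφ', Finset.sum_apply, LinearMap.sum_apply, sub_eq_add_neg]
        rw [e]
        by_cases hmn : m' + n' = K
        · have hmem : u ⟨(m', n'), hmn⟩ ∈ Submodule.span ℂ (Set.range (u ∘ a)) :=
            hspan ▸ Submodule.subset_span ⟨_, rfl⟩
          have hle : Submodule.span ℂ (Set.range (u ∘ a)) ≤ LinearMap.ker φ' := by
            rw [Submodule.span_le]
            rintro _ ⟨j, rfl⟩
            simp [hφ', LinearMap.sum_apply, hφij]
          exact hle hmem
        · have hne : h - (m' + n') ≠ h - K := fun h1 => hmn (sub_right_injective h1)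
          have z1 := hφ _ hne _ (hv m' n')
          have z2 := fun i => hφi i _ hne _ (hv m' n')
          simp [hφ', LinearMap.sum_apply, z1, z2]
      rw [hzero] at h0
      have h1 := h0.unique HasE12.zero
      have h2 := congrFun (congrFun h1 n) m
      simp only [Pi.add_apply, Finset.sum_apply, Pi.smul_apply, smul_eq_mul, Pi.zero_apply,
        neg_mul, Finset.sum_neg_distrib, ← sub_eq_add_neg, sub_eq_zero] at h2
      rw [h2, map_sum]
      exact Finset.sum_congr rfl fun i _ => by rw [map_smul, smul_eq_mul, mul_comm]
    · have z : φ (∑ i, di i n m • u (a i)) = 0 :=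
        hφ (h - K) (Ne.symm hh) _
          (Submodule.sum_mem _ fun i _ => Submodule.smul_mem _ _ (hu _))
      rw [z]
      -- For a functional of another weight, the product series is concentrated in a different total
      -- degree, and E₁₂ preserves that degree.
      by_contra hne
      have := hd.homogeneous (K := h - h') (fun m' n' hc => ?_) n m hne
      · exact hh (by rw [hK, add_comm, this]; ring)
      · rw [← hφ.weight_eq (hv m' n') hc]
        ring
  choose Ψ hΨ hΨ' using key
  refine ⟨Ψ, hΨ, fun φ hφ => ?_⟩
  refine restrictedDual_induction hT
    (p := fun φ => HasE12 (fun m n => φ (v m n)) fun n m => φ (Ψ n m)) ?_ HasE12.zero ?_ hφ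
  · intro h' φ hφ
    obtain ⟨d, hd⟩ := hE' h' φ hφ
    convert hd using 3 with n m
    exact (hΨ' n m h' φ hφ d hd).symm
  · intro φ φ' h1 h2
    exact h1.add h2

end Coefficients

/-! ### The series ψ: existence, truncation and L(-1)-derivatives -/

section Psi

open Module.End

variable {V : Type v} [AddCommGroup V] [Module ℂ V] {𝒱 : VertexOperatorAlgebra V}
  {W₁ W₂ W₃ W₄ W₅ : Type u}
  [AddCommGroup W₁] [Module ℂ W₁] [AddCommGroup W₂] [Module ℂ W₂] [AddCommGroup W₃] [Module ℂ W₃]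
  [AddCommGroup W₄] [Module ℂ W₄] [AddCommGroup W₅] [Module ℂ W₅]
  {M₁ : WeakModule 𝒱 W₁} {M₂ : WeakModule 𝒱 W₂} {M₃ : WeakModule 𝒱 W₃} {M₄ : WeakModule 𝒱 W₄}
  {M₅ : WeakModule 𝒱 W₅} {I₁ : Intertwining M₁ M₅ M₄} {I₂ : Intertwining M₂ M₃ M₅}

theorem product_weight (m n : ℂ) {h₁ h₂ h₃ : ℂ} {w₁ : W₁} {w₂ : W₂} {w₃ : W₃}
    (hw₁ : w₁ ∈ maxGenEigenspace M₁.L0 h₁) (hw₂ : w₂ ∈ maxGenEigenspace M₂.L0 h₂)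
    (hw₃ : w₃ ∈ maxGenEigenspace M₃.L0 h₃) :
    I₁.mode m w₁ (I₂.mode n w₂ w₃) ∈ maxGenEigenspace M₄.L0 (h₁ + h₂ + h₃ - 2 - (m + n)) := by
  have := I₁.weight m hw₁ (I₂.weight n hw₂ hw₃)
  convert this using 2
  ring

theorem IsPsi.eq (hM₄ : ⨆ h, maxGenEigenspace M₄.L0 h = ⊤) {w₁ : W₁} {w₂ : W₂} {w₃ : W₃}
    {Ψ Ψ' : ℂ → ℂ → W₄}
    (h : ∀ φ, InRestrictedDual M₄.L0 φ → HasE12 (productCoeff I₁ I₂ w₁ w₂ w₃ φ) fun n m => φ (Ψ n m))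
    (h' : ∀ φ, InRestrictedDual M₄.L0 φ →
      HasE12 (productCoeff I₁ I₂ w₁ w₂ w₃ φ) fun n m => φ (Ψ' n m)) : Ψ = Ψ' := by
  ext n m
  rw [← sub_eq_zero]
  refine eq_zero_of_restrictedDual hM₄ fun φ hφ => ?_
  rw [map_sub, sub_eq_zero]
  exact congrFun (congrFun ((h φ hφ).unique (h' φ hφ)) n) m

/-- Hypotheses under which the series `ψ` exist. -/
structure PsiData (I₁ : Intertwining M₁ M₅ M₄) (I₂ : Intertwining M₂ M₃ M₅) : Prop where
  top₁ : ⨆ h, maxGenEigenspace M₁.L0 h = ⊤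
  top₂ : ⨆ h, maxGenEigenspace M₂.L0 h = ⊤
  top₃ : ⨆ h, maxGenEigenspace M₃.L0 h = ⊤
  top₄ : ⨆ h, maxGenEigenspace M₄.L0 h = ⊤
  lower₄ : ∀ h : ℂ, ∃ N : ℤ, ∀ n : ℤ, n < N → maxGenEigenspace M₄.L0 (h + n) = ⊥
  conv : ConvergenceExtension I₁ I₂

/-- An exponent -n - 1 that occurs has the form sᵢ + j with j ≥ 0, so the lower bound on Re sᵢ
bounds Re n from above by a constant independent of w₃ and φ. -/
theorem PsiData.exists_bound (H : PsiData I₁ I₂) : ∃ N : ℤ, ∀ (h₁ h₂ h₃ h₄ : ℂ) (w₁ : W₁) (w₂ : W₂)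
    (w₃ : W₃) (φ : Module.Dual ℂ W₄), w₁ ∈ maxGenEigenspace M₁.L0 h₁ →
    w₂ ∈ maxGenEigenspace M₂.L0 h₂ → w₃ ∈ maxGenEigenspace M₃.L0 h₃ →
    IsHomogeneousDual M₄.L0 h₄ φ → ∃ d, HasE12 (productCoeff I₁ I₂ w₁ w₂ w₃ φ) d ∧
      ∀ n m, d n m ≠ 0 → (N : ℝ) < (h₁ + h₂ - n - 1).re := by
  obtain ⟨N, hN⟩ := H.conv
  refine ⟨N, fun h₁ h₂ h₃ h₄ w₁ w₂ w₃ φ hw₁ hw₂ hw₃ hφ => ?_⟩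
  by_cases hz : w₁ = 0 ∨ w₂ = 0 ∨ w₃ = 0
  · have hc : productCoeff I₁ I₂ w₁ w₂ w₃ φ = 0 := by
      ext m n
      rcases hz with rfl | rfl | rfl <;> simp [productCoeff]
    exact ⟨0, hc ▸ HasE12.zero, fun n m h => absurd rfl h⟩
  · push Not at hz
    obtain ⟨k, r, s, f, hs, hx⟩ := hN h₁ h₂ h₃ h₄ w₁ w₂ w₃ φ ⟨hz.1, mem_maxGenEigenspace_iff.1 hw₁⟩
      ⟨hz.2.1, mem_maxGenEigenspace_iff.1 hw₂⟩ ⟨hz.2.2, mem_maxGenEigenspace_iff.1 hw₃⟩ hφ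
    refine ⟨_, ⟨k, r, s, f, hx, fun _ _ => rfl⟩, fun n m hne => ?_⟩
    rw [expansionCoeff_eq_sum] at hne
    obtain ⟨i, -, hi⟩ := Finset.exists_ne_zero_of_sum_ne_zero hne
    have : ∃ j : ℕ, -n - 1 = s i + j ∧ -m - 1 = r i - j := by
      by_contra hcon
      push Not at hcon
      exact hi (termCoeff_eq_zero hcon)
    obtain ⟨j, hj, -⟩ := this
    have h1 := hs i
    have h2 := congrArg Complex.re hj
    simp only [Complex.add_re, Complex.sub_re, Complex.neg_re, Complex.one_re,
      Complex.natCast_re] at h1 h2 ⊢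
    have h4 : (0 : ℝ) ≤ j := Nat.cast_nonneg j
    linarith

theorem PsiData.exists_hasE12 (H : PsiData I₁ I₂) (w₁ : W₁) (w₂ : W₂) (w₃ : W₃)
    {φ : Module.Dual ℂ W₄} (hφ : InRestrictedDual M₄.L0 φ) :
    ∃ d, HasE12 (productCoeff I₁ I₂ w₁ w₂ w₃ φ) d := by
  obtain ⟨N, hN⟩ := H.exists_bound
  refine restrictedDual_induction H.top₄
    (p := fun φ => ∃ d, HasE12 (productCoeff I₁ I₂ w₁ w₂ w₃ φ) d) (fun h₄ φ hφ => ?_)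
    ⟨0, HasE12.zero⟩ (fun φ φ' h h' => ?_) hφ
  · refine weight_induction H.top₁
      (p := fun w₁ => ∃ d, HasE12 (productCoeff I₁ I₂ w₁ w₂ w₃ φ) d) (fun h₁ w₁ hw₁ => ?_)
      ⟨0, ?_⟩ (fun x y hx hy => ?_) w₁
    · refine weight_induction H.top₂
        (p := fun w₂ => ∃ d, HasE12 (productCoeff I₁ I₂ w₁ w₂ w₃ φ) d) (fun h₂ w₂ hw₂ => ?_)
        ⟨0, ?_⟩ (fun x y hx hy => ?_) w₂
      · refine weight_induction H.top₃
          (p := fun w₃ => ∃ d, HasE12 (productCoeff I₁ I₂ w₁ w₂ w₃ φ) d) (fun h₃ w₃ hw₃ => ?_)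
          ⟨0, ?_⟩ (fun x y hx hy => ?_) w₃
        · obtain ⟨d, hd, -⟩ := hN h₁ h₂ h₃ h₄ w₁ w₂ w₃ φ hw₁ hw₂ hw₃ hφ
          exact ⟨d, hd⟩
        · convert HasE12.zero using 1
          ext; simp [productCoeff]
        · obtain ⟨d, hd⟩ := hx
          obtain ⟨d', hd'⟩ := hy
          refine ⟨d + d', ?_⟩
          convert hd.add hd' using 1
          ext; simp [productCoeff]
      · convert HasE12.zero using 1
        ext; simp [productCoeff]
      · obtain ⟨d, hd⟩ := hx
        obtain ⟨d', hd'⟩ := hy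
        refine ⟨d + d', ?_⟩
        convert hd.add hd' using 1
        ext; simp [productCoeff]
    · convert HasE12.zero using 1
      ext; simp [productCoeff]
    · obtain ⟨d, hd⟩ := hx
      obtain ⟨d', hd'⟩ := hy
      refine ⟨d + d', ?_⟩
      convert hd.add hd' using 1
      ext; simp [productCoeff]
  · obtain ⟨d, hd⟩ := h
    obtain ⟨d', hd'⟩ := h'
    exact ⟨d + d', hd.add hd'⟩

theorem PsiData.exists_vector_homogeneous (H : PsiData I₁ I₂) {h₁ h₂ h₃ : ℂ} {w₁ : W₁} {w₂ : W₂}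
    {w₃ : W₃} (hw₁ : w₁ ∈ maxGenEigenspace M₁.L0 h₁) (hw₂ : w₂ ∈ maxGenEigenspace M₂.L0 h₂)
    (hw₃ : w₃ ∈ maxGenEigenspace M₃.L0 h₃) :
    ∃ Ψ : ℂ → ℂ → W₄, (∀ n m, Ψ n m ∈ maxGenEigenspace M₄.L0 (h₁ + h₂ + h₃ - 2 - (m + n))) ∧
      ∀ φ, InRestrictedDual M₄.L0 φ →
        HasE12 (productCoeff I₁ I₂ w₁ w₂ w₃ φ) fun n m => φ (Ψ n m) :=
  exists_vector_of_hasE12 H.top₄ (fun m n => product_weight m n hw₁ hw₂ hw₃)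
    fun _ hφ => H.exists_hasE12 w₁ w₂ w₃ hφ

theorem PsiData.exists_vector (H : PsiData I₁ I₂) (w₁ : W₁) (w₂ : W₂) (w₃ : W₃) :
    ∃ Ψ : ℂ → ℂ → W₄, ∀ φ, InRestrictedDual M₄.L0 φ →
        HasE12 (productCoeff I₁ I₂ w₁ w₂ w₃ φ) fun n m => φ (Ψ n m) := by
  refine weight_induction H.top₁ (p := fun w₁ => ∃ Ψ : ℂ → ℂ → W₄, ∀ φ, InRestrictedDual M₄.L0 φ →
      HasE12 (productCoeff I₁ I₂ w₁ w₂ w₃ φ) fun n m => φ (Ψ n m)) (fun h₁ w₁ hw₁ => ?_)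
    ⟨0, fun φ hφ => ?_⟩ (fun x y hx hy => ?_) w₁
  · refine weight_induction H.top₂ (p := fun w₂ => ∃ Ψ : ℂ → ℂ → W₄, ∀ φ, InRestrictedDual M₄.L0 φ →
        HasE12 (productCoeff I₁ I₂ w₁ w₂ w₃ φ) fun n m => φ (Ψ n m)) (fun h₂ w₂ hw₂ => ?_)
      ⟨0, fun φ hφ => ?_⟩ (fun x y hx hy => ?_) w₂
    · refine weight_induction H.top₃ (p := fun w₃ => ∃ Ψ : ℂ → ℂ → W₄, ∀ φ,
          InRestrictedDual M₄.L0 φ →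
          HasE12 (productCoeff I₁ I₂ w₁ w₂ w₃ φ) fun n m => φ (Ψ n m)) (fun h₃ w₃ hw₃ => ?_)
        ⟨0, fun φ hφ => ?_⟩ (fun x y hx hy => ?_) w₃
      · obtain ⟨Ψ, -, hΨ⟩ := H.exists_vector_homogeneous hw₁ hw₂ hw₃
        exact ⟨Ψ, hΨ⟩
      · convert HasE12.zero using 1 <;> (ext; simp [productCoeff])
      · obtain ⟨d, hd⟩ := hx
        obtain ⟨d', hd'⟩ := hy
        refine ⟨d + d', fun φ hφ => ?_⟩
        convert (hd φ hφ).add (hd' φ hφ) using 1 <;> (ext; simp [productCoeff])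
    · convert HasE12.zero using 1 <;> (ext; simp [productCoeff])
    · obtain ⟨d, hd⟩ := hx
      obtain ⟨d', hd'⟩ := hy
      refine ⟨d + d', fun φ hφ => ?_⟩
      convert (hd φ hφ).add (hd' φ hφ) using 1 <;> (ext; simp [productCoeff])
  · convert HasE12.zero using 1 <;> (ext; simp [productCoeff])
  · obtain ⟨d, hd⟩ := hx
    obtain ⟨d', hd'⟩ := hy
    refine ⟨d + d', fun φ hφ => ?_⟩
    convert (hd φ hφ).add (hd' φ hφ) using 1 <;> (ext; simp [productCoeff])

/-- The coefficients of the series `ψ(w₁,w₂;z₀,z₂)w₃`. -/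
def PsiData.vec (H : PsiData I₁ I₂) (w₁ : W₁) (w₂ : W₂) (w₃ : W₃) : ℂ → ℂ → W₄ :=
  (H.exists_vector w₁ w₂ w₃).choose

theorem PsiData.hasE12_vec (H : PsiData I₁ I₂) (w₁ : W₁) (w₂ : W₂) (w₃ : W₃) {φ : Module.Dual ℂ W₄}
    (hφ : InRestrictedDual M₄.L0 φ) :
    HasE12 (productCoeff I₁ I₂ w₁ w₂ w₃ φ) fun n m => φ (H.vec w₁ w₂ w₃ n m) :=
  (H.exists_vector w₁ w₂ w₃).choose_spec φ hφ

theorem PsiData.vec_eq (H : PsiData I₁ I₂) {w₁ : W₁} {w₂ : W₂} {w₃ : W₃} {Ψ : ℂ → ℂ → W₄}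
    (h : ∀ φ, InRestrictedDual M₄.L0 φ →
      HasE12 (productCoeff I₁ I₂ w₁ w₂ w₃ φ) fun n m => φ (Ψ n m)) : H.vec w₁ w₂ w₃ = Ψ :=
  IsPsi.eq H.top₄ (fun _ hφ => H.hasE12_vec w₁ w₂ w₃ hφ) h

/-- The coefficients `ψ_n(w₁,w₂)_m`, as a trilinear map. -/
def PsiData.psi (H : PsiData I₁ I₂) (n m : ℂ) : W₁ →ₗ[ℂ] W₂ →ₗ[ℂ] W₃ →ₗ[ℂ] W₄ :=
  LinearMap.mk₂ ℂ
    (fun w₁ w₂ =>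
      { toFun := fun w₃ => H.vec w₁ w₂ w₃ n m
        map_add' := fun x y => by
          rw [H.vec_eq (Ψ := H.vec w₁ w₂ x + H.vec w₁ w₂ y)]
          · rfl
          intro φ hφ
          convert (H.hasE12_vec w₁ w₂ x hφ).add (H.hasE12_vec w₁ w₂ y hφ) using 1 <;>
            (ext; simp [productCoeff])
        map_smul' := fun c x => by
          rw [H.vec_eq (Ψ := c • H.vec w₁ w₂ x)]
          · rfl
          intro φ hφ
          convert (H.hasE12_vec w₁ w₂ x hφ).smul c using 1 <;> (ext; simp [productCoeff]) })
    (fun x y w₂ => by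
      ext w₃
      change H.vec (x + y) w₂ w₃ n m = H.vec x w₂ w₃ n m + H.vec y w₂ w₃ n m
      rw [H.vec_eq (Ψ := H.vec x w₂ w₃ + H.vec y w₂ w₃)]
      · rfl
      intro φ hφ
      convert (H.hasE12_vec x w₂ w₃ hφ).add (H.hasE12_vec y w₂ w₃ hφ) using 1 <;>
        (ext; simp [productCoeff]))
    (fun c x w₂ => by
      ext w₃
      change H.vec (c • x) w₂ w₃ n m = c • H.vec x w₂ w₃ n m
      rw [H.vec_eq (Ψ := c • H.vec x w₂ w₃)]
      · rfl
      intro φ hφ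
      convert (H.hasE12_vec x w₂ w₃ hφ).smul c using 1 <;> (ext; simp [productCoeff]))
    (fun w₁ x y => by
      ext w₃
      change H.vec w₁ (x + y) w₃ n m = H.vec w₁ x w₃ n m + H.vec w₁ y w₃ n m
      rw [H.vec_eq (Ψ := H.vec w₁ x w₃ + H.vec w₁ y w₃)]
      · rfl
      intro φ hφ
      convert (H.hasE12_vec w₁ x w₃ hφ).add (H.hasE12_vec w₁ y w₃ hφ) using 1 <;>
        (ext; simp [productCoeff]))
    (fun c w₁ x => by
      ext w₃
      change H.vec w₁ (c • x) w₃ n m = c • H.vec w₁ x w₃ n m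
      rw [H.vec_eq (Ψ := c • H.vec w₁ x w₃)]
      · rfl
      intro φ hφ
      convert (H.hasE12_vec w₁ x w₃ hφ).smul c using 1 <;> (ext; simp [productCoeff]))

theorem PsiData.hasE12 (H : PsiData I₁ I₂) (w₁ : W₁) (w₂ : W₂) (w₃ : W₃) {φ : Module.Dual ℂ W₄}
    (hφ : InRestrictedDual M₄.L0 φ) :
    HasE12 (productCoeff I₁ I₂ w₁ w₂ w₃ φ) fun n m => φ (H.psi n m w₁ w₂ w₃) :=
  H.hasE12_vec w₁ w₂ w₃ hφ

theorem PsiData.isPsi (H : PsiData I₁ I₂) (w₁ : W₁) (w₂ : W₂) :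
    IsPsi I₁ I₂ w₁ w₂ fun n m => H.psi n m w₁ w₂ :=
  fun w₃ _ hφ => H.hasE12 w₁ w₂ w₃ hφ

theorem PsiData.psi_eq (H : PsiData I₁ I₂) {w₁ : W₁} {w₂ : W₂} {w₃ : W₃} {Ψ : ℂ → ℂ → W₄}
    (h : ∀ φ, InRestrictedDual M₄.L0 φ →
      HasE12 (productCoeff I₁ I₂ w₁ w₂ w₃ φ) fun n m => φ (Ψ n m)) (n m : ℂ) :
    H.psi n m w₁ w₂ w₃ = Ψ n m :=
  congrFun (congrFun (H.vec_eq h) n) m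

theorem PsiData.eq_psi_of_isPsi (H : PsiData I₁ I₂) {w₁ : W₁} {w₂ : W₂}
    {ψ : ℂ → ℂ → W₃ →ₗ[ℂ] W₄} (h : IsPsi I₁ I₂ w₁ w₂ ψ) (n m : ℂ) : ψ n m = H.psi n m w₁ w₂ := by
  ext w₃
  exact (H.psi_eq (Ψ := fun n m => ψ n m w₃) (fun φ hφ => h w₃ φ hφ) n m).symm

theorem PsiData.psi_weight (H : PsiData I₁ I₂) {h₁ h₂ h₃ : ℂ} {w₁ : W₁} {w₂ : W₂}
    {w₃ : W₃} (hw₁ : w₁ ∈ maxGenEigenspace M₁.L0 h₁) (hw₂ : w₂ ∈ maxGenEigenspace M₂.L0 h₂)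
    (hw₃ : w₃ ∈ maxGenEigenspace M₃.L0 h₃) (n m : ℂ) :
    H.psi n m w₁ w₂ w₃ ∈ maxGenEigenspace M₄.L0 (h₁ + h₂ + h₃ - 2 - (m + n)) := by
  obtain ⟨Ψ, h, hΨ⟩ := H.exists_vector_homogeneous hw₁ hw₂ hw₃
  rw [H.psi_eq hΨ]
  exact h n m

/-- Trilinear induction over weight vectors. -/
theorem PsiData.induction (H : PsiData I₁ I₂) {p : W₁ → W₂ → W₃ → Prop}
    (hmem : ∀ h₁ h₂ h₃, ∀ w₁ ∈ maxGenEigenspace M₁.L0 h₁, ∀ w₂ ∈ maxGenEigenspace M₂.L0 h₂,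
      ∀ w₃ ∈ maxGenEigenspace M₃.L0 h₃, p w₁ w₂ w₃)
    (z₁ : ∀ w₂ w₃, p 0 w₂ w₃) (z₂ : ∀ w₁ w₃, p w₁ 0 w₃) (z₃ : ∀ w₁ w₂, p w₁ w₂ 0)
    (a₁ : ∀ x y w₂ w₃, p x w₂ w₃ → p y w₂ w₃ → p (x + y) w₂ w₃)
    (a₂ : ∀ w₁ x y w₃, p w₁ x w₃ → p w₁ y w₃ → p w₁ (x + y) w₃)
    (a₃ : ∀ w₁ w₂ x y, p w₁ w₂ x → p w₁ w₂ y → p w₁ w₂ (x + y)) (w₁ : W₁) (w₂ : W₂) (w₃ : W₃) :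
    p w₁ w₂ w₃ := by
  refine weight_induction H.top₁ (p := fun w₁ => p w₁ w₂ w₃) (fun h₁ w₁ hw₁ => ?_)
    (z₁ _ _) (fun x y => a₁ x y _ _) w₁
  refine weight_induction H.top₂ (p := fun w₂ => p w₁ w₂ w₃) (fun h₂ w₂ hw₂ => ?_)
    (z₂ _ _) (fun x y => a₂ _ x y _) w₂
  exact weight_induction H.top₃ (p := fun w₃ => p w₁ w₂ w₃)
    (fun h₃ w₃ hw₃ => hmem h₁ h₂ h₃ w₁ hw₁ w₂ hw₂ w₃ hw₃) (z₃ _ _) (fun x y => a₃ _ _ x y) w₃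

/-- For fixed n, raising m lowers the weight of the coefficient, and the weights of the target are
bounded below in each class modulo ℤ. -/
theorem PsiData.psi_truncated_snd (H : PsiData I₁ I₂) (n m : ℂ) (w₁ : W₁) (w₂ : W₂) (w₃ : W₃) :
    ∃ N : ℤ, ∀ i : ℤ, N ≤ i → H.psi n (m + i) w₁ w₂ w₃ = 0 := by
  refine H.induction (p := fun w₁ w₂ w₃ => ∃ N : ℤ, ∀ i : ℤ, N ≤ i → H.psi n (m + i) w₁ w₂ w₃ = 0)
    ?_ (fun _ _ => ⟨0, by simp⟩) (fun _ _ => ⟨0, by simp⟩) (fun _ _ => ⟨0, by simp⟩) ?_ ?_ ?_ w₁ w₂ w₃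
  · intro h₁ h₂ h₃ w₁ hw₁ w₂ hw₂ w₃ hw₃
    obtain ⟨N, hN⟩ := H.lower₄ (h₁ + h₂ + h₃ - 2 - (m + n))
    refine ⟨1 - N, fun i hi => ?_⟩
    have := H.psi_weight hw₁ hw₂ hw₃ n (m + i)
    rw [show h₁ + h₂ + h₃ - 2 - (m + i + n) = h₁ + h₂ + h₃ - 2 - (m + n) + (-i : ℤ) by
      push_cast; ring, hN (-i) (by omega)] at this
    simpa using this
  · rintro x y w₂ w₃ ⟨N, hN⟩ ⟨N', hN'⟩
    exact ⟨max N N', fun i hi => by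
      simp [hN i (le_of_max_le_left hi), hN' i (le_of_max_le_right hi)]⟩
  · rintro w₁ x y w₃ ⟨N, hN⟩ ⟨N', hN'⟩
    exact ⟨max N N', fun i hi => by
      simp [hN i (le_of_max_le_left hi), hN' i (le_of_max_le_right hi)]⟩
  · rintro w₁ w₂ x y ⟨N, hN⟩ ⟨N', hN'⟩
    exact ⟨max N N', fun i hi => by
      simp [hN i (le_of_max_le_left hi), hN' i (le_of_max_le_right hi)]⟩

/-- The bound of the convergence and extension property is uniform in w₃ and φ, so the whole series
ψ_n(w₁,w₂) vanishes for large n. Weights alone would not give this uniformity. -/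
theorem PsiData.psi_truncated_fst (H : PsiData I₁ I₂) (n : ℂ) (w₁ : W₁) (w₂ : W₂) :
    ∃ N : ℤ, ∀ i : ℤ, N ≤ i → ∀ m, H.psi (n + i) m w₁ w₂ = 0 := by
  obtain ⟨B, hB⟩ := H.exists_bound
  refine weight_induction H.top₁
    (p := fun w₁ => ∃ N : ℤ, ∀ i : ℤ, N ≤ i → ∀ m, H.psi (n + i) m w₁ w₂ = 0)
    (fun h₁ w₁ hw₁ => ?_) ⟨0, by simp⟩ ?_ w₁
  · refine weight_induction H.top₂
      (p := fun w₂ => ∃ N : ℤ, ∀ i : ℤ, N ≤ i → ∀ m, H.psi (n + i) m w₁ w₂ = 0)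
      (fun h₂ w₂ hw₂ => ?_) ⟨0, by simp⟩ ?_ w₂
    · refine ⟨⌈(h₁ + h₂ - n - 1).re - B⌉, fun i hi m => ?_⟩
      ext w₃
      refine weight_induction H.top₃ (p := fun w₃ => H.psi (n + i) m w₁ w₂ w₃ = 0)
        (fun h₃ w₃ hw₃ => ?_) (by simp) (fun x y hx hy => by simp [hx, hy]) w₃
      refine eq_zero_of_restrictedDual H.top₄ fun φ hφ => ?_
      refine restrictedDual_induction H.top₄ (p := fun φ => φ (H.psi (n + i) m w₁ w₂ w₃) = 0)
        (fun h₄ φ hφ => ?_) (by simp) (fun φ φ' h h' => by simp [h, h']) hφ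
      obtain ⟨d, hd, hd0⟩ := hB h₁ h₂ h₃ h₄ w₁ w₂ w₃ φ hw₁ hw₂ hw₃ hφ
      have := (H.hasE12 w₁ w₂ w₃ (mem_restrictedDual.1 hφ.mem_restrictedDual)).unique hd
      have := congrFun (congrFun this (n + i)) m
      rw [this]
      by_contra hne
      have h1 := hd0 _ _ hne
      have h2 : (h₁ + h₂ - n - 1).re - B ≤ i := Int.ceil_le.1 hi
      simp only [Complex.add_re, Complex.sub_re, Complex.one_re, Complex.intCast_re] at h1 h2
      linarith
    · rintro x y ⟨N, hN⟩ ⟨N', hN'⟩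
      exact ⟨max N N', fun i hi m => by
        simp [hN i (le_of_max_le_left hi), hN' i (le_of_max_le_right hi)]⟩
  · rintro x y ⟨N, hN⟩ ⟨N', hN'⟩
    exact ⟨max N N', fun i hi m => by
      simp [hN i (le_of_max_le_left hi), hN' i (le_of_max_le_right hi)]⟩

theorem PsiData.psi_derivative_fst (H : PsiData I₁ I₂) (n m : ℂ) (w₁ : W₁) (w₂ : W₂) :
    H.psi n m (M₁.Y 0 𝒱.conformal w₁) w₂ = (-n) • H.psi (n - 1) m w₁ w₂ := by
  ext w₃
  refine H.psi_eq (Ψ := fun n m => (-n) • H.psi (n - 1) m w₁ w₂ w₃) (fun φ hφ => ?_) n m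
  have hc : productCoeff I₁ I₂ (M₁.Y 0 𝒱.conformal w₁) w₂ w₃ φ
      = fun m n => -m * productCoeff I₁ I₂ w₁ w₂ w₃ φ (m - 1) n := by
    ext m n
    simp only [productCoeff, I₁.derivative, map_smul, smul_eq_mul]
  obtain ⟨d, k, r, s, f, hx, -⟩ := H.exists_hasE12 (M₁.Y 0 𝒱.conformal w₁) w₂ w₃ hφ
  rw [hc] at hx ⊢
  have := (H.hasE12 w₁ w₂ w₃ hφ).deriv hx.converges
  simpa only [map_smul, smul_eq_mul] using this

/-- Euler's relation replaces differentiation in z₂: on a homogeneous series z₂∂₂c = -(K+2)c -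
z₁∂₁c, and E₁₂ of the right side is known. Uniqueness and the homogeneity of d then give d₂ = ∂d/∂z₂
- ∂d/∂z₀. -/
theorem HasE12.of_homogeneous {c c₂ d d₂ : ℂ → ℂ → ℂ} {K : ℂ} (hd : HasE12 c d) (hd₂ : HasE12 c₂ d₂)
    (hd₁ : HasE12 (fun m n => -m * c (m - 1) n) fun n m => -n * d (n - 1) m)
    (hc₂ : ∀ m n, c₂ m n = -n * c m (n - 1)) (hc : ∀ m n, c m n ≠ 0 → m + n = K) (n m : ℂ) :
    d₂ n m = n * d (n - 1) m - m * d n (m - 1) := by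
  have h1 := (hd₂.shift 1).add (hd₁.mul_fst.add (hd.smul (K + 2)))
  have h0 : ((fun p x => c₂ p (x + 1)) + ((fun p x => -(p + 1) * c (p + 1 - 1) x) + (K + 2) • c)) = 0 := by
    ext p x
    simp only [Pi.add_apply, Pi.smul_apply, smul_eq_mul, hc₂, add_sub_cancel_right, Pi.zero_apply]
    by_cases h : c p x = 0
    · simp [h]
    · rw [← hc p x h]
      ring
  rw [h0] at h1
  have h2 := congrFun (congrFun (h1.unique HasE12.zero) n) (m - 1)
  simp only [Pi.add_apply, Pi.smul_apply, smul_eq_mul, Pi.zero_apply, sub_add_cancel,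
    add_sub_cancel_right] at h2
  by_cases h : d n (m - 1) = 0
  · rw [h] at h2 ⊢
    linear_combination h2
  · have := hd.homogeneous hc n (m - 1) h
    rw [← this] at h2
    linear_combination h2

theorem PsiData.psi_derivative_snd (H : PsiData I₁ I₂) (n m : ℂ) (w₁ : W₁) (w₂ : W₂) :
    H.psi n m w₁ (M₂.Y 0 𝒱.conformal w₂)
      = n • H.psi (n - 1) m w₁ w₂ - m • H.psi n (m - 1) w₁ w₂ := by
  ext w₃
  refine H.induction (p := fun w₁ w₂ w₃ => H.psi n m w₁ (M₂.Y 0 𝒱.conformal w₂) w₃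
      = (n • H.psi (n - 1) m w₁ w₂ - m • H.psi n (m - 1) w₁ w₂) w₃) ?_ (by simp) (by simp) (by simp)
    ?_ ?_ ?_ w₁ w₂ w₃
  · intro h₁ h₂ h₃ w₁ hw₁ w₂ hw₂ w₃ hw₃
    rw [← sub_eq_zero]
    refine eq_zero_of_restrictedDual H.top₄ fun φ hφ => ?_
    rw [map_sub, sub_eq_zero]
    refine restrictedDual_induction H.top₄ (p := fun φ => φ (H.psi n m w₁ (M₂.Y 0 𝒱.conformal w₂) w₃)
      = φ ((n • H.psi (n - 1) m w₁ w₂ - m • H.psi n (m - 1) w₁ w₂) w₃)) (fun h₄ φ hφ => ?_)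
      (by simp) (fun φ φ' h h' => by rw [LinearMap.add_apply, LinearMap.add_apply, h, h']) hφ
    have hφ' := mem_restrictedDual.1 hφ.mem_restrictedDual
    have hd := H.hasE12 w₁ w₂ w₃ hφ'
    have hd₁ := H.hasE12 (M₁.Y 0 𝒱.conformal w₁) w₂ w₃ hφ'
    have hd₂ := H.hasE12 w₁ (M₂.Y 0 𝒱.conformal w₂) w₃ hφ'
    have := hd.of_homogeneous (K := h₁ + h₂ + h₃ - 2 - h₄) hd₂ (by
        convert hd₁ using 3
        · simp only [productCoeff, I₁.derivative, map_smul, smul_eq_mul]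
        · simp only [H.psi_derivative_fst, LinearMap.smul_apply, map_smul, smul_eq_mul])
      (fun m n => by
        simp only [productCoeff, I₂.derivative, map_smul, smul_eq_mul])
      (fun m n hne => by
        rw [← hφ.weight_eq (product_weight m n hw₁ hw₂ hw₃) hne]
        ring) n m
    rw [this]
    simp
  all_goals
    intro _ _ _ _ h h'
    simp only [map_add, LinearMap.add_apply, LinearMap.sub_apply, LinearMap.smul_apply] at h h' ⊢
    rw [h, h']
    try module

end Psi

section Maps

variable {X E F : Type*} [Ring X] [AddCommGroup E] [AddCommGroup F]

theorem map_jP (l m : ℤ) (x : X) {P : ℤ → X → E} (hP : TruncP P) (f : E →+ F) :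
    f (jP l m x P) = jP l m x fun k y => f (P k y) := by
  simp only [jP, ← map_zsmul]
  exact bsum_map _ ((hP _ _).zsmul _) f

theorem map_jN (l m : ℤ) (x : X) {P : ℤ → X → E} (hP : TruncN P) (f : E →+ F) :
    f (jN l m x P) = jN l m x fun k y => f (P k y) := by
  simp only [jN, ← map_zsmul]
  exact bsum_map _ ((hP _ _).zsmul _) f

theorem map_jR (l m : ℤ) (x : X) {P : ℤ → X → E} (hP : TruncN P) (f : E →+ F) :
    f (jR l m x P) = jR l m x fun k y => f (P k y) :=
  bsum_map _ (hP _ _) f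

end Maps

/-! ### The action of the vertex operators on a space of series -/

section LocalSystems

variable {V : Type v} [AddCommGroup V] [Module ℂ V] {𝒱 : VertexOperatorAlgebra V}
  {W₃ W₄ : Type u} [AddCommGroup W₃] [Module ℂ W₃] [AddCommGroup W₄] [Module ℂ W₄]

theorem WeakModule.exists_high (M : WeakModule 𝒱 W₃) (a : V) (w : W₃) :
    ∃ K : ℤ, ∀ k ≥ K, M.Y k a w = 0 := by
  obtain ⟨K, hK⟩ := M.truncated 0 a w
  exact ⟨K, fun k hk => by simpa using hK k hk⟩

theorem VertexOperatorAlgebra.exists_high (𝒱 : VertexOperatorAlgebra V) (a b : V) :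
    ∃ K : ℤ, ∀ k ≥ K, 𝒱.Y k a b = 0 := by
  obtain ⟨K, hK⟩ := 𝒱.truncated 0 a b
  exact ⟨K, fun k hk => by simpa using hK k hk⟩

/-- `Θ k` is the series `a_k ∘_l Φ`, and the Jacobi identity holds for `a` and the series `Φ`. -/
structure IsAction (M₃ : WeakModule 𝒱 W₃) (M₄ : WeakModule 𝒱 W₄)
    (S : Submodule ℂ (ℂ → W₃ →ₗ[ℂ] W₄)) (a : V) (Φ : ℂ → W₃ →ₗ[ℂ] W₄)
    (Θ : ℤ → ℂ → W₃ →ₗ[ℂ] W₄) : Prop where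
  mem : ∀ k, Θ k ∈ S
  high : ∃ K : ℤ, ∀ k ≥ K, Θ k = 0
  jacobi : ∀ (u : W₃) (l m : ℤ) (α : ℂ),
    jP l m α (fun k y => M₄.Y k a (Φ y u)) - jN l m α (fun k y => Φ y (M₃.Y k a u))
      = jR l m α fun k y => Θ k y u

/-- The series in `S` are truncated and `S` is closed under the action of the vertex operators. -/
structure ActionSpace (M₃ : WeakModule 𝒱 W₃) (M₄ : WeakModule 𝒱 W₄)
    (S : Submodule ℂ (ℂ → W₃ →ₗ[ℂ] W₄)) : Prop where
  trunc : ∀ Φ ∈ S, ∀ α u, EvZero fun i : ℕ => Φ (α + i) u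
  exists_action : ∀ a, ∀ Φ ∈ S, ∃ Θ, IsAction M₃ M₄ S a Φ Θ

variable {M₃ : WeakModule 𝒱 W₃} {M₄ : WeakModule 𝒱 W₄} {S : Submodule ℂ (ℂ → W₃ →ₗ[ℂ] W₄)}

theorem truncP_comp (M₄ : WeakModule 𝒱 W₄) {Φ : ℂ → W₃ →ₗ[ℂ] W₄}
    (hΦ : ∀ α u, EvZero fun i : ℕ => Φ (α + i) u) (a : V) (u : W₃) :
    TruncP fun k y => M₄.Y k a (Φ y u) := fun k x => by
  filter_upwards [hΦ x u] with i hi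
  rw [hi, map_zero]

theorem truncN_comp (M₃ : WeakModule 𝒱 W₃) (Φ : ℂ → W₃ →ₗ[ℂ] W₄) (a : V) (u : W₃) :
    TruncN fun k y => Φ y (M₃.Y k a u) := by
  obtain ⟨K, hK⟩ := M₃.exists_high a u
  exact truncN_of_high (K := K) fun k hk x => by rw [hK k hk, map_zero]

theorem IsAction.truncN {a : V} {Φ : ℂ → W₃ →ₗ[ℂ] W₄} {Θ : ℤ → ℂ → W₃ →ₗ[ℂ] W₄}
    (h : IsAction M₃ M₄ S a Φ Θ) (u : W₃) : TruncN fun k y => Θ k y u := by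
  obtain ⟨K, hK⟩ := h.high
  exact truncN_of_high (K := K) fun k hk x => by rw [hK k hk]; rfl

/-- At m = 0 the right side of the Jacobi identity is the single term `Θ k`. This uniqueness is what
makes the action bilinear. -/
theorem IsAction.eq {a : V} {Φ : ℂ → W₃ →ₗ[ℂ] W₄} {Θ Θ' : ℤ → ℂ → W₃ →ₗ[ℂ] W₄}
    (h : IsAction M₃ M₄ S a Φ Θ) (h' : IsAction M₃ M₄ S a Φ Θ') : Θ = Θ' := by
  ext k α u
  have h1 := h.jacobi u k 0 α
  have h2 := h'.jacobi u k 0 α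
  rw [jR_zero] at h1 h2
  exact h1.symm.trans h2

theorem IsAction.add_right {a : V} {Φ Φ' : ℂ → W₃ →ₗ[ℂ] W₄} {Θ Θ' : ℤ → ℂ → W₃ →ₗ[ℂ] W₄}
    (hΦ : ∀ α u, EvZero fun i : ℕ => Φ (α + i) u) (hΦ' : ∀ α u, EvZero fun i : ℕ => Φ' (α + i) u)
    (h : IsAction M₃ M₄ S a Φ Θ) (h' : IsAction M₃ M₄ S a Φ' Θ') :
    IsAction M₃ M₄ S a (Φ + Φ') (Θ + Θ') where
  mem k := S.add_mem (h.mem k) (h'.mem k)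
  high := by
    obtain ⟨K, hK⟩ := h.high
    obtain ⟨K', hK'⟩ := h'.high
    exact ⟨max K K', fun k hk => by
      simp [hK k (le_of_max_le_left hk), hK' k (le_of_max_le_right hk)]⟩
  jacobi u l m α := by
    simp only [Pi.add_apply, LinearMap.add_apply, map_add]
    rw [jP_add _ _ _ (truncP_comp M₄ hΦ a u) (truncP_comp M₄ hΦ' a u),
      jN_add _ _ _ (truncN_comp M₃ Φ a u) (truncN_comp M₃ Φ' a u),
      jR_add _ _ _ (h.truncN u) (h'.truncN u), ← h.jacobi, ← h'.jacobi]
    abel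

theorem IsAction.smul_right {a : V} {Φ : ℂ → W₃ →ₗ[ℂ] W₄} {Θ : ℤ → ℂ → W₃ →ₗ[ℂ] W₄}
    (hΦ : ∀ α u, EvZero fun i : ℕ => Φ (α + i) u) (h : IsAction M₃ M₄ S a Φ Θ) (c : ℂ) :
    IsAction M₃ M₄ S a (c • Φ) (c • Θ) where
  mem k := S.smul_mem c (h.mem k)
  high := by
    obtain ⟨K, hK⟩ := h.high
    exact ⟨K, fun k hk => by simp [hK k hk]⟩
  jacobi u l m α := by
    have e := congrArg (LinearMap.lsmul ℂ W₄ c).toAddMonoidHom (h.jacobi u l m α)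
    rw [map_sub, map_jP _ _ _ (truncP_comp M₄ hΦ a u), map_jN _ _ _ (truncN_comp M₃ Φ a u),
      map_jR _ _ _ (h.truncN u)] at e
    simpa using e

theorem IsAction.add_left {a b : V} {Φ : ℂ → W₃ →ₗ[ℂ] W₄} {Θ Θ' : ℤ → ℂ → W₃ →ₗ[ℂ] W₄}
    (hΦ : ∀ α u, EvZero fun i : ℕ => Φ (α + i) u)
    (h : IsAction M₃ M₄ S a Φ Θ) (h' : IsAction M₃ M₄ S b Φ Θ') :
    IsAction M₃ M₄ S (a + b) Φ (Θ + Θ') where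
  mem k := S.add_mem (h.mem k) (h'.mem k)
  high := by
    obtain ⟨K, hK⟩ := h.high
    obtain ⟨K', hK'⟩ := h'.high
    exact ⟨max K K', fun k hk => by
      simp [hK k (le_of_max_le_left hk), hK' k (le_of_max_le_right hk)]⟩
  jacobi u l m α := by
    simp only [Pi.add_apply, LinearMap.add_apply, map_add]
    rw [jP_add _ _ _ (truncP_comp M₄ hΦ a u) (truncP_comp M₄ hΦ b u),
      jN_add _ _ _ (truncN_comp M₃ Φ a u) (truncN_comp M₃ Φ b u),
      jR_add _ _ _ (h.truncN u) (h'.truncN u), ← h.jacobi, ← h'.jacobi]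
    abel

theorem IsAction.smul_left {a : V} {Φ : ℂ → W₃ →ₗ[ℂ] W₄} {Θ : ℤ → ℂ → W₃ →ₗ[ℂ] W₄}
    (hΦ : ∀ α u, EvZero fun i : ℕ => Φ (α + i) u) (h : IsAction M₃ M₄ S a Φ Θ) (c : ℂ) :
    IsAction M₃ M₄ S (c • a) Φ (c • Θ) where
  mem k := S.smul_mem c (h.mem k)
  high := by
    obtain ⟨K, hK⟩ := h.high
    exact ⟨K, fun k hk => by simp [hK k hk]⟩
  jacobi u l m α := by
    have e := congrArg (LinearMap.lsmul ℂ W₄ c).toAddMonoidHom (h.jacobi u l m α)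
    rw [map_sub, map_jP _ _ _ (truncP_comp M₄ hΦ a u), map_jN _ _ _ (truncN_comp M₃ Φ a u),
      map_jR _ _ _ (h.truncN u)] at e
    simpa using e

namespace ActionSpace

variable (H : ActionSpace M₃ M₄ S)

/-- The series `a_k ∘_l Φ`. -/
def series (a : V) (Φ : S) : ℤ → ℂ → W₃ →ₗ[ℂ] W₄ := (H.exists_action a Φ Φ.2).choose

theorem isAction (a : V) (Φ : S) : IsAction M₃ M₄ S a Φ (H.series a Φ) :=
  (H.exists_action a Φ Φ.2).choose_spec

theorem series_eq {a : V} {Φ : S} {Θ : ℤ → ℂ → W₃ →ₗ[ℂ] W₄} (h : IsAction M₃ M₄ S a Φ Θ) :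
    H.series a Φ = Θ := (H.isAction a Φ).eq h

/-- The operators `a_k ∘_l` on `S`. -/
def Y (k : ℤ) : V →ₗ[ℂ] S →ₗ[ℂ] S :=
  LinearMap.mk₂ ℂ (fun a Φ => ⟨H.series a Φ k, (H.isAction a Φ).mem k⟩)
    (fun a b Φ => by
      ext1
      change H.series (a + b) Φ k = H.series a Φ k + H.series b Φ k
      rw [H.series_eq ((H.isAction a Φ).add_left (H.trunc _ Φ.2) (H.isAction b Φ))]
      rfl)
    (fun c a Φ => by
      ext1
      change H.series (c • a) Φ k = c • H.series a Φ k
      rw [H.series_eq ((H.isAction a Φ).smul_left (H.trunc _ Φ.2) c)]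
      rfl)
    (fun a Φ Φ' => by
      ext1
      change H.series a (Φ + Φ') k = H.series a Φ k + H.series a Φ' k
      rw [H.series_eq (Φ := Φ + Φ')
        ((H.isAction a Φ).add_right (H.trunc _ Φ.2) (H.trunc _ Φ'.2) (H.isAction a Φ'))]
      rfl)
    (fun c a Φ => by
      ext1
      change H.series a (c • Φ) k = c • H.series a Φ k
      rw [H.series_eq (Φ := c • Φ) ((H.isAction a Φ).smul_right (H.trunc _ Φ.2) c)]
      rfl)

theorem coe_Y (k : ℤ) (a : V) (Φ : S) : (H.Y k a Φ : ℂ → W₃ →ₗ[ℂ] W₄) = H.series a Φ k := rfl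

theorem Y_eq {a : V} {Φ : S} {Θ : ℤ → ℂ → W₃ →ₗ[ℂ] W₄} (h : IsAction M₃ M₄ S a Φ Θ) (k : ℤ) :
    (H.Y k a Φ : ℂ → W₃ →ₗ[ℂ] W₄) = Θ k := congrFun (H.series_eq h) k

/-- The coefficients of the series in `S`. -/
def eval (S : Submodule ℂ (ℂ → W₃ →ₗ[ℂ] W₄)) (α : ℂ) : S →ₗ[ℂ] W₃ →ₗ[ℂ] W₄ :=
  LinearMap.proj α ∘ₗ S.subtype

theorem eval_truncated (H : ActionSpace M₃ M₄ S) : Truncated (eval S) := fun α Φ u => by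
  obtain ⟨N, hN⟩ := eventually_atTop.1 (H.trunc Φ Φ.2 α u)
  refine ⟨N, fun n hn => ?_⟩
  obtain ⟨i, rfl⟩ := Int.eq_ofNat_of_zero_le (show 0 ≤ n by omega)
  have := hN i (by omega)
  rwa [Int.cast_natCast]

theorem eval_jacobi : Jacobi H.Y M₃.Y M₄.Y (eval S) :=
  jacobi_iff.2 fun a Φ u l m α => (H.isAction a Φ).jacobi u l m α

theorem exists_high (a : V) (Φ : S) : ∃ K : ℤ, ∀ k ≥ K, H.Y k a Φ = 0 := by
  obtain ⟨K, hK⟩ := (H.isAction a Φ).high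
  exact ⟨K, fun k hk => Subtype.ext (hK k hk)⟩

theorem Y_truncated : Truncated H.Y := fun α a Φ => by
  obtain ⟨K, hK⟩ := H.exists_high a Φ
  exact ⟨K - α, fun n hn => hK _ (by rw [Int.cast_id]; omega)⟩

theorem Y_apply (k : ℤ) (a : V) (Φ : S) (α : ℂ) (u : W₃) :
    (H.Y k a Φ : ℂ → W₃ →ₗ[ℂ] W₄) α u
      = jP k 0 α (fun j y => M₄.Y j a ((Φ : ℂ → W₃ →ₗ[ℂ] W₄) y u))
        - jN k 0 α fun j y => (Φ : ℂ → W₃ →ₗ[ℂ] W₄) y (M₃.Y j a u) := by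
  rw [(H.isAction a Φ).jacobi, jR_zero, coe_Y]

theorem Y_apply_circCoeff (k : ℤ) (a : V) (Φ : S) (α : ℂ) (u : W₃) :
    (H.Y k a Φ : ℂ → W₃ →ₗ[ℂ] W₄) α u = circCoeff M₃ M₄ a k Φ α u := by
  rw [Y_apply, circCoeff, jP, jN, bsum, bsum]
  congr 1
  · refine finsum_congr fun i => ?_
    rw [smul_smul, mul_comm, add_zero]
  · refine finsum_congr fun i => ?_
    rw [smul_smul, mul_comm, zero_add]
    congr 2
    rw [Int.negOnePow_sub]
    push_cast
    rw [Int.coe_negOnePow_natCast]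

theorem Y_vacuum (k : ℤ) (Φ : S) : H.Y k 𝒱.vacuum Φ = if k = -1 then Φ else 0 := by
  ext α u
  rw [Y_apply]
  have hN : jN k 0 α (fun j y => (Φ : ℂ → W₃ →ₗ[ℂ] W₄) y (M₃.Y j 𝒱.vacuum u)) = 0 :=
    jN_eq_zero _ _ _ fun i y => by
      rw [M₃.vacuum, if_neg (by omega), map_zero]
  rw [hN, sub_zero, jP]
  simp only [M₄.vacuum]
  by_cases hk : k = -1
  · subst hk
    rw [bsum, finsum_eq_single _ 0]
    · simp
    · intro i hi
      rw [if_neg (by omega), smul_zero, smul_zero]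
  · rw [if_neg hk, bsum]
    refine finsum_eq_zero_of_forall_eq_zero fun i => ?_
    split_ifs with h
    -- The only possible term is i = k + 1, and i ≠ 0 because k ≠ -1. Hence k ≥ 0, and the
    -- coefficient C(k, k + 1) is zero.
    · obtain ⟨j, rfl⟩ := Nat.exists_eq_succ_of_ne_zero (show i ≠ 0 by omega)
      have : Ring.choose k (j + 1) = 0 := by
        rw [show k = (j : ℕ) by push_cast at h; omega, Ring.choose_natCast, Nat.choose_succ_self,
          Nat.cast_zero]
      rw [this, zero_smul]
    · rw [smul_zero, smul_zero]

theorem choose_succ_mul (r : ℤ) (k : ℕ) :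
    ((k : ℤ) + 1) * Ring.choose r (k + 1) = r * Ring.choose (r - 1) k := by
  have := Ring.choose_smul_choose r (show 1 ≤ k + 1 by omega)
  simpa using this

theorem sub_mul_choose (r : ℤ) (k : ℕ) :
    (r - k) * Ring.choose r k = r * Ring.choose (r - 1) k := by
  have := Ring.choose_smul_choose r (show k ≤ k + 1 by omega)
  rw [← choose_succ_mul]
  simp at this
  linarith

theorem Y_derivative (k : ℤ) (a : V) (Φ : S) :
    H.Y k (𝒱.Y 0 𝒱.conformal a) Φ = (-(k : ℂ)) • H.Y (k - 1) a Φ := by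
  ext α u
  simp only [Submodule.coe_smul, Pi.smul_apply, LinearMap.smul_apply]
  have hn : ∀ (n : ℤ) (x : W₄), (n : ℂ) • x = n • x := fun n x => Int.cast_smul_eq_zsmul ℂ n x
  rw [Y_apply, Y_apply, ← Int.cast_neg, hn, zsmul_sub]
  congr 1
  · have := map_jP (k - 1) 0 α (truncP_comp M₄ (H.trunc Φ Φ.2) a u)
      (zsmulAddGroupHom (-k) : W₄ →+ W₄)
    simp only [zsmulAddGroupHom_apply] at this
    rw [this, jP, jP, bsum, bsum]
    refine finsum_congr fun i => ?_
    rw [M₄.derivative, ← Int.cast_neg, hn]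
    simp only [smul_smul, add_zero]
    rw [show k - 1 - (i : ℤ) = k - i - 1 by ring]
    congr 1
    linear_combination (-(-1 : ℤ) ^ i) * sub_mul_choose k i
  · have := map_jN (k - 1) 0 α (truncN_comp M₃ (Φ : ℂ → W₃ →ₗ[ℂ] W₄) a u)
      (zsmulAddGroupHom (-k) : W₄ →+ W₄)
    simp only [zsmulAddGroupHom_apply] at this
    rw [this, jN, jN, bsum, bsum]
    have hz : EvZero fun i : ℕ => Ring.choose k i • ((k.negOnePow : ℤ) * (-1) ^ i) •
        (Φ : ℂ → W₃ →ₗ[ℂ] W₄) (α + (k : ℂ) - (i : ℂ)) (M₃.Y (0 + i) (𝒱.Y 0 𝒱.conformal a) u) :=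
      ((truncN_comp M₃ (Φ : ℂ → W₃ →ₗ[ℂ] W₄) (𝒱.Y 0 𝒱.conformal a) u 0 (α + k)).zsmul
        fun i => (k.negOnePow : ℤ) * (-1) ^ i).zsmul _
    -- The i = 0 term vanishes because (L(-1)a)₀ = 0; the others are reindexed to match i against i
    -- + 1.
    rw [hz.finsum_succ]
    have h0 : (Φ : ℂ → W₃ →ₗ[ℂ] W₄) (α + (k : ℂ) - ((0 : ℕ) : ℂ))
        (M₃.Y (0 + (0 : ℕ)) (𝒱.Y 0 𝒱.conformal a) u) = 0 := by
      rw [M₃.derivative]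
      simp
    rw [h0, smul_zero, smul_zero, zero_add]
    refine finsum_congr fun i => ?_
    rw [M₃.derivative, ← Int.cast_neg, Int.cast_smul_eq_zsmul, map_zsmul]
    simp only [smul_smul, zero_add]
    have e1 : ((i + 1 : ℕ) : ℤ) - 1 = i := by push_cast; ring
    have e2 : α + (k : ℂ) - ((i + 1 : ℕ) : ℂ) = α + ((k - 1 : ℤ) : ℂ) - i := by push_cast; ring
    rw [e1, e2]
    congr 1
    rw [Int.negOnePow_sub, Int.negOnePow_one]
    push_cast
    linear_combination ((k.negOnePow : ℤ) * (-1) ^ i) * choose_succ_mul k i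

end ActionSpace

end LocalSystems

/-! ### The Jacobi identity as a substitution -/

section AlgebraicSubstitution

theorem TruncZ.truncN {d : ℤ → ℂ → ℂ} (hd : TruncZ d) : TruncN d := fun k x => by
  filter_upwards [hd k] with i hi
  exact hi _

/-- Pascal's rule again, now in m: raising m multiplies the series d by z₀ + z₂. -/
theorem jR_succ_right {d : ℤ → ℂ → ℂ} (hd : TruncZ d) (l m : ℤ) (α : ℂ) :
    jR l (m + 1) α d = jR l m α (mulZ d) := by
  have h : EvZero fun i : ℕ => d (l + i) (α + ((m + 1 : ℤ) : ℂ) - (i : ℂ)) := hd.truncN _ _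
  have h' : EvZero fun i : ℕ => d (l + i) (α + (m : ℂ) - (i : ℂ) + 1) := by
    convert h using 3
    push_cast; ring
  rw [jR, bsum_succ _ h, jR, ← bsum_add _ h h.succ]
  refine bsum_congr _ fun i => ?_
  rw [mulZ, add_comm]
  congr 2
  · push_cast; ring
  · push_cast; ring
  · push_cast; ring

/-- The pairs of expansions `c(z₁,z₂)`, `d(z₀,z₂)` that are related by the Jacobi identity. -/
def jacobiSpace : Submodule ℂ ((ℤ → ℂ → ℂ) × (ℤ → ℂ → ℂ)) where
  carrier := {x | TruncP x.1 ∧ TruncZ x.2 ∧ ∃ N : ℤ → ℂ → ℂ, (∃ K, ∀ k ≥ K, N k = 0) ∧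
    ∀ l m α, jP l m α x.1 - jN l m α N = jR l m α x.2}
  zero_mem' := ⟨fun k x => by simp, fun n => by simp, 0, ⟨0, fun k _ => rfl⟩, fun l m α => by
    rw [jP_eq_zero _ _ _ fun i => rfl, jN_eq_zero _ _ _ fun i y => rfl,
      jR_eq_zero _ _ _ fun i y => rfl, sub_zero]⟩
  add_mem' := by
    rintro ⟨c, d⟩ ⟨c', d'⟩ ⟨hc, hd, N, ⟨K, hK⟩, hJ⟩ ⟨hc', hd', N', ⟨K', hK'⟩, hJ'⟩
    refine ⟨fun k x => (hc k x).add (hc' k x), fun n => ?_, N + N', ⟨max K K', fun k hk => ?_⟩,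
      fun l m α => ?_⟩
    · filter_upwards [hd n, hd' n] with i h h' α
      simp [h α, h' α]
    · simp [hK k (le_of_max_le_left hk), hK' k (le_of_max_le_right hk)]
    · have tN : TruncN N := truncN_of_high (K := K) fun k hk x => by rw [hK k hk]; rfl
      have tN' : TruncN N' := truncN_of_high (K := K') fun k hk x => by rw [hK' k hk]; rfl
      have e1 := jP_add l m α hc hc'
      have e2 := jN_add l m α tN tN'
      have e3 := jR_add l m α hd.truncN hd'.truncN
      calc _ = (jP l m α c + jP l m α c') - (jN l m α N + jN l m α N') := by rw [← e1, ← e2]; rfl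
        _ = jR l m α d + jR l m α d' := by rw [← hJ l m α, ← hJ' l m α]; ring
        _ = _ := e3.symm
  smul_mem' := by
    rintro a ⟨c, d⟩ ⟨hc, hd, N, ⟨K, hK⟩, hJ⟩
    refine ⟨fun k x => ?_, fun n => ?_, a • N, ⟨K, fun k hk => by simp [hK k hk]⟩, fun l m α => ?_⟩
    · filter_upwards [hc k x] with i h
      change a * c _ _ = 0
      rw [h, mul_zero]
    · filter_upwards [hd n] with i h α
      change a * d _ _ = 0
      rw [h, mul_zero]
    · have tN : TruncN N := truncN_of_high (K := K) fun k hk x => by rw [hK k hk]; rfl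
      have := congrArg (AddMonoidHom.mulLeft a) (hJ l m α)
      rw [map_sub, map_jP _ _ _ hc, map_jN _ _ _ tN, map_jR _ _ _ hd.truncN] at this
      exact this

theorem mem_jacobiSpace {c d : ℤ → ℂ → ℂ} : (c, d) ∈ jacobiSpace ↔ TruncP c ∧ TruncZ d ∧
    ∃ N : ℤ → ℂ → ℂ, (∃ K, ∀ k ≥ K, N k = 0) ∧
      ∀ l m α, jP l m α c - jN l m α N = jR l m α d := Iff.rfl

/-- Uniqueness is weak associativity: for m large the `jN` term disappears, so c determines (z₀ +
z₂)^m d, and this power cancels on series truncated in z₀. -/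
theorem isSubstitution_jacobiSpace : IsSubstitution jacobiSpace where
  mul_fst c d := by
    rintro ⟨hc, hd, N, ⟨K, hK⟩, hJ⟩
    refine ⟨fun k x => ?_, hd.mulZ, fun k x => N (k + 1) x, ⟨K, fun k hk => ?_⟩, fun l m α => ?_⟩
    · have := hc (k + 1) x
      filter_upwards [this] with i hi
      rw [← hi]
      congr 1
      ring
    · exact hK (k + 1) (by omega)
    · have h := hJ l (m + 1) α
      rw [jR_succ_right hd] at h
      rw [show (fun n x => d (n + 1) x + d n (x + 1)) = mulZ d from rfl, ← h]
      congr 1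
      · refine bsum_congr _ fun i => ?_
        dsimp only
        rw [show l + m - i + 1 = l + (m + 1) - i by ring]
      · refine bsum_congr _ fun i => ?_
        dsimp only
        rw [show m + i + 1 = m + 1 + i by ring]
  shift c d i := by
    rintro ⟨hc, hd, N, ⟨K, hK⟩, hJ⟩
    refine ⟨fun k x => ?_, fun n => ?_, fun k x => N k (x + i), ⟨K, fun k hk => ?_⟩,
      fun l m α => ?_⟩
    · filter_upwards [hc k (x + i)] with j hj
      rw [← hj]
      congr 1
      ring
    · filter_upwards [hd n] with j hj α
      exact hj _
    · dsimp only
      rw [hK k hk]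
      rfl
    · have h := hJ l m (α + i)
      have e1 : jP l m α (fun p x => c p (x + i)) = jP l m (α + i) c :=
        bsum_congr _ fun j => by rw [add_right_comm]
      have e2 : jN l m α (fun k x => N k (x + i)) = jN l m (α + i) N :=
        bsum_congr _ fun j => by dsimp only; rw [show α + (l : ℂ) - j + i = α + i + l - j by ring]
      have e3 : jR l m α (fun p x => d p (x + i)) = jR l m (α + i) d :=
        bsum_congr _ fun j => by dsimp only; rw [show α + (m : ℂ) - j + i = α + i + m - j by ring]
      rw [e1, e2, e3, h]
  unique d := by
    rintro ⟨-, hd, N, ⟨K, hK⟩, hJ⟩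
    have key : ∀ (q : ℕ) (d : ℤ → ℂ → ℂ), TruncZ d → ∀ l α, jR l q α d = mulZ^[q] d l α := by
      intro q
      induction q with
      | zero => intro d hd l α; rw [Nat.cast_zero, jR_zero]; rfl
      | succ q ih =>
        intro d hd l α
        rw [Nat.cast_succ, jR_succ_right hd, ih _ hd.mulZ, Function.iterate_succ_apply]
    refine hd.eq_zero_of_mulZ_iterate (q := K.toNat) ?_
    ext l α
    rw [← key _ d hd, ← hJ l _ α, jP_eq_zero _ _ _ fun i => rfl,
      jN_eq_zero _ _ _ fun i y => by rw [hK _ (by omega)]; rfl, sub_zero]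
    rfl

end AlgebraicSubstitution

/-! ### The weak module structure on a space of series -/

section LocalSystems

variable {V : Type v} [AddCommGroup V] [Module ℂ V] {𝒱 : VertexOperatorAlgebra V}
  {W₃ W₄ : Type u} [AddCommGroup W₃] [Module ℂ W₃] [AddCommGroup W₄] [Module ℂ W₄]
  {M₃ : WeakModule 𝒱 W₃} {M₄ : WeakModule 𝒱 W₄} {S : Submodule ℂ (ℂ → W₃ →ₗ[ℂ] W₄)}

namespace ActionSpace

variable (H : ActionSpace M₃ M₄ S)

theorem truncP_Y (H : ActionSpace M₃ M₄ S) (Φ : S) (a : V) (u : W₃) :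
    TruncP fun k y => M₄.Y k a ((Φ : ℂ → W₃ →ₗ[ℂ] W₄) y u) :=
  truncP_comp M₄ (H.trunc Φ Φ.2) a u

theorem jacobi_apply (a : V) (Φ : S) (u : W₃) (θ : W₄ →+ ℂ) (l m : ℤ) (α : ℂ) :
    jP l m α (fun k y => θ (M₄.Y k a ((Φ : ℂ → W₃ →ₗ[ℂ] W₄) y u)))
      - jN l m α (fun k y => θ ((Φ : ℂ → W₃ →ₗ[ℂ] W₄) y (M₃.Y k a u)))
      = jR l m α fun k y => θ ((H.Y k a Φ : ℂ → W₃ →ₗ[ℂ] W₄) y u) := by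
  have := congrArg θ ((H.isAction a Φ).jacobi u l m α)
  rw [map_sub, map_jP _ _ _ (H.truncP_Y Φ a u),
    map_jN _ _ _ (truncN_comp M₃ (Φ : ℂ → W₃ →ₗ[ℂ] W₄) a u), map_jR _ _ _ ((H.isAction a Φ).truncN u)] at this
  exact this

theorem truncZ_Y (a : V) (Φ : S) (u : W₃) (θ : W₄ →+ ℂ) :
    TruncZ fun k y => θ ((H.Y k a Φ : ℂ → W₃ →ₗ[ℂ] W₄) y u) := fun n => by
  obtain ⟨K, hK⟩ := H.exists_high a Φ
  filter_upwards [eventually_gt_atTop (K - n).toNat] with i hi α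
  rw [hK _ (by omega)]
  simp

theorem mem_jacobiSpace (a : V) (Φ : S) (u : W₃) (θ : W₄ →+ ℂ) :
    ((fun p x => θ (M₄.Y p a ((Φ : ℂ → W₃ →ₗ[ℂ] W₄) x u))),
      fun n x => θ ((H.Y n a Φ : ℂ → W₃ →ₗ[ℂ] W₄) x u)) ∈ jacobiSpace := by
  refine VOA.mem_jacobiSpace.2 ⟨fun k x => ?_, H.truncZ_Y a Φ u θ,
    fun k y => θ ((Φ : ℂ → W₃ →ₗ[ℂ] W₄) y (M₃.Y k a u)), ?_, H.jacobi_apply a Φ u θ⟩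
  · filter_upwards [H.truncP_Y Φ a u k x] with i hi
    rw [hi, map_zero]
  · obtain ⟨K, hK⟩ := M₃.exists_high a u
    exact ⟨K, fun k hk => by ext y; simp [hK k hk]⟩

/-- Here the product is Y(b,z₁)Φ(z₂) and the iterate is (Y(b,z₀)Φ)(z₂); each required correspondence
is a Jacobi identity that already holds for elements of S. -/
theorem assocData {D : ModuleCategory} (hM₄ : InCategory D M₄.L0) (a b : V) (Φ : S) (u : W₃)
    {φ : Module.Dual ℂ W₄} (hφ : InRestrictedDual M₄.L0 φ) :
    AssocData jacobiSpace
      (fun k p x => φ (M₄.Y k a (M₄.Y p b ((Φ : ℂ → W₃ →ₗ[ℂ] W₄) x u))))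
      (fun k p x => φ (M₄.Y p b (M₄.Y k a ((Φ : ℂ → W₃ →ₗ[ℂ] W₄) x u))))
      (fun k p x => φ (M₄.Y p b ((Φ : ℂ → W₃ →ₗ[ℂ] W₄) x (M₃.Y k a u))))
      (fun k p x => φ (M₄.Y p (𝒱.Y k a b) ((Φ : ℂ → W₃ →ₗ[ℂ] W₄) x u)))
      (fun k p x => φ (M₄.Y p b ((H.Y k a Φ : ℂ → W₃ →ₗ[ℂ] W₄) x u)))
      (fun k n α => φ (M₄.Y k a ((H.Y n b Φ : ℂ → W₃ →ₗ[ℂ] W₄) α u)))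
      (fun k n α => φ ((H.Y n b Φ : ℂ → W₃ →ₗ[ℂ] W₄) α (M₃.Y k a u)))
      (fun k n α => φ ((H.Y n (𝒱.Y k a b) Φ : ℂ → W₃ →ₗ[ℂ] W₄) α u))
      (fun k n α => φ ((H.Y n b (H.Y k a Φ) : ℂ → W₃ →ₗ[ℂ] W₄) α u)) where
  subst := isSubstitution_jacobiSpace
  p_low := by
    obtain ⟨K, hK⟩ := M₄.comp_eq_zero hM₄ hφ a
    exact ⟨K, fun k hk => ⟨by ext p x; exact LinearMap.congr_fun (hK k hk) _,
      by ext p x; exact LinearMap.congr_fun (hK k hk) _⟩⟩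
  n_high := by
    obtain ⟨K, hK⟩ := M₃.exists_high a u
    exact ⟨K, fun k hk => ⟨by ext; simp [hK k hk], by ext; simp [hK k hk]⟩⟩
  r1_high := by
    obtain ⟨K, hK⟩ := 𝒱.exists_high a b
    exact ⟨K, fun k hk => ⟨by ext; simp [hK k hk], by ext; simp [hK k hk]⟩⟩
  r2_high := by
    obtain ⟨K, hK⟩ := H.exists_high a Φ
    exact ⟨K, fun k hk => ⟨by ext; simp [hK k hk], by ext; simp [hK k hk]⟩⟩
  m_high x := by
    obtain ⟨K, hK⟩ := M₄.exists_high a ((Φ : ℂ → W₃ →ₗ[ℂ] W₄) x u)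
    exact ⟨K, fun k hk p => by simp [hK k hk]⟩
  m_trunc p k x := by
    filter_upwards [H.trunc Φ Φ.2 x u] with i hi
    simp [hi]
  pn_trunc n := by
    obtain ⟨K, hK⟩ := H.exists_high b Φ
    filter_upwards [eventually_gt_atTop (K - n).toNat] with i hi k α
    have := hK (n + (i : ℤ)) (by omega)
    simp [this]
  r1_trunc k := H.truncZ_Y _ Φ u φ.toAddMonoidHom
  r2_trunc k := H.truncZ_Y _ (H.Y k a Φ) u φ.toAddMonoidHom
  jac1 x l m p := by
    have h := jacobi_iff.1 M₄.jacobi a b ((Φ : ℂ → W₃ →ₗ[ℂ] W₄) x u) l m p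
    have := congrArg φ.toAddMonoidHom h
    rw [map_sub, map_jP, map_jN, map_jR] at this
    · exact this
    · obtain ⟨K, hK⟩ := 𝒱.exists_high a b
      exact truncN_of_high (K := K) fun k hk x => by simp [hK k hk]
    · obtain ⟨K, hK⟩ := M₄.exists_high a ((Φ : ℂ → W₃ →ₗ[ℂ] W₄) x u)
      exact truncN_of_high (K := K) fun k hk x => by simp [hK k hk]
    · obtain ⟨K, hK⟩ := M₄.exists_high b ((Φ : ℂ → W₃ →ₗ[ℂ] W₄) x u)
      intro k p
      filter_upwards [eventually_gt_atTop (K - p).toNat] with i hi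
      rw [hK _ (by omega), map_zero]
  jac2 p l m x := H.jacobi_apply a Φ u (φ ∘ₗ M₄.Y p b).toAddMonoidHom l m x
  p_mem k := H.mem_jacobiSpace b Φ u (φ ∘ₗ M₄.Y k a).toAddMonoidHom
  n_mem k := H.mem_jacobiSpace b Φ (M₃.Y k a u) φ.toAddMonoidHom
  r1_mem k := H.mem_jacobiSpace (𝒱.Y k a b) Φ u φ.toAddMonoidHom
  r2_mem k := H.mem_jacobiSpace b (H.Y k a Φ) u φ.toAddMonoidHom

theorem apply_jR {A : Type*} [Ring A] {R : ℤ → A → S} (hR : TruncN R) (l m : ℤ) (x : A) (α : ℂ)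
    (u : W₃) : ((jR l m x R : S) : ℂ → W₃ →ₗ[ℂ] W₄) α u
      = jR l m x fun k y => (R k y : ℂ → W₃ →ₗ[ℂ] W₄) α u :=
  map_jR l m x hR (LinearMap.applyₗ u ∘ₗ eval S α).toAddMonoidHom

theorem apply_jP {A : Type*} [Ring A] {R : ℤ → A → S} (hR : TruncP R) (l m : ℤ) (x : A) (α : ℂ)
    (u : W₃) : ((jP l m x R : S) : ℂ → W₃ →ₗ[ℂ] W₄) α u
      = jP l m x fun k y => (R k y : ℂ → W₃ →ₗ[ℂ] W₄) α u :=
  map_jP l m x hR (LinearMap.applyₗ u ∘ₗ eval S α).toAddMonoidHom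

theorem apply_jN {A : Type*} [Ring A] {R : ℤ → A → S} (hR : TruncN R) (l m : ℤ) (x : A) (α : ℂ)
    (u : W₃) : ((jN l m x R : S) : ℂ → W₃ →ₗ[ℂ] W₄) α u
      = jN l m x fun k y => (R k y : ℂ → W₃ →ₗ[ℂ] W₄) α u :=
  map_jN l m x hR (LinearMap.applyₗ u ∘ₗ eval S α).toAddMonoidHom

/-- `inner_jacobi` paired with the restricted dual. The combination appearing in its `jP` term is
the action of a on b_n ∘_l Φ, by `outer_jacobi` at m = 0. -/
theorem Y_jacobi {D : ModuleCategory} (hM₄ : InCategory D M₄.L0) : Jacobi 𝒱.Y H.Y H.Y H.Y := by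
  refine jacobi_iff.2 fun a b Φ l m n => ?_
  have tP : TruncP fun k x => H.Y k a (H.Y x b Φ) := fun k x => by
    obtain ⟨K, hK⟩ := H.exists_high b Φ
    filter_upwards [eventually_gt_atTop (K - x).toNat] with i hi
    rw [hK _ (by omega), map_zero]
  have tN : TruncN fun k x => H.Y x b (H.Y k a Φ) := by
    obtain ⟨K, hK⟩ := H.exists_high a Φ
    exact truncN_of_high (K := K) fun k hk x => by simp [hK k hk]
  have tR : TruncN fun k x => H.Y x (𝒱.Y k a b) Φ := by
    obtain ⟨K, hK⟩ := 𝒱.exists_high a b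
    exact truncN_of_high (K := K) fun k hk x => by simp [hK k hk]
  ext α u
  rw [apply_jR tR, Submodule.coe_sub, Pi.sub_apply, LinearMap.sub_apply, apply_jP tP, apply_jN tN,
    ← sub_eq_zero]
  refine eq_zero_of_restrictedDual hM₄.iSup_eq_top fun φ hφ => ?_
  have h := H.assocData hM₄ a b Φ u hφ
  have hi := h.inner_jacobi l m n α
  have ho : ∀ k y, φ ((H.Y k a (H.Y y b Φ) : ℂ → W₃ →ₗ[ℂ] W₄) α u)
      = φ ((H.Y y b (H.Y k a Φ) : ℂ → W₃ →ₗ[ℂ] W₄) α u)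
        + jR 0 k y fun k' y' => φ ((H.Y y' (𝒱.Y k' a b) Φ : ℂ → W₃ →ₗ[ℂ] W₄) α u) := by
    intro k y
    have := h.outer_jacobi k 0 y α
    rw [jR_zero] at this
    have hj := H.jacobi_apply a (H.Y y b Φ) u φ.toAddMonoidHom k 0 α
    rw [jR_zero] at hj
    exact hj.symm.trans this
  simp only [← ho] at hi
  have tP' : TruncP fun k y => (H.Y k a (H.Y y b Φ) : ℂ → W₃ →ₗ[ℂ] W₄) α u := fun k x => by
    filter_upwards [tP k x] with i hi
    rw [hi]; rfl
  have tN' : TruncN fun k y => (H.Y y b (H.Y k a Φ) : ℂ → W₃ →ₗ[ℂ] W₄) α u := fun k x => by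
    filter_upwards [tN k x] with i hi
    rw [hi]; rfl
  have tR' : TruncN fun k y => (H.Y y (𝒱.Y k a b) Φ : ℂ → W₃ →ₗ[ℂ] W₄) α u := fun k x => by
    filter_upwards [tR k x] with i hi
    rw [hi]; rfl
  have e1 := map_jP l m n tP' φ.toAddMonoidHom
  have e2 := map_jN l m n tN' φ.toAddMonoidHom
  have e3 := map_jR l m n tR' φ.toAddMonoidHom
  simp only [LinearMap.toAddMonoidHom_coe] at e1 e2 e3
  rw [map_sub, map_sub, e1, e2, e3, hi, sub_self]

/-- The weak module structure on `S`. -/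
def weakModule {D : ModuleCategory} (hM₄ : InCategory D M₄.L0) : WeakModule 𝒱 S where
  Y := H.Y
  vacuum := H.Y_vacuum
  truncated := H.Y_truncated
  derivative := H.Y_derivative
  jacobi := H.Y_jacobi hM₄

end ActionSpace

end LocalSystems

/-! ### The two intertwining operators through W -/

section Assembly

variable {V : Type v} [AddCommGroup V] [Module ℂ V] {𝒱 : VertexOperatorAlgebra V}
  {W₁ W₂ W₃ W₄ W₅ : Type u}
  [AddCommGroup W₁] [Module ℂ W₁] [AddCommGroup W₂] [Module ℂ W₂] [AddCommGroup W₃] [Module ℂ W₃]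
  [AddCommGroup W₄] [Module ℂ W₄] [AddCommGroup W₅] [Module ℂ W₅]
  {M₁ : WeakModule 𝒱 W₁} {M₂ : WeakModule 𝒱 W₂} {M₃ : WeakModule 𝒱 W₃} {M₄ : WeakModule 𝒱 W₄}
  {M₅ : WeakModule 𝒱 W₅} {I₁ : Intertwining M₁ M₅ M₄} {I₂ : Intertwining M₂ M₃ M₅}

theorem Intertwining.evZero (I : Intertwining M₁ M₂ M₃) (α : ℂ) (w₁ : W₁) (w₂ : W₂) :
    EvZero fun i : ℕ => I.mode (α + i) w₁ w₂ := by
  obtain ⟨N, hN⟩ := I.truncated α w₁ w₂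
  filter_upwards [eventually_gt_atTop N.toNat] with i hi
  simpa using hN i (by omega)

theorem Intertwining.jacobi_apply (I : Intertwining M₁ M₂ M₃) (a : V) (w₁ : W₁) (w₂ : W₂)
    (θ : W₃ →+ ℂ) (l m : ℤ) (α : ℂ) :
    jP l m α (fun k x => θ (M₃.Y k a (I.mode x w₁ w₂)))
      - jN l m α (fun k x => θ (I.mode x w₁ (M₂.Y k a w₂)))
      = jR l m α fun k x => θ (I.mode x (M₁.Y k a w₁) w₂) := by
  have := congrArg θ (jacobi_iff.1 I.jacobi a w₁ w₂ l m α)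
  rw [map_sub, map_jP, map_jN, map_jR] at this
  · exact this
  · obtain ⟨K, hK⟩ := M₁.exists_high a w₁
    exact truncN_of_high (K := K) fun k hk x => by simp [hK k hk]
  · obtain ⟨K, hK⟩ := M₂.exists_high a w₂
    exact truncN_of_high (K := K) fun k hk x => by simp [hK k hk]
  · intro k x
    filter_upwards [I.evZero x w₁ w₂] with i hi
    rw [hi, map_zero]

namespace PsiData

variable (H : PsiData I₁ I₂)

theorem evZero_fst (n : ℂ) (w₁ : W₁) (w₂ : W₂) :
    ∀ᶠ i : ℕ in atTop, ∀ m, H.psi (n + i) m w₁ w₂ = 0 := by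
  obtain ⟨N, hN⟩ := H.psi_truncated_fst n w₁ w₂
  filter_upwards [eventually_gt_atTop N.toNat] with i hi m
  simpa using hN i (by omega) m

theorem evZero_snd (n m : ℂ) (w₁ : W₁) (w₂ : W₂) (w₃ : W₃) :
    EvZero fun i : ℕ => H.psi n (m + i) w₁ w₂ w₃ := by
  obtain ⟨N, hN⟩ := H.psi_truncated_snd n m w₁ w₂ w₃
  filter_upwards [eventually_gt_atTop N.toNat] with i hi
  simpa using hN i (by omega)

theorem truncZ (w₁ : W₁) (w₂ : W₂) (w₃ : W₃) (θ : W₄ →+ ℂ) :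
    TruncZ fun n m => θ (H.psi n m w₁ w₂ w₃) := fun n => by
  filter_upwards [H.evZero_fst n w₁ w₂] with i hi m
  simp [hi m]

/-- All four correspondences are instances of the defining property of ψ; for the left insertion φ
is replaced by its composite with a_k, which stays in the restricted dual. -/
theorem assocData {D : ModuleCategory} (hM₄ : InCategory D M₄.L0) (a : V) (w₁ : W₁) (w₂ : W₂)
    (w₃ : W₃) {φ : Module.Dual ℂ W₄} (hφ : InRestrictedDual M₄.L0 φ) :
    AssocData e12Space
      (fun k p x => φ (M₄.Y k a (I₁.mode p w₁ (I₂.mode x w₂ w₃))))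
      (fun k p x => φ (I₁.mode p w₁ (M₅.Y k a (I₂.mode x w₂ w₃))))
      (fun k p x => φ (I₁.mode p w₁ (I₂.mode x w₂ (M₃.Y k a w₃))))
      (fun k p x => φ (I₁.mode p (M₁.Y k a w₁) (I₂.mode x w₂ w₃)))
      (fun k p x => φ (I₁.mode p w₁ (I₂.mode x (M₂.Y k a w₂) w₃)))
      (fun k n m => φ (M₄.Y k a (H.psi n m w₁ w₂ w₃)))
      (fun k n m => φ (H.psi n m w₁ w₂ (M₃.Y k a w₃)))
      (fun k n m => φ (H.psi n m (M₁.Y k a w₁) w₂ w₃))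
      (fun k n m => φ (H.psi n m w₁ (M₂.Y k a w₂) w₃)) where
  subst := isSubstitution_e12Space
  p_low := by
    obtain ⟨K, hK⟩ := M₄.comp_eq_zero hM₄ hφ a
    exact ⟨K, fun k hk => ⟨by ext p x; exact LinearMap.congr_fun (hK k hk) _,
      by ext p x; exact LinearMap.congr_fun (hK k hk) _⟩⟩
  n_high := by
    obtain ⟨K, hK⟩ := M₃.exists_high a w₃
    exact ⟨K, fun k hk => ⟨by ext; simp [hK k hk], by ext; simp [hK k hk]⟩⟩
  r1_high := by
    obtain ⟨K, hK⟩ := M₁.exists_high a w₁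
    exact ⟨K, fun k hk => ⟨by ext; simp [hK k hk], by ext; simp [hK k hk]⟩⟩
  r2_high := by
    obtain ⟨K, hK⟩ := M₂.exists_high a w₂
    exact ⟨K, fun k hk => ⟨by ext; simp [hK k hk], by ext; simp [hK k hk]⟩⟩
  m_high x := by
    obtain ⟨K, hK⟩ := M₅.exists_high a (I₂.mode x w₂ w₃)
    exact ⟨K, fun k hk p => by simp [hK k hk]⟩
  m_trunc p k x := by
    filter_upwards [I₂.evZero x w₂ w₃] with i hi
    simp [hi]
  pn_trunc n := by
    filter_upwards [H.evZero_fst n w₁ w₂] with i hi k α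
    simp [hi α]
  r1_trunc k := H.truncZ _ _ _ φ.toAddMonoidHom
  r2_trunc k := H.truncZ _ _ _ φ.toAddMonoidHom
  jac1 x l m p := I₁.jacobi_apply a w₁ (I₂.mode x w₂ w₃) φ.toAddMonoidHom l m p
  jac2 p l m x := I₂.jacobi_apply a w₂ w₃ (φ ∘ₗ I₁.mode p w₁).toAddMonoidHom l m x
  p_mem k := H.hasE12 w₁ w₂ w₃ (M₄.comp_mem_restrictedDual hφ k a)
  n_mem k := H.hasE12 w₁ w₂ (M₃.Y k a w₃) hφ
  r1_mem k := H.hasE12 (M₁.Y k a w₁) w₂ w₃ hφ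
  r2_mem k := H.hasE12 w₁ (M₂.Y k a w₂) w₃ hφ

/-- The series `ψ_n(w₁,w₂)`, as an element of `psiSpan`. -/
def mode (n : ℂ) : W₁ →ₗ[ℂ] W₂ →ₗ[ℂ] psiSpan I₁ I₂ :=
  LinearMap.mk₂ ℂ (fun w₁ w₂ => ⟨fun m => H.psi n m w₁ w₂,
      Submodule.subset_span ⟨w₁, w₂, _, n, H.isPsi w₁ w₂, rfl⟩⟩)
    (fun x y w₂ => by ext : 2; simp) (fun c x w₂ => by ext : 2; simp)
    (fun w₁ x y => by ext : 2; simp) (fun c w₁ x => by ext : 2; simp)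

theorem psiSpan_induction (H : PsiData I₁ I₂) {p : (Φ : ℂ → W₃ →ₗ[ℂ] W₄) → Prop}
    (hmem : ∀ n w₁ w₂, p fun m => H.psi n m w₁ w₂) (h0 : p 0) (hadd : ∀ Φ Φ', p Φ → p Φ' → p (Φ + Φ'))
    (hsmul : ∀ (c : ℂ) Φ, p Φ → p (c • Φ)) {Φ : ℂ → W₃ →ₗ[ℂ] W₄} (hΦ : Φ ∈ psiSpan I₁ I₂) : p Φ := by
  refine Submodule.span_induction (p := fun Φ _ => p Φ) ?_ h0 (fun Φ Φ' _ _ => hadd Φ Φ')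
    (fun c Φ _ => hsmul c Φ) hΦ
  rintro _ ⟨w₁, w₂, ψ, n, hψ, rfl⟩
  have : ψ n = fun m => H.psi n m w₁ w₂ := funext fun m => H.eq_psi_of_isPsi hψ n m
  rw [this]
  exact hmem n w₁ w₂

theorem mode_evZero (n : ℂ) (w₁ : W₁) (w₂ : W₂) : EvZero fun i : ℕ => H.mode (n + i) w₁ w₂ := by
  filter_upwards [H.evZero_fst n w₁ w₂] with i hi
  ext m : 2
  exact hi m

/-- The series `a_k ∘_l ψ_n(w₁,w₂)`. -/
def act (a : V) (n : ℂ) (w₁ : W₁) (w₂ : W₂) (k : ℤ) : psiSpan I₁ I₂ :=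
  H.mode n w₁ (M₂.Y k a w₂) + jR 0 k n fun k' n' => H.mode n' (M₁.Y k' a w₁) w₂

theorem truncN_mode (a : V) (w₁ : W₁) (w₂ : W₂) :
    TruncN fun k' n' => H.mode n' (M₁.Y k' a w₁) w₂ := by
  obtain ⟨K, hK⟩ := M₁.exists_high a w₁
  exact truncN_of_high (K := K) fun k hk x => by simp [hK k hk]

theorem act_apply (a : V) (n : ℂ) (w₁ : W₁) (w₂ : W₂) (k : ℤ) (m : ℂ) (w₃ : W₃) :
    (H.act a n w₁ w₂ k : ℂ → W₃ →ₗ[ℂ] W₄) m w₃ = H.psi n m w₁ (M₂.Y k a w₂) w₃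
      + jR 0 k n fun k' n' => H.psi n' m (M₁.Y k' a w₁) w₂ w₃ := by
  rw [act, Submodule.coe_add, Pi.add_apply, LinearMap.add_apply,
    ActionSpace.apply_jR (H.truncN_mode a w₁ w₂)]
  rfl

/-- Only finitely many a_j w₁ with j ≥ 0 are nonzero, and for each of them ψ_{n+k-j} vanishes once k
is large. -/
theorem act_high (a : V) (n : ℂ) (w₁ : W₁) (w₂ : W₂) : ∃ K : ℤ, ∀ k ≥ K, H.act a n w₁ w₂ k = 0 := by
  obtain ⟨K₁, hK₁⟩ := M₁.exists_high a w₁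
  obtain ⟨K₂, hK₂⟩ := M₂.exists_high a w₂
  have : ∀ᶠ i : ℕ in atTop, ∀ j ∈ Finset.range K₁.toNat, H.mode (n + i) (M₁.Y (j : ℤ) a w₁) w₂ = 0 :=
    (eventually_all_finset _).2 fun j _ => H.mode_evZero n (M₁.Y (j : ℤ) a w₁) w₂
  obtain ⟨B, hB⟩ := eventually_atTop.1 this
  refine ⟨max K₂ (B + K₁.toNat), fun k hk => ?_⟩
  rw [act, hK₂ k (le_of_max_le_left hk), map_zero, zero_add]
  refine bsum_eq_zero _ fun j => ?_
  rw [zero_add]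
  by_cases hj : j < K₁.toNat
  · have hk' := le_of_max_le_right hk
    have h1 := hB (k - j).toNat (by omega) j (Finset.mem_range.2 hj)
    have h2 : (((k - j).toNat : ℕ) : ℂ) = (k : ℂ) - j := by
      rw [← Int.cast_natCast, Int.toNat_of_nonneg (by omega)]
      push_cast; ring
    rw [h2, ← add_sub_assoc] at h1
    exact h1
  · dsimp only
    rw [hK₁ _ (by omega)]
    simp

/-- `outer_jacobi`, tested on the restricted dual. It shows that the span of the ψ_n is closed under
the action. -/
theorem isAction_act {D : ModuleCategory} (hM₄ : InCategory D M₄.L0) (a : V) (n : ℂ) (w₁ : W₁)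
    (w₂ : W₂) : IsAction M₃ M₄ (psiSpan I₁ I₂) a (fun m => H.psi n m w₁ w₂)
      fun k => H.act a n w₁ w₂ k where
  mem k := (H.act a n w₁ w₂ k).2
  high := by
    obtain ⟨K, hK⟩ := H.act_high a n w₁ w₂
    exact ⟨K, fun k hk => by rw [hK k hk]; rfl⟩
  jacobi u l m α := by
    rw [← sub_eq_zero]
    refine eq_zero_of_restrictedDual hM₄.iSup_eq_top fun φ hφ => ?_
    have ho := (H.assocData hM₄ a w₁ w₂ u hφ).outer_jacobi l m n α
    have tP : TruncP fun k y => M₄.Y k a (H.psi n y w₁ w₂ u) :=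
      truncP_comp M₄ (Φ := fun m => H.psi n m w₁ w₂) (fun α u => H.evZero_snd n α w₁ w₂ u) a u
    have tN : TruncN fun k y => H.psi n y w₁ w₂ (M₃.Y k a u) :=
      truncN_comp M₃ (fun m => H.psi n m w₁ w₂) a u
    have tR : TruncN fun k y => (H.act a n w₁ w₂ k : ℂ → W₃ →ₗ[ℂ] W₄) y u := by
      obtain ⟨K, hK⟩ := H.act_high a n w₁ w₂
      exact truncN_of_high (K := K) fun k hk x => by rw [hK k hk]; rfl
    have e1 := map_jP l m α tP φ.toAddMonoidHom
    have e2 := map_jN l m α tN φ.toAddMonoidHom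
    have e3 := map_jR l m α tR φ.toAddMonoidHom
    simp only [LinearMap.toAddMonoidHom_coe] at e1 e2 e3
    rw [map_sub, map_sub, e1, e2, e3, ho, sub_eq_zero]
    refine bsum_congr _ fun i => ?_
    dsimp only
    rw [act_apply, map_add]
    congr 1
    refine (map_jR _ _ _ (fun k x => ?_) φ.toAddMonoidHom).symm
    filter_upwards [H.truncN_mode a w₁ w₂ k x] with j hj
    have := congrArg (fun Φ : psiSpan I₁ I₂ => (Φ : ℂ → W₃ →ₗ[ℂ] W₄) (α + (m : ℂ) - (i : ℂ)) u) hj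
    exact this

theorem actionSpace (H : PsiData I₁ I₂) {D : ModuleCategory} (hM₄ : InCategory D M₄.L0) :
    ActionSpace M₃ M₄ (psiSpan I₁ I₂) := by
  have trunc : ∀ Φ ∈ psiSpan I₁ I₂, ∀ α u, EvZero fun i : ℕ => Φ (α + i) u := fun Φ hΦ => by
    refine H.psiSpan_induction (p := fun Φ => ∀ α u, EvZero fun i : ℕ => Φ (α + i) u) ?_ ?_ ?_ ?_ hΦ
    · intro n w₁ w₂ α u
      exact H.evZero_snd n α w₁ w₂ u
    · intro α u
      exact Eventually.of_forall fun i => rfl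
    · intro Φ Φ' h h' α u
      exact (h α u).add (h' α u)
    · intro c Φ h α u
      filter_upwards [h α u] with i hi
      simp [hi]
  refine ⟨trunc, fun a Φ hΦ => ?_⟩
  have := H.psiSpan_induction (p := fun Φ => (∀ α u, EvZero fun i : ℕ => Φ (α + i) u) ∧
    ∃ Θ, IsAction M₃ M₄ (psiSpan I₁ I₂) a Φ Θ) ?_ ?_ ?_ ?_ hΦ
  · exact this.2
  · intro n w₁ w₂
    exact ⟨fun α u => H.evZero_snd n α w₁ w₂ u, _, H.isAction_act hM₄ a n w₁ w₂⟩
  · refine ⟨fun α u => Eventually.of_forall fun i => rfl, 0, fun k => Submodule.zero_mem _,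
      ⟨0, fun k _ => rfl⟩, fun u l m α => ?_⟩
    rw [jP_eq_zero _ _ _ fun i => by simp, jN_eq_zero _ _ _ fun i y => rfl,
      jR_eq_zero _ _ _ fun i y => rfl, sub_zero]
  · rintro Φ Φ' ⟨h, Θ, hΘ⟩ ⟨h', Θ', hΘ'⟩
    exact ⟨fun α u => (h α u).add (h' α u), _, hΘ.add_right h h' hΘ'⟩
  · rintro c Φ ⟨h, Θ, hΘ⟩
    refine ⟨fun α u => ?_, _, hΘ.smul_right h c⟩
    filter_upwards [h α u] with i hi
    simp [hi]

theorem Y_mode {D : ModuleCategory} (hM₄ : InCategory D M₄.L0) (k : ℤ) (a : V) (n : ℂ) (w₁ : W₁)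
    (w₂ : W₂) : (H.actionSpace hM₄).Y k a (H.mode n w₁ w₂) = H.act a n w₁ w₂ k :=
  Subtype.ext ((H.actionSpace hM₄).Y_eq (Φ := H.mode n w₁ w₂) (H.isAction_act hM₄ a n w₁ w₂) k)

/-- `inner_jacobi`, tested on the restricted dual, with `Y_mode` identifying its `jP` term as the
action on ψ_n(w₁,w₂). -/
theorem mode_jacobi {D : ModuleCategory} (hM₄ : InCategory D M₄.L0) :
    Jacobi M₁.Y M₂.Y (H.actionSpace hM₄).Y H.mode := by
  refine jacobi_iff.2 fun a w₁ w₂ l m n => ?_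
  have tP : TruncP fun k x => (H.actionSpace hM₄).Y k a (H.mode x w₁ w₂) := fun k x => by
    filter_upwards [H.mode_evZero x w₁ w₂] with i hi
    rw [hi, map_zero]
  have tN : TruncN fun k x => H.mode x w₁ (M₂.Y k a w₂) := by
    obtain ⟨K, hK⟩ := M₂.exists_high a w₂
    exact truncN_of_high (K := K) fun k hk x => by simp [hK k hk]
  have tR := H.truncN_mode a w₁ w₂
  ext α u
  rw [ActionSpace.apply_jR tR, Submodule.coe_sub, Pi.sub_apply, LinearMap.sub_apply,
    ActionSpace.apply_jP tP, ActionSpace.apply_jN tN, ← sub_eq_zero]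
  refine eq_zero_of_restrictedDual hM₄.iSup_eq_top fun φ hφ => ?_
  have hi := (H.assocData hM₄ a w₁ w₂ u hφ).inner_jacobi l m n α
  have ho : ∀ k n, φ (((H.actionSpace hM₄).Y k a (H.mode n w₁ w₂) : ℂ → W₃ →ₗ[ℂ] W₄) α u)
      = φ (H.psi n α w₁ (M₂.Y k a w₂) u)
        + jR 0 k n fun k' n' => φ (H.psi n' α (M₁.Y k' a w₁) w₂ u) := by
    intro k n
    rw [H.Y_mode hM₄, act_apply, map_add]
    congr 1
    refine map_jR _ _ _ (fun k x => ?_) φ.toAddMonoidHom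
    filter_upwards [tR k x] with j hj
    have := congrArg (fun Φ : psiSpan I₁ I₂ => (Φ : ℂ → W₃ →ₗ[ℂ] W₄) α u) hj
    exact this
  simp only [← ho] at hi
  have e1 := map_jP l m n
    (P := fun k y => ((H.actionSpace hM₄).Y k a (H.mode y w₁ w₂) : ℂ → W₃ →ₗ[ℂ] W₄) α u)
    (fun k x => by filter_upwards [tP k x] with i hi; rw [hi]; rfl) φ.toAddMonoidHom
  have e2 := map_jN l m n
    (P := fun k y => (H.mode y w₁ (M₂.Y k a w₂) : ℂ → W₃ →ₗ[ℂ] W₄) α u)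
    (fun k x => by filter_upwards [tN k x] with i hi; rw [hi]; rfl) φ.toAddMonoidHom
  have e3 := map_jR l m n
    (P := fun k y => (H.mode y (M₁.Y k a w₁) w₂ : ℂ → W₃ →ₗ[ℂ] W₄) α u)
    (fun k x => by filter_upwards [tR k x] with i hi; rw [hi]; rfl) φ.toAddMonoidHom
  simp only [LinearMap.toAddMonoidHom_coe] at e1 e2 e3
  rw [map_sub, map_sub, e1, e2, e3, sub_eq_zero]
  exact hi

/-- The intertwining operator `w₁ ⊗ w₂ ↦ ∑ ψ_n(w₁,w₂) z^{-n-1}`. -/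
def psiIntertwining {D : ModuleCategory} (hM₄ : InCategory D M₄.L0) :
    Intertwining M₁ M₂ ((H.actionSpace hM₄).weakModule hM₄) where
  mode := H.mode
  truncated n w₁ w₂ := by
    obtain ⟨N, hN⟩ := H.psi_truncated_fst n w₁ w₂
    exact ⟨N, fun i hi => by ext m : 2; exact hN i hi m⟩
  derivative n w₁ w₂ := by
    ext m : 2
    exact H.psi_derivative_fst n m w₁ w₂
  jacobi := H.mode_jacobi hM₄

/-- On ψ_n(w₁,w₂) the action of ω₀ is the sum of the two L(-1)-derivative formulas; their ∂/∂z₀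
parts cancel and ∂/∂z₂ remains. -/
theorem Y_conformal_zero {D : ModuleCategory} (hM₄ : InCategory D M₄.L0) (α : ℂ)
    (Φ : psiSpan I₁ I₂) :
    ((H.actionSpace hM₄).Y 0 𝒱.conformal Φ : ℂ → W₃ →ₗ[ℂ] W₄) α
      = (-α) • (Φ : ℂ → W₃ →ₗ[ℂ] W₄) (α - 1) := by
  obtain ⟨Φ, hΦ⟩ := Φ
  have := H.psiSpan_induction (p := fun Φ => ∃ hΦ : Φ ∈ psiSpan I₁ I₂,
    ((H.actionSpace hM₄).Y 0 𝒱.conformal ⟨Φ, hΦ⟩ : ℂ → W₃ →ₗ[ℂ] W₄) α = (-α) • Φ (α - 1))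
    ?_ ?_ ?_ ?_ hΦ
  · exact this.2
  · intro n w₁ w₂
    refine ⟨(H.mode n w₁ w₂).2, ?_⟩
    have h := H.Y_mode hM₄ 0 𝒱.conformal n w₁ w₂
    have h' : (⟨fun m => H.psi n m w₁ w₂, (H.mode n w₁ w₂).2⟩ : psiSpan I₁ I₂) = H.mode n w₁ w₂ := rfl
    rw [h', h]
    ext u
    rw [act_apply, jR_zero, H.psi_derivative_fst, H.psi_derivative_snd]
    simp only [LinearMap.sub_apply, LinearMap.smul_apply]
    module
  · refine ⟨Submodule.zero_mem _, ?_⟩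
    have h' : (⟨0, Submodule.zero_mem _⟩ : psiSpan I₁ I₂) = 0 := rfl
    rw [h', map_zero]
    simp
  · rintro Φ Φ' ⟨hΦ, h⟩ ⟨hΦ', h'⟩
    refine ⟨Submodule.add_mem _ hΦ hΦ', ?_⟩
    have e : (⟨Φ + Φ', Submodule.add_mem _ hΦ hΦ'⟩ : psiSpan I₁ I₂) = ⟨Φ, hΦ⟩ + ⟨Φ', hΦ'⟩ := rfl
    rw [e, map_add, Submodule.coe_add, Pi.add_apply, h, h', Pi.add_apply, smul_add]
  · rintro c Φ ⟨hΦ, h⟩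
    refine ⟨Submodule.smul_mem _ c hΦ, ?_⟩
    have e : (⟨c • Φ, Submodule.smul_mem _ c hΦ⟩ : psiSpan I₁ I₂) = c • ⟨Φ, hΦ⟩ := rfl
    rw [e, map_smul, Submodule.coe_smul, Pi.smul_apply, h, Pi.smul_apply, smul_comm]

/-- The intertwining operator `Φ ⊗ w₃ ↦ Φ(z)w₃`. -/
def evalIntertwining {D : ModuleCategory} (hM₄ : InCategory D M₄.L0) :
    Intertwining ((H.actionSpace hM₄).weakModule hM₄) M₃ M₄ where
  mode := ActionSpace.eval (psiSpan I₁ I₂)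
  truncated := (H.actionSpace hM₄).eval_truncated
  derivative α Φ w₃ := LinearMap.congr_fun (H.Y_conformal_zero hM₄ α Φ) w₃
  jacobi := (H.actionSpace hM₄).eval_jacobi

theorem inCategory {D D' : ModuleCategory} (hM₄ : InCategory D' M₄.L0)
    (hW : PsiSpanInCategory D I₁ I₂) :
    InCategory D ((H.actionSpace hM₄).weakModule hM₄).L0 := by
  obtain ⟨T, hT, hD⟩ := hW
  have : T = ((H.actionSpace hM₄).weakModule hM₄).L0 := by
    ext Φ α u
    rw [hT]
    exact ((H.actionSpace hM₄).Y_apply_circCoeff 1 𝒱.conformal Φ α u).symm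
  rwa [← this]

end PsiData

/-- Composition of an intertwining operator with a homomorphism in the first argument. -/
def Intertwining.compLeft {M : WeakModule 𝒱 W₅} (I : Intertwining M₁ M₂ M₃) {g : W₅ →ₗ[ℂ] W₁}
    (hg : IsHom M M₁ g) : Intertwining M M₂ M₃ where
  mode α := I.mode α ∘ₗ g
  truncated α w w₂ := I.truncated α (g w) w₂
  derivative α w w₂ := by
    rw [LinearMap.comp_apply, hg, I.derivative, LinearMap.comp_apply]
  jacobi a w w₂ l m α := by
    have := I.jacobi a (g w) w₂ l m α
    have e : ∀ n, g (M.Y n a w) = M₁.Y n a (g w) := fun n => hg n a w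
    simpa only [LinearMap.comp_apply, e] using this

end Assembly

end VOA

end

theorem proposition3p10 {V : Type v} [AddCommGroup V] [Module ℂ V]
    (𝒱 : VOA.VertexOperatorAlgebra V) (D : VOA.ModuleCategory)
    {W₁ W₂ W₃ W₁₂ W₂₃ W₁₂_₃ W₁_₂₃ : Type u}
    [AddCommGroup W₁] [Module ℂ W₁] [AddCommGroup W₂] [Module ℂ W₂]
    [AddCommGroup W₃] [Module ℂ W₃] [AddCommGroup W₁₂] [Module ℂ W₁₂]
    [AddCommGroup W₂₃] [Module ℂ W₂₃] [AddCommGroup W₁₂_₃] [Module ℂ W₁₂_₃]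
    [AddCommGroup W₁_₂₃] [Module ℂ W₁_₂₃]
    (M₁ : VOA.WeakModule 𝒱 W₁) (M₂ : VOA.WeakModule 𝒱 W₂) (M₃ : VOA.WeakModule 𝒱 W₃)
    (M₁₂ : VOA.WeakModule 𝒱 W₁₂) (M₂₃ : VOA.WeakModule 𝒱 W₂₃)
    (M₁₂_₃ : VOA.WeakModule 𝒱 W₁₂_₃) (M₁_₂₃ : VOA.WeakModule 𝒱 W₁_₂₃)
    (hM₁ : VOA.InCategory D M₁.L0) (hM₂ : VOA.InCategory D M₂.L0)
    (hM₃ : VOA.InCategory D M₃.L0)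
    (F₁₂ : VOA.Intertwining M₁ M₂ M₁₂) (F₁₂_₃ : VOA.Intertwining M₁₂ M₃ M₁₂_₃)
    (F₂₃ : VOA.Intertwining M₂ M₃ M₂₃) (F₁_₂₃ : VOA.Intertwining M₁ M₂₃ M₁_₂₃)
    (hF₁₂ : VOA.IsTensorProduct D F₁₂) (hF₁₂_₃ : VOA.IsTensorProduct D F₁₂_₃)
    (hF₂₃ : VOA.IsTensorProduct D F₂₃) (hF₁_₂₃ : VOA.IsTensorProduct D F₁_₂₃)
    (hconv : VOA.ConvergenceExtension F₁_₂₃ F₂₃)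
    (hW : VOA.PsiSpanInCategory D F₁_₂₃ F₂₃) :
    ∃ f : W₁₂_₃ →ₗ[ℂ] W₁_₂₃, VOA.IsHom M₁₂_₃ M₁_₂₃ f ∧
      ∀ (w₁ : W₁) (w₂ : W₂) (w₃ : W₃) (φ : Module.Dual ℂ W₁_₂₃),
        VOA.InRestrictedDual M₁_₂₃.L0 φ →
        VOA.HasE12 (VOA.productCoeff F₁_₂₃ F₂₃ w₁ w₂ w₃ φ)
          (VOA.iterateCoeff F₁₂_₃ F₁₂ w₁ w₂ w₃ (φ ∘ₗ f)) := by
  have hM₄ := hF₁_₂₃.mem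
  have H : VOA.PsiData F₁_₂₃ F₂₃ := ⟨hM₁.iSup_eq_top, hM₂.iSup_eq_top, hM₃.iSup_eq_top,
    hM₄.iSup_eq_top, hM₄.lower, hconv⟩
  -- The hypothesis that W lies in the category is what allows universality of F₁₂ to be applied to
  -- it.
  obtain ⟨g, ⟨hg, hgF⟩, -⟩ := hF₁₂.universal (VOA.psiSpan F₁_₂₃ F₂₃)
    ((H.actionSpace hM₄).weakModule hM₄) (H.inCategory hM₄ hW) (H.psiIntertwining hM₄)
  obtain ⟨f, ⟨hf, hfF⟩, -⟩ := hF₁₂_₃.universal W₁_₂₃ M₁_₂₃ hM₄ ((H.evalIntertwining hM₄).compLeft hg)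
  refine ⟨f, hf, fun w₁ w₂ w₃ φ hφ => ?_⟩
  convert H.hasE12 w₁ w₂ w₃ hφ using 3 with n m
  rw [VOA.iterateCoeff, LinearMap.comp_apply, ← hfF]
  -- After both factorizations the coefficient of the iterate is the m-th coefficient of the series
  -- g(F₁₂ n w₁ w₂) = ψ_n(w₁,w₂), applied to w₃.
  have : g (F₁₂.mode n w₁ w₂) = H.mode n w₁ w₂ := (hgF n w₁ w₂).symm
  exact congrArg (fun Φ : VOA.psiSpan F₁_₂₃ F₂₃ => φ ((Φ : ℂ → W₃ →ₗ[ℂ] W₁_₂₃) m w₃)) this
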